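/- **Setting.** Let $n,d\ge 1$ (sequence length and head dimension), $A_1,A_2,A_3,\mathrm{d}O\in\mathbb R^{n\times d}$ and $X,Y\in\mathbb R^{d\times d}$. Put $A=\exp(A_1XA_2^\top)$ (entrywise), $l=A\mathbf 1_n$, $f=\operatorname{diag}(l)^{-1}A$, $h=A_3Y$, $O=fh$, $q=\mathrm{d}O\,h^\top$, and let $p\in\mathbb R^{n\times n}$ have the rows $p_i=(\operatorname{diag}(f_i)-f_if_i^\top)q_i$, where $f_i,q_i$ are the rows of $f,q$ written as columns. The attention backward gradient is $\frac{\mathrm dL}{\mathrm dX}=A_1^\top p A_2\in\mathbb R^{d\times d}$. **Pebble game.** Let $G$ be a finite directed acyclic graph. Input nodes are the nodes without parents, output nodes those without children. Initially exactly the input nodes carry a blue pebble, and there is no red pebble. The moves are: *input*, replace a blue pebble on a node by a red one; *output*, replace a red pebble on a node by a blue one; *compute*, place a red pebble on a node that is not an input node and all of whose parents have red pebbles; *delete*, remove a pebble. The I/O complexity $Q(G,M)\in\mathbb N\cup\{\infty\}$ is the least number of input and output moves with which blue pebbles can be placed on all output nodes while never more than $M$ red pebbles are on the graph ($\infty$ if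 this is impossible). **Algorithms.** An algorithm is a finite directed acyclic graph in which each node is either an input scalar (an entry of $A_1,A_2,A_3,\mathrm dO,X,Y$, or of the forward-pass quantities $l,O$), or a sum or product of two nodes, or any other function of one or two nodes. A matrix product $PQ$ of matrices of nodes is computed by *standard matrix multiplication* if each entry $(PQ)_{ij}$ is the root of a binary summation tree (of any shape) whose leaves are product nodes $P_{ik}Q_{kj}$, one for each $k$. An *attention backward algorithm under standard matrix multiplication* is an algorithm whose output nodes are exactly the entries of $A_1^\top pA_2$, for all values of the data, and which computes $A_1XA_2^\top$, either as $(A_1X)A_2^\top$ or as $A_1(XA_2^\top)$, with both products done by standard matrix multiplication. **Theorem 1.1.** Let $$B(n,d,M)=\min\left\{\frac{n^2d^2+nd^3}{M},\ \frac{n^2d+nd^2}{\sqrt M}\right\}.$$ The I/O complexity of attention backward computation under standard matrix multiplication with cache size $M$ is $\Theta(B(n,d,M))$. Precisely, there are absolute constants $c,C>0$ such that: 1. (Lower bound.) For all integers $n,d,M\ge 1$, every attention backward algorithm $G$ under standard matrix multiplication satisfies $Q(G,M)\ge c\,B(n,d,M)$. 2. (Upper bound.) For all integers $n,d,M$ with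 $M\ge 3$, $M\le nd$ and $M\le n^2$, there is an attention backward algorithm $G$ under standard matrix multiplication with $Q(G,M)\le C\,B(n,d,M)$. It can be chosen to take only the entries of the six matrices as inputs (neither $l$ nor $O$), and to follow the computational graph $S=A_1X$, $Z=SA_2^\top$, $E=\exp Z$, $l=E\mathbf 1_n$, $f=\operatorname{diag}(l)^{-1}E$, $h=A_3Y$, $q=\mathrm dO\,h^\top$, $w=f\circ q$, $v=w\mathbf 1_n$, $p=w-\operatorname{diag}(v)f$, $T=A_1^\top p$, $g=TA_2$, with all six products of two matrices among $S,Z,h,q,T,g$ done by standard matrix multiplication and the row sums $l,v$ by summation trees. -/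

import Mathlib

open scoped ENNReal Matrix

/-! ### Directed acyclic graphs and the red-blue pebble game -/

/-- A finite directed acyclic graph, given by the finite set of parents of each node. -/
structure Dag where
  V : Type
  [fintypeV : Fintype V]
  [decEqV : DecidableEq V]
  parents : V → Finset V
  acyclic : WellFounded (fun u v : V => u ∈ parents v)

attribute [instance] Dag.fintypeV Dag.decEqV

namespace Dag

/-- An input node is a node without parents. -/
def IsInput (G : Dag) (v : G.V) : Prop := G.parents v = ∅

/-- An output node is a node without children. -/
def IsOutput (G : Dag) (v : G.V) : Prop := ∀ w, v ∉ G.parents w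

instance (G : Dag) (v : G.V) : Decidable (G.IsInput v) :=
  inferInstanceAs (Decidable (G.parents v = ∅))

/-- A position of the game: the nodes that carry a red pebble (cache) and the nodes that carry
a blue pebble (memory). A node may carry both. -/
structure Position (G : Dag) where
  red : Finset G.V
  blue : Finset G.V

/-- At the start exactly the input nodes carry a blue pebble, and there is no red pebble. -/
def start (G : Dag) : G.Position where
  red := ∅
  blue := Finset.univ.filter fun v => G.IsInput v

/-- `G.Step s t κ`: a legal move leads from `s` to `t`, and `κ` is its I/O cost. Input and output
replace a pebble by one of the other colour. Only nodes that have parents can be computed: an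
input node gets into the cache only by an input operation. -/
inductive Step (G : Dag) : G.Position → G.Position → ℕ → Prop
  | input (s : G.Position) (v : G.V) (h : v ∈ s.blue) :
      Step G s ⟨insert v s.red, s.blue.erase v⟩ 1
  | output (s : G.Position) (v : G.V) (h : v ∈ s.red) :
      Step G s ⟨s.red.erase v, insert v s.blue⟩ 1
  | compute (s : G.Position) (v : G.V) (hv : ¬ G.IsInput v) (h : G.parents v ⊆ s.red) :
      Step G s ⟨insert v s.red, s.blue⟩ 0
  | deleteRed (s : G.Position) (v : G.V) : Step G s ⟨s.red.erase v, s.blue⟩ 0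
  | deleteBlue (s : G.Position) (v : G.V) : Step G s ⟨s.red, s.blue.erase v⟩ 0

/-- `G.Play M s q`: the position `s` can be reached from the start with exactly `q` input and
output operations, never having more than `M` red pebbles on the graph. -/
inductive Play (G : Dag) (M : ℕ) : G.Position → ℕ → Prop
  | nil : Play G M G.start 0
  | snoc {s t : G.Position} {q κ : ℕ} (h : Play G M s q) (hst : G.Step s t κ)
      (ht : t.red.card ≤ M) : Play G M t (q + κ)

/-- The I/O complexity `Q(G, M)`: the least number of input and output operations in a play that
ends with blue pebbles on all output nodes (`⊤` if there is no such play). -/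
noncomputable def ioComplexity (G : Dag) (M : ℕ) : ℕ∞ :=
  ⨅ (q : ℕ) (_ : ∃ s, G.Play M s q ∧ ∀ v, G.IsOutput v → v ∈ s.blue), (q : ℕ∞)

end Dag

/-! ### Algorithms as computational graphs -/

/-- What is computed at a node: an input entry, a sum or a product of two nodes, or any other
scalar operation on one or two nodes. -/
inductive Gate (ι V : Type) where
  | input (x : ι)
  | add (u w : V)
  | mul (u w : V)
  | unary (φ : ℝ → ℝ) (u : V)
  | binary (φ : ℝ → ℝ → ℝ) (u w : V)

/-- The nodes that a gate reads. -/
def Gate.parents {ι V : Type} [DecidableEq V] : Gate ι V → Finset V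
  | .input _ => ∅
  | .add u w => {u, w}
  | .mul u w => {u, w}
  | .unary _ u => {u}
  | .binary _ u w => {u, w}

/-- A computational graph over the input entries `ι`: a finite acyclic graph of gates. -/
structure Circuit (ι : Type) where
  V : Type
  [fintypeV : Fintype V]
  [decEqV : DecidableEq V]
  gate : V → Gate ι V
  acyclic : WellFounded (fun u v : V => u ∈ (gate v).parents)

attribute [instance] Circuit.fintypeV Circuit.decEqV

namespace Circuit

variable {ι : Type}

/-- The directed acyclic graph of a computational graph. -/
def dag (G : Circuit ι) : Dag where
  V := G.V
  parents := fun v => (G.gate v).parents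
  acyclic := G.acyclic

/-- The value computed at each node when the input entries have the values `x`. -/
noncomputable def eval (G : Circuit ι) (x : ι → ℝ) : G.V → ℝ :=
  G.acyclic.fix fun v val =>
    match h : G.gate v with
    | .input i => x i
    | .add u w => val u (by simp [h, Gate.parents]) + val w (by simp [h, Gate.parents])
    | .mul u w => val u (by simp [h, Gate.parents]) * val w (by simp [h, Gate.parents])
    | .unary φ u => φ (val u (by simp [h, Gate.parents]))
    | .binary φ u w => φ (val u (by simp [h, Gate.parents])) (val w (by simp [h, Gate.parents]))

/-- `G.IsSum v s`: the node `v` is the root of a binary summation tree, of any shape, whose leaves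
are the nodes in `s`. -/
inductive IsSum (G : Circuit ι) : G.V → Multiset G.V → Prop
  | leaf (v : G.V) : IsSum G v {v}
  | add {v u w : G.V} {s t : Multiset G.V} (hv : G.gate v = .add u w)
      (hu : IsSum G u s) (hw : IsSum G w t) : IsSum G v (s + t)

/-- The node `v` is the product of the nodes `u` and `w`. -/
def IsProd (G : Circuit ι) (v u w : G.V) : Prop :=
  G.gate v = .mul u w ∨ G.gate v = .mul w u

/-- Standard matrix multiplication `R = P Q` of matrices of nodes: for each entry there are
product nodes `P i k * Q k j`, one for each `k`, and `R i j` is the root of a summation tree over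
them. -/
def StdMul (G : Circuit ι) {a b c : ℕ} (P : Matrix (Fin a) (Fin b) G.V)
    (Q : Matrix (Fin b) (Fin c) G.V) (R : Matrix (Fin a) (Fin c) G.V) : Prop :=
  ∀ i j, ∃ m : Fin b → G.V, (∀ k, G.IsProd (m k) (P i k) (Q k j)) ∧
    G.IsSum (R i j) (Finset.univ.val.map m)

end Circuit

/-! ### The attention backward gradient -/

/-- The data of the attention backward computation: the layer inputs `A₁, A₂, A₃`, the upstream
gradient `dO`, and the weights `X, Y`. -/
structure AttnData (n d : ℕ) where
  A₁ : Matrix (Fin n) (Fin d) ℝ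
  A₂ : Matrix (Fin n) (Fin d) ℝ
  A₃ : Matrix (Fin n) (Fin d) ℝ
  dO : Matrix (Fin n) (Fin d) ℝ
  X : Matrix (Fin d) (Fin d) ℝ
  Y : Matrix (Fin d) (Fin d) ℝ

namespace AttnData

variable {n d : ℕ} (D : AttnData n d)

/-- `A(X) = exp(A₁ X A₂ᵀ)`, entrywise. -/
noncomputable def A : Matrix (Fin n) (Fin n) ℝ := (D.A₁ * D.X * D.A₂ᵀ).map Real.exp

/-- The softmax normalizing vector `l(X) = A(X) 1`. -/
noncomputable def l : Fin n → ℝ := D.A *ᵥ 1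

/-- The attention matrix `f(X)`, with rows `l(X)ᵢ⁻¹ A(X)ᵢ`. -/
noncomputable def f : Matrix (Fin n) (Fin n) ℝ := Matrix.of fun i => (D.l i)⁻¹ • D.A i

/-- `h(Y) = A₃ Y`. -/
noncomputable def h : Matrix (Fin n) (Fin d) ℝ := D.A₃ * D.Y

/-- The output `O = f(X) h(Y)` of the forward computation. -/
noncomputable def O : Matrix (Fin n) (Fin d) ℝ := D.f * D.h

/-- `q(Y) = dO h(Y)ᵀ`. -/
noncomputable def q : Matrix (Fin n) (Fin n) ℝ := D.dO * D.hᵀ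

/-- The matrix `p(X)`, with rows `(diag(fᵢ) - fᵢ fᵢᵀ) qᵢ`. -/
noncomputable def p : Matrix (Fin n) (Fin n) ℝ :=
  Matrix.of fun i => (Matrix.diagonal (D.f i) - Matrix.vecMulVec (D.f i) (D.f i)) *ᵥ D.q i

/-- The attention backward gradient `dL/dX = A₁ᵀ p(X) A₂`. -/
noncomputable def grad : Matrix (Fin d) (Fin d) ℝ := D.A₁ᵀ * D.p * D.A₂

end AttnData

/-- The scalars that an attention backward algorithm may find in memory: the entries of the six
matrices, and the quantities `l` and `O` left by the forward computation. -/
inductive AttnInput (n d : ℕ) where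
  | A₁ (i : Fin n) (k : Fin d)
  | A₂ (i : Fin n) (k : Fin d)
  | A₃ (i : Fin n) (k : Fin d)
  | dO (i : Fin n) (k : Fin d)
  | X (k k' : Fin d)
  | Y (k k' : Fin d)
  | l (i : Fin n)
  | O (i : Fin n) (k : Fin d)

/-- The value of each input scalar. -/
noncomputable def AttnData.value {n d : ℕ} (D : AttnData n d) : AttnInput n d → ℝ
  | .A₁ i k => D.A₁ i k
  | .A₂ i k => D.A₂ i k
  | .A₃ i k => D.A₃ i k
  | .dO i k => D.dO i k
  | .X k k' => D.X k k'
  | .Y k k' => D.Y k k'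
  | .l i => D.l i
  | .O i k => D.O i k

namespace Circuit

variable {n d : ℕ}

/-- The output nodes of the graph are the entries of the attention backward gradient, for all
values of the data. -/
def ComputesAttnGrad (G : Circuit (AttnInput n d)) : Prop :=
  ∃ g : Matrix (Fin d) (Fin d) G.V,
    (∀ v, G.dag.IsOutput v ↔ ∃ a b, g a b = v) ∧
    ∀ (D : AttnData n d) (a b : Fin d), G.eval D.value (g a b) = D.grad a b

/-- `A₁ X A₂ᵀ` is computed by standard matrix multiplication, as `(A₁ X) A₂ᵀ` or as
`A₁ (X A₂ᵀ)`. -/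
def StdScores (G : Circuit (AttnInput n d)) : Prop :=
  ∃ (a₁ a₂ : Matrix (Fin n) (Fin d) G.V) (x : Matrix (Fin d) (Fin d) G.V)
    (Z : Matrix (Fin n) (Fin n) G.V),
    (∀ i k, G.gate (a₁ i k) = .input (.A₁ i k)) ∧
    (∀ i k, G.gate (a₂ i k) = .input (.A₂ i k)) ∧
    (∀ k k', G.gate (x k k') = .input (.X k k')) ∧
    ((∃ S : Matrix (Fin n) (Fin d) G.V, G.StdMul a₁ x S ∧ G.StdMul S a₂ᵀ Z) ∨
      (∃ R : Matrix (Fin d) (Fin n) G.V, G.StdMul x a₂ᵀ R ∧ G.StdMul a₁ R Z))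

/-- An attention backward algorithm using standard matrix multiplication: it computes the
gradient, and it computes `A₁ X A₂ᵀ` by standard matrix multiplication. The remaining computation
is arbitrary. -/
def IsAttnBackward (G : Circuit (AttnInput n d)) : Prop :=
  G.ComputesAttnGrad ∧ G.StdScores

/-- The full computational graph of attention backward, with each of the six matrix products done
by standard matrix multiplication, from the six matrices alone: `S = A₁ X`, `Z = S A₂ᵀ`,
`E = exp Z`, `l = E 1`, `f = diag(l)⁻¹ E`, `h = A₃ Y`, `q = dO hᵀ`, `w = f ∘ q`, `v = w 1`,
`r = diag(v) f`, `p = w - r`, `T = A₁ᵀ p`, `g = T A₂`. -/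
structure StdLayout (G : Circuit (AttnInput n d)) where
  a₁ : Matrix (Fin n) (Fin d) G.V
  a₂ : Matrix (Fin n) (Fin d) G.V
  a₃ : Matrix (Fin n) (Fin d) G.V
  dO : Matrix (Fin n) (Fin d) G.V
  x : Matrix (Fin d) (Fin d) G.V
  y : Matrix (Fin d) (Fin d) G.V
  S : Matrix (Fin n) (Fin d) G.V
  Z : Matrix (Fin n) (Fin n) G.V
  E : Matrix (Fin n) (Fin n) G.V
  l : Fin n → G.V
  f : Matrix (Fin n) (Fin n) G.V
  h : Matrix (Fin n) (Fin d) G.V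
  q : Matrix (Fin n) (Fin n) G.V
  w : Matrix (Fin n) (Fin n) G.V
  v : Fin n → G.V
  r : Matrix (Fin n) (Fin n) G.V
  p : Matrix (Fin n) (Fin n) G.V
  T : Matrix (Fin d) (Fin n) G.V
  g : Matrix (Fin d) (Fin d) G.V
  a₁_eq : ∀ i k, G.gate (a₁ i k) = .input (.A₁ i k)
  a₂_eq : ∀ i k, G.gate (a₂ i k) = .input (.A₂ i k)
  a₃_eq : ∀ i k, G.gate (a₃ i k) = .input (.A₃ i k)
  dO_eq : ∀ i k, G.gate (dO i k) = .input (.dO i k)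
  x_eq : ∀ k k', G.gate (x k k') = .input (.X k k')
  y_eq : ∀ k k', G.gate (y k k') = .input (.Y k k')
  no_l : ∀ u i, G.gate u ≠ .input (.l i)
  no_O : ∀ u i k, G.gate u ≠ .input (.O i k)
  S_eq : G.StdMul a₁ x S
  Z_eq : G.StdMul S a₂ᵀ Z
  E_eq : ∀ i j, G.gate (E i j) = .unary Real.exp (Z i j)
  l_eq : ∀ i, G.IsSum (l i) (Finset.univ.val.map (E i))
  f_eq : ∀ i j, G.gate (f i j) = .binary (· / ·) (E i j) (l i)
  h_eq : G.StdMul a₃ y h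
  q_eq : G.StdMul dO hᵀ q
  w_eq : ∀ i j, G.IsProd (w i j) (f i j) (q i j)
  v_eq : ∀ i, G.IsSum (v i) (Finset.univ.val.map (w i))
  r_eq : ∀ i j, G.IsProd (r i j) (v i) (f i j)
  p_eq : ∀ i j, G.gate (p i j) = .binary (· - ·) (w i j) (r i j)
  T_eq : G.StdMul a₁ᵀ p T
  g_eq : G.StdMul T a₂ g
  out : ∀ u, G.dag.IsOutput u ↔ ∃ a b, g a b = u

end Circuit

/-- `min {(n²d² + nd³) / M, (n²d + nd²) / √M}`. -/
noncomputable def attnIOBound (n d M : ℕ) : ℝ :=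
  min (((n : ℝ) ^ 2 * (d : ℝ) ^ 2 + (n : ℝ) * (d : ℝ) ^ 3) / (M : ℝ))
    (((n : ℝ) ^ 2 * (d : ℝ) + (n : ℝ) * (d : ℝ) ^ 2) / Real.sqrt (M : ℝ))

/-! Lower bound. Only the product `Z = (A₁ X) A₂ᵀ` is used; the bracketing `A₁ (X A₂ᵀ)` is the same
situation transposed. A play is cut into segments of `M` input and output moves. In a segment at
most `2M` nodes come from outside (red at its beginning or input) and at most `2M` survive it (red
at its end or output). Since nodes may be deleted and recomputed, a scalar product may be computed
often and in vain. But some segment computes it and also either computes the root of its summation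
tree or keeps a partial sum of that tree (`Segmentation.thread`, through the notion `IsThread`).
Charging the product to that segment, the Loomis-Whitney inequality bounds the number of products
per segment by the numbers of factors present and of trees touched (`MulTrees.mul_le_length_mul`).

The obstacle is that `S = A₁ X` is not an input: its entries can appear in the cache without being
read. However, an entry computed with no node of its tree available needs a full row of `A₁` and a
full column of `X`, and at most `2M/d` of each are available. So at most `2M + (2M/d)²` entries of
`S` are present, and a similar argument bounds the entries of `Z` computed (`sq_mul_card_S_le`,
`sq_mul_card_Z_le`). If `M ≤ d²`, both numbers are at most `6M`, a segment is charged `O(M^{3/2})`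
products of each multiplication, and the count is `(n d² + n² d)/√M`. If `d² ≤ M`, a segment
computes `O(M²/d²)` entries of `Z`, which gives `n² d²/M`, while reading `A₁` costs `n d ≥ n d³/M`.
The inequalities `q ≥ n d` and `q ≥ d²` absorb the incomplete last segment.

Upper bound. At the price of a factor two, reading may be assumed not to erase memory (`Reach`). If
`√M ≤ d + 1` (head dimension `d + 1`), the large intermediate matrices are written and the products
are done with tiles of side about `√M/4`. If `d + 1 < √M`, no `n × n` matrix is written: an entry of
`Z`, `q`, `f` or `p` is recomputed in constant extra space from rows of length `d + 1`, and `l`,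
`v`, `T` are accumulated for about `M/(16(d + 1))` rows or columns at a time, each block reading
`O(n d)` entries (`ioComplexity_le_fused`). Caches below a fixed size are served by computing node
by node. -/

/-! ### Cutting a play into segments -/

/-- What matters of a stretch of a play: the nodes available in the cache (red at its beginning, or
input during it), the nodes computed, and the nodes kept (red at its end, or output during it). -/
structure Segment (V : Type) where
  avail : Finset V
  computed : Finset V
  kept : Finset V

namespace Dag

variable {G : Dag}

/-- A set of nodes with parents, each of which except `u` has a parent in the set. -/
structure IsThread (G : Dag) (D : Set G.V) (u : G.V) : Prop where
  not_input : ∀ v ∈ D, ¬ G.IsInput v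
  exists_parent : ∀ v ∈ D, v ≠ u → ∃ w ∈ G.parents v, w ∈ D

/-- The bookkeeping for a play that has reached the position `s` with `q` input and output
operations: `past` are the completed segments, with `T` operations each, and `cur` is the current
one, with `r` operations so far. -/
structure Trace (G : Dag) (M T : ℕ) (s : G.Position) (q : ℕ) (past : List (Segment G.V))
    (cur : Segment G.V) (r : ℕ) : Prop where
  count : q = T * past.length + r
  r_le : r ≤ T
  card_red : s.red.card ≤ M
  card_past : ∀ σ ∈ past, σ.avail.card ≤ M + T ∧ σ.kept.card ≤ M + T
  card_avail : cur.avail.card ≤ M + r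
  card_kept : cur.kept.card ≤ r
  closed : ∀ σ ∈ cur :: past, ∀ v ∈ σ.computed,
    ¬ G.IsInput v ∧ ∀ u ∈ G.parents v, u ∈ σ.avail ∨ u ∈ σ.computed
  red_sub : ∀ v ∈ s.red, v ∈ cur.avail ∨ v ∈ cur.computed
  avail_computed : ∀ σ ∈ cur :: past, ∀ v ∈ σ.avail, ¬ G.IsInput v →
    ∃ τ ∈ cur :: past, v ∈ τ.computed
  blue_computed : ∀ v ∈ s.blue, ¬ G.IsInput v → ∃ τ ∈ cur :: past, v ∈ τ.computed
  reads : ∃ I : Finset G.V, I.card ≤ q ∧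
    ∀ σ ∈ cur :: past, ∀ v ∈ σ.avail, G.IsInput v → v ∈ I
  -- Pebbles can come onto `D` only through a computation of `u`. If no completed segment has
  -- computed `u` and kept a node of `D`, then `D` carried no pebble when the current segment began,
  -- so any pebble on `D` descends from a computation of `u` within this segment.
  thread : ∀ D u, G.IsThread D u →
    (∃ σ ∈ past, u ∈ σ.computed ∧ ∃ w ∈ D, w ∈ σ.kept) ∨
      ((∀ v ∈ D, v ∈ s.red → u ∈ cur.computed) ∧
        ∀ v ∈ D, v ∈ s.blue → u ∈ cur.computed ∧ ∃ w ∈ D, w ∈ cur.kept)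
  found : ∀ D u, G.IsThread D u → ∀ v ∈ D, (∃ σ ∈ cur :: past, v ∈ σ.computed) →
    (∃ σ ∈ past, u ∈ σ.computed ∧ ∃ w ∈ D, w ∈ σ.kept) ∨
      ∃ σ ∈ cur :: past, u ∈ σ.computed ∧ v ∈ σ.computed

namespace Trace

variable {M T q r : ℕ} {s : G.Position} {past : List (Segment G.V)} {cur : Segment G.V}

theorem red_computed (h : Trace G M T s q past cur r) {v : G.V} (hv : v ∈ s.red)
    (hi : ¬ G.IsInput v) : ∃ τ ∈ cur :: past, v ∈ τ.computed := by
  rcases h.red_sub v hv with h' | h'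
  · exact h.avail_computed cur (by simp) v h' hi
  · exact ⟨cur, by simp, h'⟩

/-- Deleting pebbles is harmless because the pebbles of `s` occur only in hypotheses and in an upper
bound. -/
theorem mono (h : Trace G M T s q past cur r) {t : G.Position} (hr : t.red ⊆ s.red)
    (hb : t.blue ⊆ s.blue) : Trace G M T t q past cur r where
  count := h.count
  r_le := h.r_le
  card_red := (Finset.card_le_card hr).trans h.card_red
  card_past := h.card_past
  card_avail := h.card_avail
  card_kept := h.card_kept
  closed := h.closed
  red_sub v hv := h.red_sub v (hr hv)
  avail_computed := h.avail_computed
  blue_computed v hv := h.blue_computed v (hb hv)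
  reads := h.reads
  thread D u hD := (h.thread D u hD).imp_right fun h' =>
    ⟨fun v hv hv' => h'.1 v hv (hr hv'), fun v hv hv' => h'.2 v hv (hb hv')⟩
  found := h.found

theorem start (G : Dag) (M T : ℕ) : Trace G M T G.start 0 [] ⟨∅, ∅, ∅⟩ 0 where
  count := by simp
  r_le := by simp
  card_red := by simp [Dag.start]
  card_past := by simp
  card_avail := by simp
  card_kept := by simp
  closed := by simp
  red_sub := by simp [Dag.start]
  avail_computed := by simp
  blue_computed := by simp [Dag.start]
  reads := ⟨∅, by simp, by simp⟩
  thread D u hD := .inr ⟨by simp [Dag.start], fun v hv hv' =>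
    absurd (by simpa [Dag.start] using hv') (hD.not_input v hv)⟩
  found := by simp

/-- Completing the current segment. -/
theorem close (h : Trace G M T s q past cur T) :
    Trace G M T s q (⟨cur.avail, cur.computed, s.red ∪ cur.kept⟩ :: past) ⟨s.red, ∅, ∅⟩ 0 where
  count := by rw [h.count]; simp; ring
  r_le := by simp
  card_red := h.card_red
  card_past := by
    intro σ hσ
    rcases List.mem_cons.1 hσ with rfl | hσ
    · exact ⟨h.card_avail, (Finset.card_union_le _ _).trans (add_le_add h.card_red h.card_kept)⟩
    · exact h.card_past σ hσ
  card_avail := by simpa using h.card_red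
  card_kept := by simp
  closed := by
    intro σ hσ v hv
    simp only [List.mem_cons] at hσ
    rcases hσ with rfl | rfl | hσ
    · simp at hv
    · exact h.closed cur (by simp) v hv
    · exact h.closed σ (by simp [hσ]) v hv
  red_sub v hv := .inl hv
  avail_computed := by
    have key : ∀ v, (∃ τ ∈ cur :: past, v ∈ τ.computed) →
        ∃ τ ∈ (⟨s.red, ∅, ∅⟩ : Segment G.V) ::
          ⟨cur.avail, cur.computed, s.red ∪ cur.kept⟩ :: past, v ∈ τ.computed := by
      rintro v ⟨τ, hτ, hv⟩
      rcases List.mem_cons.1 hτ with rfl | hτ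
      · exact ⟨_, List.mem_cons_of_mem _ List.mem_cons_self, hv⟩
      · exact ⟨τ, by simp [hτ], hv⟩
    intro σ hσ v hv hi
    apply key
    simp only [List.mem_cons] at hσ
    rcases hσ with rfl | rfl | hσ
    · exact h.red_computed hv hi
    · exact h.avail_computed cur (by simp) v hv hi
    · exact h.avail_computed σ (by simp [hσ]) v hv hi
  blue_computed v hv hi := by
    obtain ⟨τ, hτ, hv⟩ := h.blue_computed v hv hi
    rcases List.mem_cons.1 hτ with rfl | hτ
    · exact ⟨_, List.mem_cons_of_mem _ List.mem_cons_self, hv⟩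
    · exact ⟨τ, by simp [hτ], hv⟩
  reads := by
    obtain ⟨I, hI, h'⟩ := h.reads
    refine ⟨I, hI, fun σ hσ v hv hi => ?_⟩
    simp only [List.mem_cons] at hσ
    rcases hσ with rfl | rfl | hσ
    · rcases h.red_sub v hv with hv | hv
      · exact h' cur (by simp) v hv hi
      · exact absurd hi (h.closed cur (by simp) v hv).1
    · exact h' cur (by simp) v hv hi
    · exact h' σ (by simp [hσ]) v hv hi
  thread D u hD := by
    rcases h.thread D u hD with ⟨σ, hσ, h'⟩ | ⟨h1, h2⟩
    · exact .inl ⟨σ, by simp [hσ], h'⟩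
    -- A pebble on `D`, red or blue, provides a kept node of `D` in the segment just completed.
    -- Without one, the invariant restarts vacuously.
    · by_cases hr : ∃ v ∈ D, v ∈ s.red
      · obtain ⟨v, hv, hv'⟩ := hr
        exact .inl ⟨_, List.mem_cons_self, h1 v hv hv', v, hv, by simp [hv']⟩
      by_cases hb : ∃ v ∈ D, v ∈ s.blue
      · obtain ⟨v, hv, hv'⟩ := hb
        obtain ⟨hu, w, hw, hw'⟩ := h2 v hv hv'
        exact .inl ⟨_, List.mem_cons_self, hu, w, hw, by simp [hw']⟩
      push Not at hr hb
      exact .inr ⟨fun v hv hv' => absurd hv' (hr v hv), fun v hv hv' => absurd hv' (hb v hv)⟩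
  found D u hD v hv := by
    rintro ⟨σ, hσ, hvσ⟩
    have : ∃ σ ∈ cur :: past, v ∈ σ.computed := by
      simp only [List.mem_cons] at hσ
      rcases hσ with rfl | rfl | hσ
      · simp at hvσ
      · exact ⟨cur, by simp, hvσ⟩
      · exact ⟨σ, by simp [hσ], hvσ⟩
    rcases h.found D u hD v hv this with ⟨σ, hσ, h'⟩ | ⟨σ, hσ, h'⟩
    · exact .inl ⟨σ, by simp [hσ], h'⟩
    · rcases List.mem_cons.1 hσ with rfl | hσ
      · exact .inr ⟨_, List.mem_cons_of_mem _ List.mem_cons_self, h'⟩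
      · exact .inr ⟨σ, by simp [hσ], h'⟩

theorem compute (h : Trace G M T s q past cur r) {v : G.V} (hi : ¬ G.IsInput v)
    (hp : G.parents v ⊆ s.red) (hM : (insert v s.red).card ≤ M) :
    Trace G M T ⟨insert v s.red, s.blue⟩ q past ⟨cur.avail, insert v cur.computed, cur.kept⟩ r := by
  have key : ∀ w, (∃ τ ∈ cur :: past, w ∈ τ.computed) →
      ∃ τ ∈ (⟨cur.avail, insert v cur.computed, cur.kept⟩ : Segment G.V) :: past,
        w ∈ τ.computed := by
    rintro w ⟨τ, hτ, hw⟩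
    rcases List.mem_cons.1 hτ with rfl | hτ
    · exact ⟨_, List.mem_cons_self, by simp [hw]⟩
    · exact ⟨τ, by simp [hτ], hw⟩
  refine ⟨h.count, h.r_le, hM, h.card_past, h.card_avail, h.card_kept, ?_, ?_, ?_, ?_, ?_, ?_, ?_⟩
  · intro σ hσ w hw
    rcases List.mem_cons.1 hσ with rfl | hσ
    · rcases Finset.mem_insert.1 hw with rfl | hw
      · exact ⟨hi, fun u hu => (h.red_sub u (hp hu)).imp_right fun h' => by simp [h']⟩
      · obtain ⟨h1, h2⟩ := h.closed cur (by simp) w hw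
        exact ⟨h1, fun u hu => (h2 u hu).imp_right fun h' => by simp [h']⟩
    · exact h.closed σ (by simp [hσ]) w hw
  · intro w hw
    rcases Finset.mem_insert.1 hw with rfl | hw
    · simp
    · exact (h.red_sub w hw).imp_right fun h' => by simp [h']
  · intro σ hσ w hw hwi
    apply key
    rcases List.mem_cons.1 hσ with rfl | hσ
    · exact h.avail_computed cur (by simp) w hw hwi
    · exact h.avail_computed σ (by simp [hσ]) w hw hwi
  · exact fun w hw hwi => key w (h.blue_computed w hw hwi)
  · obtain ⟨I, hI, h'⟩ := h.reads
    refine ⟨I, hI, fun σ hσ w hw hwi => ?_⟩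
    rcases List.mem_cons.1 hσ with rfl | hσ
    · exact h' cur (by simp) w hw hwi
    · exact h' σ (by simp [hσ]) w hw hwi
  · intro D u hD
    refine (h.thread D u hD).imp_right fun ⟨h1, h2⟩ => ⟨fun w hw hwr => ?_, fun w hw hwb => ?_⟩
    · rcases Finset.mem_insert.1 hwr with rfl | hwr
      -- If `w ≠ u`, some parent of `w` in `D` is red, and the invariant for that parent already
      -- gives the computation of `u`.
      · by_cases huw : w = u
        · simp [huw]
        · obtain ⟨x, hx, hxD⟩ := hD.exists_parent w hw huw
          simp [h1 x hxD (hp hx)]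
      · simp [h1 w hw hwr]
    · obtain ⟨hu, h3⟩ := h2 w hw hwb
      exact ⟨by simp [hu], h3⟩
  · rintro D u hD w hw ⟨σ, hσ, hwσ⟩
    by_cases hold : ∃ σ ∈ cur :: past, w ∈ σ.computed
    · refine (h.found D u hD w hw hold).imp_right ?_
      rintro ⟨τ, hτ, h1, h2⟩
      rcases List.mem_cons.1 hτ with rfl | hτ
      · exact ⟨_, List.mem_cons_self, by simp [h1], by simp [h2]⟩
      · exact ⟨τ, by simp [hτ], h1, h2⟩
    · have hwv : w = v := by
        rcases List.mem_cons.1 hσ with rfl | hσ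
        · rcases Finset.mem_insert.1 hwσ with rfl | hwσ
          · rfl
          · exact absurd ⟨cur, by simp, hwσ⟩ hold
        · exact absurd ⟨σ, by simp [hσ], hwσ⟩ hold
      subst hwv
      -- For a first computation of `w`, a red parent in `D` shows that `u` was computed in this
      -- same segment, unless a past segment already serves.
      by_cases huw : w = u
      · exact .inr ⟨_, List.mem_cons_self, by simp [huw], by simp⟩
      · obtain ⟨x, hx, hxD⟩ := hD.exists_parent w hw huw
        rcases h.thread D u hD with h' | ⟨h1, -⟩
        · exact .inl h'
        · exact .inr ⟨_, List.mem_cons_self, by simp [h1 x hxD (hp hx)], by simp⟩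

theorem input (h : Trace G M T s q past cur r) (hr : r < T) {v : G.V} (hv : v ∈ s.blue)
    (hM : (insert v s.red).card ≤ M) :
    Trace G M T ⟨insert v s.red, s.blue.erase v⟩ (q + 1) past
      ⟨insert v cur.avail, cur.computed, cur.kept⟩ (r + 1) := by
  have key : ∀ w, (∃ τ ∈ cur :: past, w ∈ τ.computed) →
      ∃ τ ∈ (⟨insert v cur.avail, cur.computed, cur.kept⟩ : Segment G.V) :: past,
        w ∈ τ.computed := by
    rintro w ⟨τ, hτ, hw⟩
    rcases List.mem_cons.1 hτ with rfl | hτ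
    · exact ⟨_, List.mem_cons_self, hw⟩
    · exact ⟨τ, by simp [hτ], hw⟩
  refine ⟨by rw [h.count]; ring, hr, hM, h.card_past, ?_, h.card_kept.trans (by omega),
    ?_, ?_, ?_, ?_, ?_, ?_, ?_⟩
  · have := Finset.card_insert_le v cur.avail
    have := h.card_avail
    simp only
    omega
  · intro σ hσ w hw
    rcases List.mem_cons.1 hσ with rfl | hσ
    · obtain ⟨h1, h2⟩ := h.closed cur (by simp) w hw
      exact ⟨h1, fun u hu => (h2 u hu).imp_left fun h' => by simp [h']⟩
    · exact h.closed σ (by simp [hσ]) w hw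
  · intro w hw
    rcases Finset.mem_insert.1 hw with rfl | hw
    · simp
    · exact (h.red_sub w hw).imp_left fun h' => by simp [h']
  · intro σ hσ w hw hwi
    apply key
    rcases List.mem_cons.1 hσ with rfl | hσ
    · rcases Finset.mem_insert.1 hw with rfl | hw
      · exact h.blue_computed w hv hwi
      · exact h.avail_computed cur (by simp) w hw hwi
    · exact h.avail_computed σ (by simp [hσ]) w hw hwi
  · exact fun w hw hwi => key w (h.blue_computed w (Finset.mem_of_mem_erase hw) hwi)
  · obtain ⟨I, hI, h'⟩ := h.reads
    refine ⟨insert v I, (Finset.card_insert_le v I).trans (by omega), fun σ hσ w hw hwi => ?_⟩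
    rcases List.mem_cons.1 hσ with rfl | hσ
    · rcases Finset.mem_insert.1 hw with rfl | hw
      · simp
      · exact Finset.mem_insert_of_mem (h' cur (by simp) w hw hwi)
    · exact Finset.mem_insert_of_mem (h' σ (by simp [hσ]) w hw hwi)
  · intro D u hD
    refine (h.thread D u hD).imp_right fun ⟨h1, h2⟩ => ⟨fun w hw hwr => ?_, fun w hw hwb => ?_⟩
    · rcases Finset.mem_insert.1 hwr with rfl | hwr
      -- A blue pebble on `D` carries at least the information that a red one must carry.
      · exact (h2 w hw hv).1
      · exact h1 w hw hwr
    · exact h2 w hw (Finset.mem_of_mem_erase hwb)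
  · rintro D u hD w hw ⟨σ, hσ, hwσ⟩
    have hold : ∃ σ ∈ cur :: past, w ∈ σ.computed := by
      rcases List.mem_cons.1 hσ with rfl | hσ
      · exact ⟨cur, by simp, hwσ⟩
      · exact ⟨σ, by simp [hσ], hwσ⟩
    refine (h.found D u hD w hw hold).imp_right ?_
    rintro ⟨τ, hτ, h1, h2⟩
    rcases List.mem_cons.1 hτ with rfl | hτ
    · exact ⟨_, List.mem_cons_self, h1, h2⟩
    · exact ⟨τ, by simp [hτ], h1, h2⟩

theorem output (h : Trace G M T s q past cur r) (hr : r < T) {v : G.V} (hv : v ∈ s.red) :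
    Trace G M T ⟨s.red.erase v, insert v s.blue⟩ (q + 1) past
      ⟨cur.avail, cur.computed, insert v cur.kept⟩ (r + 1) := by
  have key : ∀ w, (∃ τ ∈ cur :: past, w ∈ τ.computed) →
      ∃ τ ∈ (⟨cur.avail, cur.computed, insert v cur.kept⟩ : Segment G.V) :: past,
        w ∈ τ.computed := by
    rintro w ⟨τ, hτ, hw⟩
    rcases List.mem_cons.1 hτ with rfl | hτ
    · exact ⟨_, List.mem_cons_self, hw⟩
    · exact ⟨τ, by simp [hτ], hw⟩
  refine ⟨by rw [h.count]; ring, hr, ?_, h.card_past, h.card_avail.trans (by omega), ?_,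
    ?_, ?_, ?_, ?_, ?_, ?_, ?_⟩
  · exact (Finset.card_le_card (Finset.erase_subset _ _)).trans h.card_red
  · have := Finset.card_insert_le v cur.kept
    have := h.card_kept
    simp only
    omega
  · intro σ hσ w hw
    rcases List.mem_cons.1 hσ with rfl | hσ
    · exact h.closed cur (by simp) w hw
    · exact h.closed σ (by simp [hσ]) w hw
  · exact fun w hw => h.red_sub w (Finset.mem_of_mem_erase hw)
  · intro σ hσ w hw hwi
    apply key
    rcases List.mem_cons.1 hσ with rfl | hσ
    · exact h.avail_computed cur (by simp) w hw hwi
    · exact h.avail_computed σ (by simp [hσ]) w hw hwi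
  · intro w hw hwi
    apply key
    rcases Finset.mem_insert.1 hw with rfl | hw
    · exact h.red_computed hv hwi
    · exact h.blue_computed w hw hwi
  · obtain ⟨I, hI, h'⟩ := h.reads
    refine ⟨I, by omega, fun σ hσ w hw hwi => ?_⟩
    rcases List.mem_cons.1 hσ with rfl | hσ
    · exact h' cur (by simp) w hw hwi
    · exact h' σ (by simp [hσ]) w hw hwi
  · intro D u hD
    refine (h.thread D u hD).imp_right fun ⟨h1, h2⟩ => ⟨fun w hw hwr => ?_, fun w hw hwb => ?_⟩
    · exact h1 w hw (Finset.mem_of_mem_erase hwr)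
    · rcases Finset.mem_insert.1 hwb with rfl | hwb
      -- The node written is itself the kept node that a blue pebble on `D` has to exhibit.
      · exact ⟨h1 w hw hv, w, hw, by simp⟩
      · obtain ⟨hu, x, hx, hx'⟩ := h2 w hw hwb
        exact ⟨hu, x, hx, by simp [hx']⟩
  · rintro D u hD w hw ⟨σ, hσ, hwσ⟩
    have hold : ∃ σ ∈ cur :: past, w ∈ σ.computed := by
      rcases List.mem_cons.1 hσ with rfl | hσ
      · exact ⟨cur, by simp, hwσ⟩
      · exact ⟨σ, by simp [hσ], hwσ⟩
    refine (h.found D u hD w hw hold).imp_right ?_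
    rintro ⟨τ, hτ, h1, h2⟩
    rcases List.mem_cons.1 hτ with rfl | hτ
    · exact ⟨_, List.mem_cons_self, h1, h2⟩
    · exact ⟨τ, by simp [hτ], h1, h2⟩

end Trace

theorem Play.exists_trace {M T : ℕ} (hT : 0 < T) {s : G.Position} {q : ℕ} (h : G.Play M s q) :
    ∃ past cur r, Trace G M T s q past cur r := by
  induction h with
  | nil => exact ⟨_, _, _, Trace.start G M T⟩
  | @snoc s t q κ _ hst ht ih =>
    have room : ∃ past cur r, Trace G M T s q past cur r ∧ r < T := by
      obtain ⟨past, cur, r, h⟩ := ih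
      -- A full segment is closed just before the next move; `0 < T` then leaves room for that move.
      rcases h.r_le.lt_or_eq with hr | rfl
      · exact ⟨_, _, _, h, hr⟩
      · exact ⟨_, _, _, h.close, hT⟩
    obtain ⟨past, cur, r, h, hr⟩ := room
    cases hst with
    | input v hv => exact ⟨_, _, _, h.input hr hv ht⟩
    | output v hv => exact ⟨_, _, _, h.output hr hv⟩
    | compute v hi hp => exact ⟨_, _, _, h.compute hi hp ht⟩
    | deleteRed v => exact ⟨_, _, _, h.mono (Finset.erase_subset _ _) subset_rfl⟩
    | deleteBlue v => exact ⟨_, _, _, h.mono subset_rfl (Finset.erase_subset _ _)⟩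

/-! ### Segmentations of complete plays -/

/-- A division of a complete play with `q` input and output operations into segments of `T` such
operations, the last of which may be shorter. -/
structure Segmentation (G : Dag) (M T q : ℕ) (L : List (Segment G.V)) : Prop where
  le_q : T * (L.length - 1) ≤ q
  length_pos : 0 < L.length
  card_avail : ∀ σ ∈ L, σ.avail.card ≤ M + T
  card_kept : ∀ σ ∈ L, σ.kept.card ≤ M + T
  not_input : ∀ σ ∈ L, ∀ v ∈ σ.computed, ¬ G.IsInput v
  parents : ∀ σ ∈ L, ∀ v ∈ σ.computed, ∀ u ∈ G.parents v, u ∈ σ.avail ∨ u ∈ σ.computed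
  exists_computed : ∀ v, ¬ G.IsInput v → ∃ σ ∈ L, v ∈ σ.computed
  reads : ∃ I : Finset G.V, I.card ≤ q ∧ ∀ σ ∈ L, ∀ v ∈ σ.avail, G.IsInput v → v ∈ I
  thread : ∀ D u, G.IsThread D u → ∀ v ∈ D,
    ∃ σ ∈ L, u ∈ σ.computed ∧ (v ∈ σ.computed ∨ ∃ w ∈ D, w ∈ σ.kept)

/-- On a finite set the reverse of an acyclic relation is well founded. This permits induction from
the outputs down to the inputs. -/
theorem wellFounded_children (G : Dag) : WellFounded (fun u v : G.V => v ∈ G.parents u) := by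
  have : IsWellFounded G.V (fun u v => u ∈ G.parents v) := ⟨G.acyclic⟩
  have hsub : ∀ u v, Relation.TransGen (fun u v : G.V => v ∈ G.parents u) u v →
      Relation.TransGen (fun u v : G.V => u ∈ G.parents v) v u := fun u v h =>
    Relation.transGen_swap.1 h
  have hirr : Std.Irrefl (Relation.TransGen (fun u v : G.V => v ∈ G.parents u)) :=
    ⟨fun v h => (G.acyclic.transGen.irrefl).irrefl v (hsub v v h)⟩
  have htr : IsTrans G.V (Relation.TransGen (fun u v : G.V => v ∈ G.parents u)) :=
    ⟨fun _ _ _ => Relation.TransGen.trans⟩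
  exact Subrelation.wf (fun h => Relation.TransGen.single h)
    (Finite.wellFounded_of_trans_of_irrefl
      (Relation.TransGen (fun u v : G.V => v ∈ G.parents u)))

theorem Play.exists_segmentation {M T : ℕ} (hT : 0 < T) {s : G.Position} {q : ℕ}
    (h : G.Play M s q) (hout : ∀ v, G.IsOutput v → v ∈ s.blue) :
    ∃ L, G.Segmentation M T q L := by
  obtain ⟨past, cur, r, h⟩ := h.exists_trace hT
  -- An output ends blue, hence was computed. Any other node is a parent of a node computed in some
  -- segment, so it was computed there or available there, and an available node that is not an
  -- input was computed at some time.
  have hcomp : ∀ v, ¬ G.IsInput v → ∃ σ ∈ cur :: past, v ∈ σ.computed := by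
    intro v
    induction v using G.wellFounded_children.induction with
    | _ v ih =>
      intro hi
      by_cases ho : G.IsOutput v
      · exact h.blue_computed v (hout v ho) hi
      · simp only [IsOutput, not_forall, not_not] at ho
        obtain ⟨w, hw⟩ := ho
        obtain ⟨σ, hσ, hwσ⟩ := ih w hw fun hwi => by simp [IsInput] at hwi; simp [hwi] at hw
        rcases (h.closed σ hσ w hwσ).2 v hw with h' | h'
        · exact h.avail_computed σ hσ v h' hi
        · exact ⟨σ, hσ, h'⟩
  -- The unfinished segment is closed as it stands, with the final red nodes counted as kept.
  refine ⟨⟨cur.avail, cur.computed, s.red ∪ cur.kept⟩ :: past, ?_, by simp, ?_, ?_, ?_, ?_, ?_,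
    ?_, ?_⟩
  · simp [h.count]
  · intro σ hσ
    rcases List.mem_cons.1 hσ with rfl | hσ
    · exact h.card_avail.trans (by simpa using h.r_le)
    · exact (h.card_past σ hσ).1
  · intro σ hσ
    rcases List.mem_cons.1 hσ with rfl | hσ
    · exact (Finset.card_union_le _ _).trans
        (add_le_add h.card_red (h.card_kept.trans h.r_le))
    · exact (h.card_past σ hσ).2
  · intro σ hσ
    rcases List.mem_cons.1 hσ with rfl | hσ
    · exact fun v hv => (h.closed cur (by simp) v hv).1
    · exact fun v hv => (h.closed σ (by simp [hσ]) v hv).1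
  · intro σ hσ
    rcases List.mem_cons.1 hσ with rfl | hσ
    · exact fun v hv => (h.closed cur (by simp) v hv).2
    · exact fun v hv => (h.closed σ (by simp [hσ]) v hv).2
  · intro v hi
    obtain ⟨σ, hσ, hv⟩ := hcomp v hi
    rcases List.mem_cons.1 hσ with rfl | hσ
    · exact ⟨_, List.mem_cons_self, hv⟩
    · exact ⟨σ, by simp [hσ], hv⟩
  · obtain ⟨I, hI, h'⟩ := h.reads
    refine ⟨I, hI, fun σ hσ => ?_⟩
    rcases List.mem_cons.1 hσ with rfl | hσ
    · exact h' cur (by simp)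
    · exact h' σ (by simp [hσ])
  · intro D u hD v hv
    rcases h.found D u hD v hv (hcomp v (hD.not_input v hv)) with ⟨σ, hσ, h1, h2⟩ | ⟨σ, hσ, h1, h2⟩
    · exact ⟨σ, by simp [hσ], h1, .inr h2⟩
    · rcases List.mem_cons.1 hσ with rfl | hσ
      · exact ⟨_, List.mem_cons_self, h1, .inl h2⟩
      · exact ⟨σ, by simp [hσ], h1, .inl h2⟩

end Dag

/-! ### Counting lemmas -/

/-- At most `F.card` members of a disjoint family of sets meet the finite set `F`. -/
theorem card_filter_meets_le {α V : Type} [Fintype α] (D : α → Set V)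
    (hD : ∀ a b v, v ∈ D a → v ∈ D b → a = b) (F : Finset V)
    [DecidablePred fun a => ∃ v ∈ D a, v ∈ F] :
    (Finset.univ.filter fun a => ∃ v ∈ D a, v ∈ F).card ≤ F.card := by
  refine Finset.card_le_card_of_forall_subsingleton (fun a v => v ∈ D a) ?_ ?_
  · intro a ha
    obtain ⟨v, hv, hvF⟩ := (Finset.mem_filter.1 ha).2
    exact ⟨v, hvF, hv⟩
  · rintro v - a ⟨-, ha⟩ b ⟨-, hb⟩
    exact hD a b v ha hb

/-- In a disjoint family of sets arranged in rows of length `d`, the number of rows whose members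
all meet `F` is at most `F.card / d`. -/
theorem mul_card_rows_le {α V : Type} [Fintype α] {d : ℕ} (D : α → Fin d → Set V)
    (hD : ∀ a k b l v, v ∈ D a k → v ∈ D b l → a = b ∧ k = l) (F : Finset V) (I : Finset α)
    (hI : ∀ a ∈ I, ∀ k, ∃ v ∈ D a k, v ∈ F) : d * I.card ≤ F.card := by
  classical
  have h := card_filter_meets_le (fun p : α × Fin d => D p.1 p.2)
    (fun p q v hp hq => Prod.ext_iff.2 (hD _ _ _ _ v hp hq)) F
  refine le_trans ?_ h
  calc _ = (I ×ˢ (Finset.univ : Finset (Fin d))).card := by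
        rw [Finset.card_product]; simp [mul_comm]
    _ ≤ _ := by
        refine Finset.card_le_card fun p hp => ?_
        simp only [Finset.mem_product, Finset.mem_filter, Finset.mem_univ, true_and,
          and_true] at hp ⊢
        exact hI _ hp p.2

/-- The discrete Loomis-Whitney inequality in dimension three. -/
theorem card_sq_le_of_projections {α β γ : Type} [DecidableEq α] [DecidableEq β] [DecidableEq γ]
    (Θ : Finset (α × γ × β)) (C : Finset (α × γ)) (A : Finset (α × β)) (B : Finset (γ × β))
    (hC : ∀ t ∈ Θ, (t.1, t.2.1) ∈ C) (hA : ∀ t ∈ Θ, (t.1, t.2.2) ∈ A)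
    (hB : ∀ t ∈ Θ, (t.2.1, t.2.2) ∈ B) :
    Θ.card ^ 2 ≤ C.card * (A.card * B.card) := by
  set N : α × γ → Finset (α × γ × β) := fun c => Θ.filter fun t => (t.1, t.2.1) = c with hN
  have h1 : Θ.card = ∑ c ∈ C, (N c).card := Finset.card_eq_sum_card_fiberwise hC
  -- Two triples `t`, `u` over the same pair `c` are determined by the projection of `t` to `A` and
  -- that of `u` to `B`: these contain both coordinates of `c` and both third coordinates.
  -- Cauchy-Schwarz over the fibres then finishes.
  have h2 : ∑ c ∈ C, (N c).card ^ 2 ≤ A.card * B.card := by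
    calc _ = (C.sigma fun c => N c ×ˢ N c).card := by
          rw [Finset.card_sigma]
          exact Finset.sum_congr rfl fun c _ => by rw [Finset.card_product, sq]
      _ ≤ (A ×ˢ B).card := by
          refine Finset.card_le_card_of_injOn
            (fun x => ((x.2.1.1, x.2.1.2.2), (x.2.2.2.1, x.2.2.2.2))) ?_ ?_
          · rintro ⟨c, t, u⟩ hx
            simp only [Finset.coe_sigma, Set.mem_sigma_iff, Finset.mem_coe, Finset.mem_product, hN,
              Finset.mem_filter] at hx
            simp only [Finset.coe_product, Set.mem_prod, Finset.mem_coe]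
            exact ⟨hA t hx.2.1.1, hB u hx.2.2.1⟩
          · rintro ⟨c, ⟨t1, t2, t3⟩, ⟨u1, u2, u3⟩⟩ hx ⟨c', ⟨t1', t2', t3'⟩, ⟨u1', u2', u3'⟩⟩ hx' h
            simp only [Finset.coe_sigma, Set.mem_sigma_iff, Finset.mem_coe, Finset.mem_product, hN,
              Finset.mem_filter] at hx hx'
            obtain ⟨-, ⟨-, rfl⟩, -, h3⟩ := hx
            obtain ⟨-, ⟨-, rfl⟩, -, h3'⟩ := hx'
            simp only [Prod.mk.injEq] at h h3 h3'
            obtain ⟨⟨rfl, rfl⟩, rfl, rfl⟩ := h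
            obtain ⟨rfl, rfl⟩ := h3
            obtain ⟨rfl, rfl⟩ := h3'
            rfl
      _ = _ := Finset.card_product _ _
  calc Θ.card ^ 2 = (∑ c ∈ C, (N c).card) ^ 2 := by rw [h1]
    _ ≤ C.card * ∑ c ∈ C, (N c).card ^ 2 := sq_sum_le_card_mul_sum_sq
    _ ≤ _ := Nat.mul_le_mul_left _ h2

/-- If every element satisfies one of `L.length` predicates, and at most `N` elements satisfy
each, then there are at most `L.length * N` elements. -/
theorem card_le_length_mul {α β : Type} [Fintype α] (L : List β) (p : β → α → Prop)
    [∀ σ, DecidablePred (p σ)] (N : ℕ)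
    (hp : ∀ a, ∃ σ ∈ L, p σ a) (hN : ∀ σ ∈ L, (Finset.univ.filter (p σ)).card ≤ N) :
    Fintype.card α ≤ L.length * N := by
  classical
  have : (Finset.univ : Finset α) ⊆ L.toFinset.biUnion fun σ => Finset.univ.filter (p σ) := by
    intro a _
    obtain ⟨σ, hσ, h⟩ := hp a
    simp only [Finset.mem_biUnion, List.mem_toFinset, Finset.mem_filter, Finset.mem_univ, true_and]
    exact ⟨σ, hσ, h⟩
  calc Fintype.card α ≤ _ := Finset.card_le_card this
    _ ≤ L.toFinset.card * N :=
        Finset.card_biUnion_le_card_mul _ _ _ fun σ hσ => hN σ (List.mem_toFinset.1 hσ)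
    _ ≤ _ := Nat.mul_le_mul_right _ (List.toFinset_card_le L)

/-! ### Summation trees -/

namespace Circuit

variable {ι : Type} {G : Circuit ι}

theorem mem_dag_parents {u v : G.V} : u ∈ G.dag.parents v ↔ u ∈ (G.gate v).parents := Iff.rfl

theorem dag_isInput_iff {v : G.V} : G.dag.IsInput v ↔ (G.gate v).parents = ∅ := Iff.rfl

/-- The node `v` is a product of two nodes. -/
def IsMulGate (G : Circuit ι) (v : G.V) : Prop := ∃ u w, G.gate v = .mul u w

theorem IsProd.isMulGate {v u w : G.V} (h : G.IsProd v u w) : G.IsMulGate v := by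
  rcases h with h | h <;> exact ⟨_, _, h⟩

theorem IsProd.symm {v u w : G.V} (h : G.IsProd v u w) : G.IsProd v w u := Or.symm h

theorem IsProd.parents {v u w : G.V} (h : G.IsProd v u w) : (G.gate v).parents = {u, w} := by
  rcases h with h | h
  · simp [h, Gate.parents]
  · simp [h, Gate.parents, Finset.pair_comm]

theorem IsMulGate.not_isInput {v : G.V} (h : G.IsMulGate v) : ¬ G.dag.IsInput v := by
  obtain ⟨u, w, h⟩ := h
  simp [dag_isInput_iff, h, Gate.parents]

theorem not_isInput_of_gate_eq_add {v u w : G.V} (h : G.gate v = .add u w) :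
    ¬ G.dag.IsInput v := by
  simp [dag_isInput_iff, h, Gate.parents]

theorem IsProd.unique {v u w u' w' : G.V} (h : G.IsProd v u w) (h' : G.IsProd v u' w') :
    (u = u' ∧ w = w') ∨ (u = w' ∧ w = u') := by
  rcases h with h | h <;> rcases h' with h' | h' <;> simp_all

theorem IsSum.exists_mem {v : G.V} {s : Multiset G.V} (h : G.IsSum v s) : ∃ x, x ∈ s := by
  induction h with
  | leaf v => exact ⟨v, by simp⟩
  | add _ _ _ ih _ => exact ih.imp fun x hx => Multiset.mem_add.2 (.inl hx)

/-- The gate of a node shows whether a tree with product leaves ends there or branches, so the root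
determines the leaves. Hence trees over disjoint sets of products share no node. -/
theorem IsSum.unique {v : G.V} {s t : Multiset G.V} (hs : G.IsSum v s) (ht : G.IsSum v t)
    (hs' : ∀ x ∈ s, G.IsMulGate x) (ht' : ∀ x ∈ t, G.IsMulGate x) : s = t := by
  induction hs generalizing t with
  | leaf v =>
    obtain ⟨a, b, hv⟩ := hs' v (by simp)
    cases ht with
    | leaf => rfl
    | add h _ _ => simp [hv] at h
  | @add v u w s₁ s₂ hv hu hw ihu ihw =>
    cases ht with
    | leaf =>
      obtain ⟨a, b, h⟩ := ht' v (by simp)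
      simp [hv] at h
    | add h hu' hw' =>
      rw [hv] at h
      cases h
      rw [ihu hu' (fun x hx => hs' x (Multiset.mem_add.2 (.inl hx)))
          (fun x hx => ht' x (Multiset.mem_add.2 (.inl hx))),
        ihw hw' (fun x hx => hs' x (Multiset.mem_add.2 (.inr hx)))
          (fun x hx => ht' x (Multiset.mem_add.2 (.inr hx)))]

theorem IsSum.not_isInput {v : G.V} {s : Multiset G.V} (h : G.IsSum v s)
    (hs : ∀ x ∈ s, G.IsMulGate x) : ¬ G.dag.IsInput v := by
  cases h with
  | leaf => exact (hs v (by simp)).not_isInput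
  | add hv _ _ => exact not_isInput_of_gate_eq_add hv

/-- Below a partial sum that contains the leaf `m` there is always a summand that contains `m`, down
to `m` itself. The restriction to `L` keeps the thread inside one tree. -/
theorem isThread_sums (L : Set G.V) (hL : ∀ x ∈ L, G.IsMulGate x) (m : G.V) :
    G.dag.IsThread {v | ∃ s, G.IsSum v s ∧ m ∈ s ∧ ∀ x ∈ s, x ∈ L} m where
  not_input := by
    rintro v ⟨s, hs, -, h⟩
    exact hs.not_isInput fun x hx => hL x (h x hx)
  exists_parent := by
    rintro v ⟨s, hs, hm, h⟩ hne
    cases hs with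
    | leaf => exact absurd (Multiset.mem_singleton.1 hm).symm hne
    | @add _ u w s t hv hu hw =>
      rcases Multiset.mem_add.1 hm with hm | hm
      · exact ⟨u, mem_dag_parents.2 (by simp [hv, Gate.parents]), s, hu, hm,
          fun x hx => h x (Multiset.mem_add.2 (.inl hx))⟩
      · exact ⟨w, mem_dag_parents.2 (by simp [hv, Gate.parents]), t, hw, hm,
          fun x hx => h x (Multiset.mem_add.2 (.inr hx))⟩

/-- If the root of a summation tree is computed during a segment, then either some node of the
tree was available or all leaves are computed. -/
theorem IsSum.avail_or_computed {v : G.V} {s : Multiset G.V} (h : G.IsSum v s)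
    {σ : Segment G.V}
    (hσ : ∀ v ∈ σ.computed, ∀ u ∈ G.dag.parents v, u ∈ σ.avail ∨ u ∈ σ.computed)
    (hv : v ∈ σ.computed) :
    (∃ w ∈ σ.avail, ∃ t, G.IsSum w t ∧ ∀ x ∈ t, x ∈ s) ∨ ∀ x ∈ s, x ∈ σ.computed := by
  induction h with
  | leaf v => exact .inr (by simpa using hv)
  | @add v u w s t hgate hu hw ihu ihw =>
    have hL : ∀ x ∈ s, x ∈ s + t := fun x hx => Multiset.mem_add.2 (.inl hx)
    have hR : ∀ x ∈ t, x ∈ s + t := fun x hx => Multiset.mem_add.2 (.inr hx)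
    rcases hσ v hv u (mem_dag_parents.2 (by simp [hgate, Gate.parents])) with hu' | hu'
    · exact .inl ⟨u, hu', s, hu, hL⟩
    rcases hσ v hv w (mem_dag_parents.2 (by simp [hgate, Gate.parents])) with hw' | hw'
    · exact .inl ⟨w, hw', t, hw, hR⟩
    rcases ihu hu' with ⟨y, hy, r, hr, hrs⟩ | h1
    · exact .inl ⟨y, hy, r, hr, fun x hx => hL x (hrs x hx)⟩
    rcases ihw hw' with ⟨y, hy, r, hr, hrs⟩ | h2
    · exact .inl ⟨y, hy, r, hr, fun x hx => hR x (hrs x hx)⟩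
    exact .inr fun x hx => (Multiset.mem_add.1 hx).elim (h1 x) (h2 x)

/-! ### Standard matrix multiplication in a segment -/

/-- A standard matrix multiplication `R = P Q` with its product nodes, all different. -/
structure MulTrees (G : Circuit ι) {a b c : ℕ} (P : Fin a → Fin b → G.V) (Q : Fin b → Fin c → G.V)
    (R : Fin a → Fin c → G.V) (m : Fin a → Fin c → Fin b → G.V) : Prop where
  prod : ∀ i j k, G.IsProd (m i j k) (P i k) (Q k j)
  sum : ∀ i j, G.IsSum (R i j) (Finset.univ.val.map (m i j))
  inj : ∀ i j k i' j' k', m i j k = m i' j' k' → i = i' ∧ j = j' ∧ k = k'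

/-- The nodes that are sums of some of the nodes in `L`. -/
def sumsOf (G : Circuit ι) (L : Set G.V) : Set G.V := {v | ∃ s, G.IsSum v s ∧ ∀ x ∈ s, x ∈ L}

namespace MulTrees

variable {a b c : ℕ} {P : Fin a → Fin b → G.V} {Q : Fin b → Fin c → G.V}
  {R : Fin a → Fin c → G.V} {m : Fin a → Fin c → Fin b → G.V}

theorem isMulGate (h : G.MulTrees P Q R m) {i : Fin a} {j : Fin c} {x : G.V}
    (hx : x ∈ Set.range (m i j)) : G.IsMulGate x := by
  obtain ⟨k, rfl⟩ := hx
  exact (h.prod i j k).isMulGate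

theorem not_isInput (h : G.MulTrees P Q R m) {i : Fin a} {j : Fin c} {v : G.V}
    (hv : v ∈ G.sumsOf (Set.range (m i j))) : ¬ G.dag.IsInput v := by
  obtain ⟨s, hs, hs'⟩ := hv
  exact hs.not_isInput fun x hx => h.isMulGate (hs' x hx)

theorem root_mem (h : G.MulTrees P Q R m) (i : Fin a) (j : Fin c) :
    R i j ∈ G.sumsOf (Set.range (m i j)) :=
  ⟨_, h.sum i j, fun x hx => by simpa using hx⟩

theorem disjoint (h : G.MulTrees P Q R m) {i i' : Fin a} {j j' : Fin c} {v : G.V}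
    (hv : v ∈ G.sumsOf (Set.range (m i j))) (hv' : v ∈ G.sumsOf (Set.range (m i' j'))) :
    i = i' ∧ j = j' := by
  obtain ⟨s, hs, hs'⟩ := hv
  obtain ⟨t, ht, ht'⟩ := hv'
  have hst := hs.unique ht (fun x hx => h.isMulGate (hs' x hx))
    (fun x hx => h.isMulGate (ht' x hx))
  subst hst
  obtain ⟨x, hx⟩ := hs.exists_mem
  obtain ⟨k, rfl⟩ := hs' x hx
  obtain ⟨k', hk'⟩ := ht' _ hx
  obtain ⟨rfl, rfl, -⟩ := h.inj _ _ _ _ _ _ hk'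
  exact ⟨rfl, rfl⟩

variable {M T q : ℕ} {L : List (Segment G.V)}

theorem avail_or_computed (h : G.MulTrees P Q R m) (hL : G.dag.Segmentation M T q L)
    {σ : Segment G.V} (hσ : σ ∈ L) {i : Fin a} {j : Fin c} (hR : R i j ∈ σ.computed) :
    (∃ w ∈ G.sumsOf (Set.range (m i j)), w ∈ σ.avail) ∨ ∀ k, m i j k ∈ σ.computed := by
  rcases (h.sum i j).avail_or_computed (hL.parents σ hσ) hR with ⟨w, hw, t, ht, hs⟩ | h'
  · exact .inl ⟨w, ⟨t, ht, fun x hx => by simpa using hs x hx⟩, hw⟩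
  · exact .inr fun k => h' _ (by simp)

theorem left_mem (h : G.MulTrees P Q R m) (hL : G.dag.Segmentation M T q L)
    {σ : Segment G.V} (hσ : σ ∈ L) {i : Fin a} {j : Fin c} {k : Fin b}
    (hm : m i j k ∈ σ.computed) : P i k ∈ σ.avail ∨ P i k ∈ σ.computed :=
  hL.parents σ hσ _ hm _ (mem_dag_parents.2 (by simp [(h.prod i j k).parents]))

theorem right_mem (h : G.MulTrees P Q R m) (hL : G.dag.Segmentation M T q L)
    {σ : Segment G.V} (hσ : σ ∈ L) {i : Fin a} {j : Fin c} {k : Fin b}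
    (hm : m i j k ∈ σ.computed) : Q k j ∈ σ.avail ∨ Q k j ∈ σ.computed :=
  hL.parents σ hσ _ hm _ (mem_dag_parents.2 (by simp [(h.prod i j k).parents]))

/-- The thread of partial sums containing this product, followed from the root. This is what makes
the count insensitive to recomputation: each product is charged to a segment in which its tree also
leaves a trace. -/
theorem exists_segment (h : G.MulTrees P Q R m) (hL : G.dag.Segmentation M T q L)
    (i : Fin a) (j : Fin c) (k : Fin b) :
    ∃ σ ∈ L, m i j k ∈ σ.computed ∧
      (R i j ∈ σ.computed ∨ ∃ w ∈ G.sumsOf (Set.range (m i j)), w ∈ σ.kept) := by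
  obtain ⟨σ, hσ, h1, h2⟩ := hL.thread _ _
    (isThread_sums (Set.range (m i j)) (fun x hx => h.isMulGate hx) (m i j k)) (R i j)
    ⟨_, h.sum i j, by simp, fun x hx => by simpa using hx⟩
  refine ⟨σ, hσ, h1, h2.imp_right ?_⟩
  rintro ⟨w, ⟨s, hs, -, hs'⟩, hw⟩
  exact ⟨w, ⟨s, hs, hs'⟩, hw⟩

open Classical in
/-- The number of scalar products of a standard matrix multiplication, in terms of the numbers of
entries of the factors that are present, and of roots computed, during each segment. -/
theorem mul_le_length_mul (h : G.MulTrees P Q R m) (hL : G.dag.Segmentation M T q L)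
    {kA kB kC N : ℕ}
    (hA : ∀ σ ∈ L, (Finset.univ.filter fun p : Fin a × Fin b =>
      P p.1 p.2 ∈ σ.avail ∨ P p.1 p.2 ∈ σ.computed).card ≤ kA)
    (hB : ∀ σ ∈ L, (Finset.univ.filter fun p : Fin c × Fin b =>
      Q p.2 p.1 ∈ σ.avail ∨ Q p.2 p.1 ∈ σ.computed).card ≤ kB)
    (hC : ∀ σ ∈ L, (Finset.univ.filter fun p : Fin a × Fin c =>
      R p.1 p.2 ∈ σ.computed).card ≤ kC)
    (hN : (kC + (M + T)) * (kA * kB) ≤ N ^ 2) :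
    a * (c * b) ≤ L.length * N := by
  have hcard : Fintype.card (Fin a × Fin c × Fin b) = a * (c * b) := by simp
  rw [← hcard]
  refine card_le_length_mul L (fun σ t => m t.1 t.2.1 t.2.2 ∈ σ.computed ∧
    (R t.1 t.2.1 ∈ σ.computed ∨
      ∃ w ∈ G.sumsOf (Set.range (m t.1 t.2.1)), w ∈ σ.kept)) N
    (fun t => h.exists_segment hL t.1 t.2.1 t.2.2) fun σ hσ => ?_
  -- Loomis-Whitney for the triples `(i, j, k)` charged to `σ`. The three projections are the trees
  -- touched, the entries of `P` present and the entries of `Q` present.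
  refine (Nat.pow_le_pow_iff_left two_ne_zero).1 ((card_sq_le_of_projections _
    (Finset.univ.filter fun p : Fin a × Fin c => R p.1 p.2 ∈ σ.computed ∨
      ∃ w ∈ G.sumsOf (Set.range (m p.1 p.2)), w ∈ σ.kept)
    (Finset.univ.filter fun p : Fin a × Fin b => P p.1 p.2 ∈ σ.avail ∨ P p.1 p.2 ∈ σ.computed)
    (Finset.univ.filter fun p : Fin c × Fin b => Q p.2 p.1 ∈ σ.avail ∨ Q p.2 p.1 ∈ σ.computed)
    ?_ ?_ ?_).trans ?_)
  · intro t ht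
    simpa using (Finset.mem_filter.1 ht).2.2
  · intro t ht
    simpa using h.left_mem hL hσ (Finset.mem_filter.1 ht).2.1
  · intro t ht
    simpa using h.right_mem hL hσ (Finset.mem_filter.1 ht).2.1
  · refine le_trans (Nat.mul_le_mul ?_ (Nat.mul_le_mul (hA σ hσ) (hB σ hσ))) hN
    rw [Finset.filter_or]
    refine (Finset.card_union_le _ _).trans (add_le_add (hC σ hσ) ?_)
    -- The trees are disjoint, so at most `M + T` of them have a kept node.
    refine (card_filter_meets_le (fun p : Fin a × Fin c => G.sumsOf (Set.range (m p.1 p.2)))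
      (fun p q v hp hq => Prod.ext_iff.2 (h.disjoint hp hq)) σ.kept).trans (hL.card_kept σ hσ)

end MulTrees

/-! ### The score matrix in a segment -/

/-- Two chained standard matrix multiplications `S = A X`, `Z = S Bᵀ` from input nodes. -/
structure ScoreTrees (G : Circuit ι) {n d : ℕ} (A B : Fin n → Fin d → G.V)
    (X : Fin d → Fin d → G.V) (S : Fin n → Fin d → G.V) (Z : Fin n → Fin n → G.V)
    (mS : Fin n → Fin d → Fin d → G.V) (mZ : Fin n → Fin n → Fin d → G.V) : Prop where
  A_input : ∀ i k, G.dag.IsInput (A i k)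
  B_input : ∀ i k, G.dag.IsInput (B i k)
  X_input : ∀ k l, G.dag.IsInput (X k l)
  A_inj : ∀ i k i' k', A i k = A i' k' → i = i' ∧ k = k'
  B_inj : ∀ i k i' k', B i k = B i' k' → i = i' ∧ k = k'
  X_inj : ∀ i k i' k', X i k = X i' k' → i = i' ∧ k = k'
  S_trees : G.MulTrees A X S mS
  Z_trees : G.MulTrees S (fun k j => B j k) Z mZ

/-- The trees of a chain of two standard matrix multiplications. -/
theorem exists_scoreTrees {n d : ℕ} {A B : Matrix (Fin n) (Fin d) G.V}
    {X : Matrix (Fin d) (Fin d) G.V} {S : Matrix (Fin n) (Fin d) G.V}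
    {Z : Matrix (Fin n) (Fin n) G.V}
    (A_input : ∀ i k, G.dag.IsInput (A i k)) (B_input : ∀ i k, G.dag.IsInput (B i k))
    (X_input : ∀ k l, G.dag.IsInput (X k l))
    (A_inj : ∀ i k i' k', A i k = A i' k' → i = i' ∧ k = k')
    (B_inj : ∀ i k i' k', B i k = B i' k' → i = i' ∧ k = k')
    (X_inj : ∀ i k i' k', X i k = X i' k' → i = i' ∧ k = k')
    (hAX : ∀ i k l l', A i k ≠ X l l') (hS : G.StdMul A X S) (hZ : G.StdMul S Bᵀ Z) :
    ∃ mS mZ, G.ScoreTrees A B X S Z mS mZ := by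
  choose mS hmS hS using hS
  choose mZ hmZ hZ using hZ
  have hSt : G.MulTrees A X S mS := by
    refine ⟨hmS, hS, fun i j k i' j' k' h => ?_⟩
    have h' := hmS i' j' k'
    rw [← h] at h'
    -- A product gate fixes its factors up to order; exchanged factors would identify an entry of
    -- `A` with one of `X`.
    rcases (hmS i j k).unique h' with ⟨h1, h2⟩ | ⟨h1, -⟩
    · obtain ⟨rfl, rfl⟩ := A_inj _ _ _ _ h1
      exact ⟨rfl, (X_inj _ _ _ _ h2).2, rfl⟩
    · exact absurd h1 (hAX _ _ _ _)
  refine ⟨mS, mZ, A_input, B_input, X_input, A_inj, B_inj, X_inj, hSt, hmZ, hZ, ?_⟩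
  intro i j k i' j' k' h
  have h' := hmZ i' j' k'
  rw [← h] at h'
  rcases (hmZ i j k).unique h' with ⟨h1, h2⟩ | ⟨h1, -⟩
  · have h3 := hSt.root_mem i k
    rw [h1] at h3
    obtain ⟨rfl, rfl⟩ := hSt.disjoint h3 (hSt.root_mem i' k')
    exact ⟨rfl, (B_inj _ _ _ _ h2).1, rfl⟩
  -- Exchanged factors would make a root of a tree of `S` an input node.
  · refine absurd (B_input j' k') ?_
    rw [Matrix.transpose_apply] at h1
    rw [← h1]
    exact hSt.not_isInput (hSt.root_mem i k)

namespace ScoreTrees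

variable {n d M T q : ℕ} {A B : Fin n → Fin d → G.V}
    {X : Fin d → Fin d → G.V} {S : Fin n → Fin d → G.V} {Z : Fin n → Fin n → G.V}
    {mS : Fin n → Fin d → Fin d → G.V} {mZ : Fin n → Fin n → Fin d → G.V}
    {L : List (Segment G.V)} {σ : Segment G.V}

theorem mem_avail_of_isInput (hL : G.dag.Segmentation M T q L) (hσ : σ ∈ L) {v : G.V}
    (hv : G.dag.IsInput v) (h : v ∈ σ.avail ∨ v ∈ σ.computed) : v ∈ σ.avail :=
  h.resolve_right fun h' => hL.not_input σ hσ v h' hv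

open Classical in
-- Input nodes are never computed, so those present in a segment are all available.
theorem card_filter_input_le {α : Type} [Fintype α] (F : α → G.V) (hF : Function.Injective F)
    (hI : ∀ a, G.dag.IsInput (F a)) (hL : G.dag.Segmentation M T q L) (hσ : σ ∈ L) :
    (Finset.univ.filter fun a => F a ∈ σ.avail ∨ F a ∈ σ.computed).card ≤ M + T := by
  refine le_trans (Finset.card_le_card ?_) ((card_filter_meets_le (fun a => ({F a} : Set G.V))
    ?_ σ.avail).trans (hL.card_avail σ hσ))
  · intro a ha
    simpa using mem_avail_of_isInput hL hσ (hI a) (Finset.mem_filter.1 ha).2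
  · intro a b v ha hb
    exact hF (ha.symm.trans hb)

/-- A member of a row of `A`, or of the corresponding trees of `S`, is available. -/
def RowAvail (G : Circuit ι) (A : Fin n → Fin d → G.V) (mS : Fin n → Fin d → Fin d → G.V)
    (σ : Segment G.V) (i : Fin n) : Prop :=
  ∀ k, ∃ v ∈ ({A i k} ∪ G.sumsOf (Set.range (mS i k)) : Set G.V), v ∈ σ.avail

open Classical in
-- The sets formed by `A i k` and the tree of `S i k` are pairwise disjoint, so each such row uses
-- up `d` available nodes of its own.
theorem mul_card_rowAvail_le (h : G.ScoreTrees A B X S Z mS mZ)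
    (hL : G.dag.Segmentation M T q L) (hσ : σ ∈ L) :
    d * (Finset.univ.filter (RowAvail G A mS σ)).card ≤ M + T := by
  have hD : ∀ i k j l v, v ∈ ({A i k} ∪ G.sumsOf (Set.range (mS i k)) : Set G.V) →
      v ∈ ({A j l} ∪ G.sumsOf (Set.range (mS j l)) : Set G.V) → i = j ∧ k = l := by
    rintro i k j l v (rfl | hv) (hw | hw)
    · exact h.A_inj _ _ _ _ hw
    · exact absurd (h.A_input i k) (h.S_trees.not_isInput hw)
    · cases hw
      exact absurd (h.A_input j l) (h.S_trees.not_isInput hv)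
    · exact h.S_trees.disjoint hv hw
  exact (mul_card_rows_le _ hD σ.avail _ fun i hi => by simpa [RowAvail] using hi).trans
    (hL.card_avail σ hσ)

/-- The bound `K + (K / D)²`, cleared of denominators. -/
theorem sq_mul_card_le {α β : Type} [DecidableEq α] [DecidableEq β]
    {K D : ℕ} (C U : Finset (α × β)) (I : Finset α) (J : Finset β)
    (hC : C ⊆ U ∪ I ×ˢ J) (hU : U.card ≤ K) (hI : D * I.card ≤ K) (hJ : D * J.card ≤ K) :
    D ^ 2 * C.card ≤ D ^ 2 * K + K ^ 2 := by
  have h1 : C.card ≤ K + I.card * J.card := by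
    refine (Finset.card_le_card hC).trans ((Finset.card_union_le _ _).trans ?_)
    rw [Finset.card_product]
    omega
  calc D ^ 2 * C.card ≤ D ^ 2 * (K + I.card * J.card) := Nat.mul_le_mul_left _ h1
    _ = D ^ 2 * K + (D * I.card) * (D * J.card) := by ring
    _ ≤ D ^ 2 * K + K * K := by gcongr
    _ = _ := by ring

open Classical in
-- An entry with no available node in its tree has all its products computed in the segment, which
-- requires a full row of `A` and a full column of `X` to be available.
theorem sq_mul_card_S_le (h : G.ScoreTrees A B X S Z mS mZ)
    (hL : G.dag.Segmentation M T q L) (hσ : σ ∈ L) :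
    d ^ 2 * (Finset.univ.filter fun p : Fin n × Fin d =>
      S p.1 p.2 ∈ σ.avail ∨ S p.1 p.2 ∈ σ.computed).card ≤ d ^ 2 * (M + T) + (M + T) ^ 2 := by
  refine sq_mul_card_le _
    (Finset.univ.filter fun p : Fin n × Fin d =>
      ∃ w ∈ G.sumsOf (Set.range (mS p.1 p.2)), w ∈ σ.avail)
    (Finset.univ.filter (RowAvail G A mS σ))
    (Finset.univ.filter fun j : Fin d => ∀ k, ∃ v ∈ ({X k j} : Set G.V), v ∈ σ.avail)
    ?_ ?_ (h.mul_card_rowAvail_le hL hσ) ?_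
  · rintro ⟨i, j⟩ hp
    simp only [Finset.mem_filter, Finset.mem_univ, true_and, Finset.mem_union,
      Finset.mem_product] at hp ⊢
    rcases hp with hp | hp
    · exact .inl ⟨_, h.S_trees.root_mem i j, hp⟩
    · rcases h.S_trees.avail_or_computed hL hσ hp with h' | h'
      · exact .inl h'
      · exact .inr ⟨fun k => ⟨_, .inl rfl, mem_avail_of_isInput hL hσ (h.A_input i k)
          (h.S_trees.left_mem hL hσ (h' k))⟩, fun k => ⟨_, rfl,
          mem_avail_of_isInput hL hσ (h.X_input k j) (h.S_trees.right_mem hL hσ (h' k))⟩⟩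
  · exact (card_filter_meets_le (fun p : Fin n × Fin d => G.sumsOf (Set.range (mS p.1 p.2)))
      (fun p q v hp hq => Prod.ext_iff.2 (h.S_trees.disjoint hp hq)) σ.avail).trans
      (hL.card_avail σ hσ)
  · refine (mul_card_rows_le (fun j k => ({X k j} : Set G.V)) ?_ σ.avail _
      fun j hj => (Finset.mem_filter.1 hj).2).trans (hL.card_avail σ hσ)
    intro j k j' k' v hv hv'
    exact (h.X_inj _ _ _ _ (hv.symm.trans hv')).symm

open Classical in
-- An entry `Z i j` with no available node in its tree requires the full row `j` of `B`, and for row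
-- `i` one available node for each `k`, either `A i k` or from the tree of `S i k`. At most `(M +
-- T)/d` rows of either kind exist.
theorem sq_mul_card_Z_le (h : G.ScoreTrees A B X S Z mS mZ)
    (hL : G.dag.Segmentation M T q L) (hσ : σ ∈ L) :
    d ^ 2 * (Finset.univ.filter fun p : Fin n × Fin n => Z p.1 p.2 ∈ σ.computed).card ≤
      d ^ 2 * (M + T) + (M + T) ^ 2 := by
  refine sq_mul_card_le _
    (Finset.univ.filter fun p : Fin n × Fin n =>
      ∃ w ∈ G.sumsOf (Set.range (mZ p.1 p.2)), w ∈ σ.avail)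
    (Finset.univ.filter (RowAvail G A mS σ))
    (Finset.univ.filter fun j : Fin n => ∀ k, ∃ v ∈ ({B j k} : Set G.V), v ∈ σ.avail)
    ?_ ?_ (h.mul_card_rowAvail_le hL hσ) ?_
  · rintro ⟨i, j⟩ hp
    simp only [Finset.mem_filter, Finset.mem_univ, true_and, Finset.mem_union,
      Finset.mem_product] at hp ⊢
    rcases h.Z_trees.avail_or_computed hL hσ hp with h' | h'
    · exact .inl h'
    · refine .inr ⟨?_, fun k => ⟨_, rfl,
          mem_avail_of_isInput hL hσ (h.B_input j k) (h.Z_trees.right_mem hL hσ (h' k))⟩⟩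
      -- If a single entry of row `i` of `S` is computed from scratch, the whole row of `A` is
      -- available. If none is, each entry of that row of `S` has an available node in its tree.
      by_cases hall : ∃ l, ∀ k, mS i l k ∈ σ.computed
      · obtain ⟨l, hl⟩ := hall
        exact fun k => ⟨_, .inl rfl, mem_avail_of_isInput hL hσ (h.A_input i k)
          (h.S_trees.left_mem hL hσ (hl k))⟩
      · intro k
        rcases h.Z_trees.left_mem hL hσ (h' k) with hS | hS
        · exact ⟨_, .inr (h.S_trees.root_mem i k), hS⟩
        · rcases h.S_trees.avail_or_computed hL hσ hS with ⟨w, hw, hw'⟩ | hc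
          · exact ⟨w, .inr hw, hw'⟩
          · exact absurd ⟨k, hc⟩ hall
  · exact (card_filter_meets_le (fun p : Fin n × Fin n => G.sumsOf (Set.range (mZ p.1 p.2)))
      (fun p q v hp hq => Prod.ext_iff.2 (h.Z_trees.disjoint hp hq)) σ.avail).trans
      (hL.card_avail σ hσ)
  · refine (mul_card_rows_le (fun j k => ({B j k} : Set G.V)) ?_ σ.avail _
      fun j hj => (Finset.mem_filter.1 hj).2).trans (hL.card_avail σ hσ)
    intro j k j' k' v hv hv'
    exact h.B_inj _ _ _ _ (hv.symm.trans hv')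

/-! ### The two cache regimes -/

/-- Every input node that a computed product reads has to be input. -/
theorem card_le_of_inputs {α : Type} [Fintype α] (F : α → G.V) (hF : Function.Injective F)
    (hI : ∀ a, G.dag.IsInput (F a)) (hL : G.dag.Segmentation M T q L)
    (hchild : ∀ a, ∃ v, F a ∈ G.dag.parents v) : Fintype.card α ≤ q := by
  obtain ⟨I, hIq, hI'⟩ := hL.reads
  refine le_trans ?_ hIq
  rw [← Finset.card_univ]
  refine Finset.card_le_card_of_injOn F (fun a _ => ?_) hF.injOn
  obtain ⟨v, hv⟩ := hchild a
  obtain ⟨σ, hσ, hvσ⟩ := hL.exists_computed v fun hvi => by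
    rw [show G.dag.parents v = ∅ from hvi] at hv
    exact Finset.notMem_empty _ hv
  exact hI' σ hσ _ (mem_avail_of_isInput hL hσ (hI a) (hL.parents σ hσ v hvσ _ hv)) (hI a)

/-- This and the next bound pay for the incomplete last segment; for large caches this one also
yields the term `n d³ / M`. -/
theorem mul_le_reads (h : G.ScoreTrees A B X S Z mS mZ) (hL : G.dag.Segmentation M T q L)
    (hd : 0 < d) : n * d ≤ q := by
  have := card_le_of_inputs (fun p : Fin n × Fin d => A p.1 p.2)
    (fun p r hpr => Prod.ext_iff.2 (h.A_inj _ _ _ _ hpr)) (fun p => h.A_input _ _) hL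
    fun p => ⟨mS p.1 ⟨0, hd⟩ p.2, mem_dag_parents.2 (by simp [(h.S_trees.prod _ _ _).parents])⟩
  simpa using this

theorem sq_le_reads (h : G.ScoreTrees A B X S Z mS mZ) (hL : G.dag.Segmentation M T q L)
    (hn : 0 < n) : d * d ≤ q := by
  have := card_le_of_inputs (fun p : Fin d × Fin d => X p.1 p.2)
    (fun p r hpr => Prod.ext_iff.2 (h.X_inj _ _ _ _ hpr)) (fun p => h.X_input _ _) hL
    fun p => ⟨mS ⟨0, hn⟩ p.2 p.1, mem_dag_parents.2 (by simp [(h.S_trees.prod _ _ _).parents])⟩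
  simpa using this

open Classical in
-- For large caches it suffices to count entries of `Z`: the bound `2 d² M + 4 M²` per segment,
-- scaled by `d²`, is at most `6 M²`.
theorem sq_mul_sq_le (h : G.ScoreTrees A B X S Z mS mZ) (hL : G.dag.Segmentation M M q L)
    (hM : d ^ 2 ≤ M) : n ^ 2 * d ^ 2 ≤ L.length * (6 * M ^ 2) := by
  rcases Nat.eq_zero_or_pos d with rfl | hd
  · simp
  have hcard : Fintype.card (Fin n × Fin n) = n ^ 2 := by simp [sq]
  have hN : ∀ σ ∈ L, (Finset.univ.filter fun p : Fin n × Fin n => Z p.1 p.2 ∈ σ.computed).card ≤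
      6 * M ^ 2 / d ^ 2 := by
    intro σ hσ
    rw [Nat.le_div_iff_mul_le (by positivity)]
    have := h.sq_mul_card_Z_le hL hσ
    nlinarith
  have := card_le_length_mul L (fun σ (p : Fin n × Fin n) => Z p.1 p.2 ∈ σ.computed) _
    (fun p => hL.exists_computed _ (h.Z_trees.not_isInput (h.Z_trees.root_mem _ _))) hN
  rw [hcard] at this
  calc n ^ 2 * d ^ 2 ≤ L.length * (6 * M ^ 2 / d ^ 2) * d ^ 2 := Nat.mul_le_mul_right _ this
    _ = L.length * (6 * M ^ 2 / d ^ 2 * d ^ 2) := by ring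
    _ ≤ _ := Nat.mul_le_mul_left _ (Nat.div_mul_le_self _ _)

/-- Here `(2M)² ≤ 4 d² M`, which leaves `2M + 4M` after division by `d²`. -/
theorem card_le_six {c : ℕ} (hM : M ≤ d ^ 2) (hd : 0 < d)
    (h : d ^ 2 * c ≤ d ^ 2 * (M + M) + (M + M) ^ 2) : c ≤ 6 * M := by
  have hd2 : 0 < d ^ 2 := by positivity
  refine Nat.le_of_mul_le_mul_left (h.trans ?_) hd2
  nlinarith

open Classical in
theorem card_S_le (h : G.ScoreTrees A B X S Z mS mZ)
    (hL : G.dag.Segmentation M M q L) (hM : M ≤ d ^ 2) (hd : 0 < d) (hσ : σ ∈ L) :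
    (Finset.univ.filter fun p : Fin n × Fin d =>
      S p.1 p.2 ∈ σ.avail ∨ S p.1 p.2 ∈ σ.computed).card ≤ 6 * M :=
  card_le_six hM hd (h.sq_mul_card_S_le hL hσ)

/-- The count for `S = A X`. -/
theorem mul_sq_le (h : G.ScoreTrees A B X S Z mS mZ) (hL : G.dag.Segmentation M M q L)
    (hM : M ≤ d ^ 2) (hd : 0 < d) {N : ℕ} (hN : 96 * M ^ 3 ≤ N ^ 2) :
    n * (d * d) ≤ L.length * N := by
  classical
  -- Both factors are inputs, so the requirement is only `(6M + 2M) · 2M · 2M = 32 M³`.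
  refine h.S_trees.mul_le_length_mul hL (kA := M + M) (kB := M + M) (kC := 6 * M) ?_ ?_ ?_ ?_
  · exact fun σ hσ => card_filter_input_le (fun p : Fin n × Fin d => A p.1 p.2)
      (fun p r hpr => Prod.ext_iff.2 (h.A_inj _ _ _ _ hpr)) (fun p => h.A_input _ _) hL hσ
  · exact fun σ hσ => card_filter_input_le (fun p : Fin d × Fin d => X p.2 p.1)
      (fun p r hpr => Prod.ext_iff.2 (h.X_inj _ _ _ _ hpr).symm) (fun p => h.X_input _ _) hL hσ
  · refine fun σ hσ => le_trans (Finset.card_le_card ?_) (h.card_S_le hL hM hd hσ)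
    exact Finset.monotone_filter_right _ fun p _ hp => .inr hp
  · refine le_trans ?_ hN
    ring_nf
    gcongr
    norm_num

/-- The count for `Z = S Bᵀ`. -/
theorem sq_mul_le (h : G.ScoreTrees A B X S Z mS mZ) (hL : G.dag.Segmentation M M q L)
    (hM : M ≤ d ^ 2) (hd : 0 < d) {N : ℕ} (hN : 96 * M ^ 3 ≤ N ^ 2) :
    n * (n * d) ≤ L.length * N := by
  classical
  -- The left factor `S` is not an input; `(6M + 2M) · 6M · 2M = 96 M³` is the source of the
  -- constant.
  refine h.Z_trees.mul_le_length_mul hL (kA := 6 * M) (kB := M + M) (kC := 6 * M) ?_ ?_ ?_ ?_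
  · exact fun σ hσ => h.card_S_le hL hM hd hσ
  · exact fun σ hσ => card_filter_input_le (fun p : Fin n × Fin d => B p.1 p.2)
      (fun p r hpr => Prod.ext_iff.2 (h.B_inj _ _ _ _ hpr)) (fun p => h.B_input _ _) hL hσ
  · exact fun σ hσ => card_le_six hM hd (h.sq_mul_card_Z_le hL hσ)
  · refine le_trans (le_of_eq ?_) hN
    ring

end ScoreTrees

end Circuit

/-! ### The lower bound -/

namespace Circuit

variable {ι : Type} {G : Circuit ι}

theorem StdMul.transpose {a b c : ℕ} {P : Matrix (Fin a) (Fin b) G.V}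
    {Q : Matrix (Fin b) (Fin c) G.V} {R : Matrix (Fin a) (Fin c) G.V} (h : G.StdMul P Q R) :
    G.StdMul Qᵀ Pᵀ Rᵀ := by
  intro i j
  obtain ⟨m, hm, hs⟩ := h j i
  exact ⟨m, fun k => (hm k).symm, hs⟩

theorem ScoreTrees.real_bound {n d M q : ℕ} {A B : Fin n → Fin d → G.V}
    {X : Fin d → Fin d → G.V} {S : Fin n → Fin d → G.V} {Z : Fin n → Fin n → G.V}
    {mS : Fin n → Fin d → Fin d → G.V} {mZ : Fin n → Fin n → Fin d → G.V}
    {L : List (Segment G.V)} (h : G.ScoreTrees A B X S Z mS mZ)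
    (hL : G.dag.Segmentation M M q L) (hn : 0 < n) (hd : 0 < d) (hM : 0 < M) :
    attnIOBound n d M ≤ 64 * q := by
  have hM' : (0 : ℝ) < M := by exact_mod_cast hM
  have hLq : M * (L.length - 1) ≤ q := hL.le_q
  have hLpos : 0 < L.length := hL.length_pos
  have hlen : (M : ℝ) * ((L.length : ℝ) - 1) ≤ q := by
    have := hLq
    have h1 := hLpos
    obtain ⟨c, hc⟩ : ∃ c, L.length = c + 1 := ⟨L.length - 1, by omega⟩
    rw [hc] at this ⊢
    push_cast
    have h2 : M * c ≤ q := by simpa using this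
    have h3 : (M : ℝ) * c ≤ q := by exact_mod_cast h2
    linarith
  have hreads : (n : ℝ) * d ≤ q := by exact_mod_cast h.mul_le_reads hL hd
  have hn' : (0 : ℝ) < n := by exact_mod_cast hn
  have hd' : (0 : ℝ) < d := by exact_mod_cast hd
  rcases le_total (d ^ 2) M with hdM | hdM
  · refine (min_le_left _ _).trans ?_
    have hcount : (n : ℝ) ^ 2 * d ^ 2 ≤ L.length * (6 * M ^ 2) := by
      exact_mod_cast h.sq_mul_sq_le hL hdM
    have hdM' : (d : ℝ) ^ 2 ≤ M := by exact_mod_cast hdM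
    rw [div_le_iff₀ hM']
    have h1 : (n : ℝ) * d ^ 3 ≤ q * M := by
      calc (n : ℝ) * d ^ 3 = ((n : ℝ) * d) * d ^ 2 := by ring
        _ ≤ (q : ℝ) * M := by gcongr
    have h2 : (n : ℝ) ^ 2 * d ^ 2 ≤ 12 * (q * M) := by
      -- With one segment, `q` need not reach `M`. The count then says `n d ≤ 3M`, and the inputs
      -- read supply the factor `n d ≤ q`.
      rcases (show L.length = 1 ∨ 2 ≤ L.length by omega) with h1 | h1
      · rw [h1] at hcount
        have h3 : (n : ℝ) * d ≤ 3 * M := by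
          refine (sq_le_sq₀ (by positivity) (by positivity)).1 ?_
          push_cast at hcount
          nlinarith [sq_nonneg (M : ℝ)]
        calc (n : ℝ) ^ 2 * d ^ 2 = ((n : ℝ) * d) * (n * d) := by ring
          _ ≤ (q : ℝ) * (3 * M) := by gcongr
          _ ≤ _ := by nlinarith [mul_nonneg (Nat.cast_nonneg (α := ℝ) q) hM'.le]
      · have h1' : (2 : ℝ) ≤ L.length := by exact_mod_cast h1
        have h3 : (L.length : ℝ) * M ≤ 2 * q := by nlinarith
        calc (n : ℝ) ^ 2 * d ^ 2 ≤ L.length * (6 * M ^ 2) := hcount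
          _ = (L.length * M) * (6 * M) := by ring
          _ ≤ (2 * q) * (6 * M) := by gcongr
          _ = _ := by ring
    have h3 : (0 : ℝ) ≤ q * M := by positivity
    linarith
  · refine (min_le_right _ _).trans ?_
    have hsq : (0 : ℝ) < √M := Real.sqrt_pos.2 hM'
    rw [div_le_iff₀ hsq]
    -- The square of `10 M^{3/2}` exceeds `96 M³`; rounding up costs at most one more `M^{3/2}`.
    set N : ℕ := ⌈10 * (M * √M)⌉₊ with hNdef
    have hN1 : 10 * (M * √M) ≤ N := Nat.le_ceil _
    have h1 : (1 : ℝ) ≤ M * √M := by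
      have : (1 : ℝ) ≤ M := by exact_mod_cast hM
      have h2 : (1 : ℝ) ≤ √M := Real.one_le_sqrt.2 this
      nlinarith
    have hN2 : (N : ℝ) ≤ 11 * (M * √M) := by
      have := (Nat.ceil_lt_add_one (by positivity : (0 : ℝ) ≤ 10 * (M * √M))).le
      linarith
    have hN : 96 * M ^ 3 ≤ N ^ 2 := by
      have h3 : (96 : ℝ) * M ^ 3 ≤ N ^ 2 := by
        calc (96 : ℝ) * M ^ 3 ≤ 100 * (M ^ 2 * √M ^ 2) := by
              rw [Real.sq_sqrt hM'.le]
              have : (0 : ℝ) ≤ (M : ℝ) ^ 3 := by positivity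
              nlinarith
          _ = (10 * (M * √M)) ^ 2 := by ring
          _ ≤ _ := by gcongr
      exact_mod_cast h3
    have c1 : (n : ℝ) * (d * d) ≤ L.length * N := by exact_mod_cast h.mul_sq_le hL hdM hd hN
    have c2 : (n : ℝ) * (n * d) ≤ L.length * N := by exact_mod_cast h.sq_mul_le hL hdM hd hN
    -- Reading `X` gives `q ≥ d² ≥ M`, which covers the incomplete segment.
    have hML : (M : ℝ) * L.length ≤ 2 * q := by
      have hMq : (M : ℝ) ≤ q := by
        have := h.sq_le_reads hL hn
        exact_mod_cast hdM.trans (by rwa [sq])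
      linarith
    have h2 : (L.length : ℝ) * N ≤ 22 * (q * √M) := by
      calc (L.length : ℝ) * N ≤ L.length * (11 * (M * √M)) := by gcongr
        _ = (M * L.length) * (11 * √M) := by ring
        _ ≤ (2 * q) * (11 * √M) := by gcongr
        _ = _ := by ring
    have h3 : (0 : ℝ) ≤ q * √M := by positivity
    nlinarith

theorem IsAttnBackward.exists_scoreTrees {n d : ℕ} {G : Circuit (AttnInput n d)}
    (h : G.IsAttnBackward) : ∃ (A B : Fin n → Fin d → G.V) (X : Fin d → Fin d → G.V)
      (S : Fin n → Fin d → G.V) (Z : Fin n → Fin n → G.V)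
      (mS : Fin n → Fin d → Fin d → G.V) (mZ : Fin n → Fin n → Fin d → G.V),
      G.ScoreTrees A B X S Z mS mZ := by
  obtain ⟨-, a₁, a₂, x, Z, h1, h2, hx, h⟩ := h
  have i1 : ∀ i k, G.dag.IsInput (a₁ i k) := fun i k => by
    simp [dag_isInput_iff, h1, Gate.parents]
  have i2 : ∀ i k, G.dag.IsInput (a₂ i k) := fun i k => by
    simp [dag_isInput_iff, h2, Gate.parents]
  have ix : ∀ i k, G.dag.IsInput (x i k) := fun i k => by
    simp [dag_isInput_iff, hx, Gate.parents]
  have j1 : ∀ i k i' k', a₁ i k = a₁ i' k' → i = i' ∧ k = k' := fun i k i' k' h => by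
    have := h1 i k
    rw [h, h1] at this
    simpa [eq_comm] using this
  have j2 : ∀ i k i' k', a₂ i k = a₂ i' k' → i = i' ∧ k = k' := fun i k i' k' h => by
    have := h2 i k
    rw [h, h2] at this
    simpa [eq_comm] using this
  have jx : ∀ i k i' k', x i k = x i' k' → i = i' ∧ k = k' := fun i k i' k' h => by
    have := hx i k
    rw [h, hx] at this
    simpa [eq_comm] using this
  have d1 : ∀ i k l l', a₁ i k ≠ x l l' := fun i k l l' h => by
    have := h1 i k
    rw [h, hx] at this
    simp at this
  have d2 : ∀ i k l l', a₂ i k ≠ x l l' := fun i k l l' h => by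
    have := h2 i k
    rw [h, hx] at this
    simp at this
  rcases h with ⟨S, hS, hZ⟩ | ⟨R, hR, hZ⟩
  · obtain ⟨mS, mZ, h⟩ := Circuit.exists_scoreTrees i1 i2 ix j1 j2 jx d1 hS hZ
    exact ⟨_, _, _, _, _, _, _, h⟩
  -- Transposed, the second bracketing reads `Zᵀ = (A₂ Xᵀ) A₁ᵀ`, an instance of the first.
  · have hR' : G.StdMul a₂ xᵀ Rᵀ := by simpa using hR.transpose
    obtain ⟨mS, mZ, h⟩ := Circuit.exists_scoreTrees (X := xᵀ) i2 i1 (fun i k => ix k i) j2 j1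
      (fun i k i' k' h => (jx _ _ _ _ h).symm) (fun i k l l' => d2 i k l' l) hR' hZ.transpose
    exact ⟨_, _, _, _, _, _, _, h⟩

theorem IsAttnBackward.le_ioComplexity {n d M : ℕ} (hn : 0 < n) (hd : 0 < d) (hM : 0 < M)
    {G : Circuit (AttnInput n d)} (h : G.IsAttnBackward) :
    ENNReal.ofReal (1 / 64 * attnIOBound n d M) ≤ ((G.dag.ioComplexity M : ℕ∞) : ℝ≥0∞) := by
  have key : ((⌈1 / 64 * attnIOBound n d M⌉₊ : ℕ) : ℕ∞) ≤ G.dag.ioComplexity M := by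
    refine le_iInf₂ fun q hq => ?_
    obtain ⟨s, hplay, hout⟩ := hq
    obtain ⟨A, B, X, S, Z, mS, mZ, ht⟩ := h.exists_scoreTrees
    obtain ⟨L, hL⟩ := hplay.exists_segmentation hM hout
    have := ht.real_bound hL hn hd hM
    rw [Nat.cast_le, Nat.ceil_le]
    linarith
  calc ENNReal.ofReal (1 / 64 * attnIOBound n d M)
      ≤ ENNReal.ofReal (⌈1 / 64 * attnIOBound n d M⌉₊ : ℕ) :=
        ENNReal.ofReal_le_ofReal (Nat.le_ceil _)
    _ = (((⌈1 / 64 * attnIOBound n d M⌉₊ : ℕ) : ℕ∞) : ℝ≥0∞) := by simp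
    _ ≤ _ := by exact_mod_cast key

end Circuit

/-! ### Pebbling with a memory that reading does not erase -/

namespace Dag

variable {G : Dag} {M : ℕ}

/-- The cache can be brought to contain exactly `R`, with the nodes of `Mem` in cache or memory, at
cost `q`, where the cost accounts for writing back the nodes of `Mem` that are only in the cache. -/
def Reach (G : Dag) (M : ℕ) (R Mem : Finset G.V) (q : ℕ) : Prop :=
  ∃ (s : G.Position) (q' : ℕ), G.Play M s q' ∧ s.red = R ∧ Mem ⊆ R ∪ s.blue ∧
    q' + ((R ∩ Mem) \ s.blue).card ≤ q

namespace Reach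

variable {R Mem : Finset G.V} {q : ℕ}

theorem start (G : Dag) (M : ℕ) : G.Reach M ∅ (Finset.univ.filter fun v => G.IsInput v) 0 :=
  ⟨G.start, 0, .nil, rfl, by simp [Dag.start], by simp⟩

theorem mono (h : G.Reach M R Mem q) {Mem' : Finset G.V} {q' : ℕ} (hM : Mem' ⊆ Mem)
    (hq : q ≤ q') : G.Reach M R Mem' q' := by
  obtain ⟨s, r, hs, hr, hb, hc⟩ := h
  refine ⟨s, r, hs, hr, hM.trans hb, le_trans ?_ (hc.trans hq)⟩
  gcongr

/-- One unit is the input move; the other is reserved for restoring the blue pebble that this move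
removes. -/
theorem load (h : G.Reach M R Mem q) {v : G.V} (hv : v ∈ Mem) (hM : (insert v R).card ≤ M) :
    G.Reach M (insert v R) Mem (q + 2) := by
  by_cases hvR : v ∈ R
  · rw [Finset.insert_eq_of_mem hvR]
    exact h.mono subset_rfl (by omega)
  obtain ⟨s, r, hs, rfl, hb, hc⟩ := h
  have hvb : v ∈ s.blue := by simpa [hvR] using hb hv
  refine ⟨_, r + 1, hs.snoc (.input s v hvb) hM, rfl, ?_, ?_⟩
  · intro w hw
    have := hb hw
    simp only [Finset.mem_union, Finset.mem_insert, Finset.mem_erase] at this ⊢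
    tauto
  · have : ((insert v s.red ∩ Mem) \ s.blue.erase v).card ≤
        ((s.red ∩ Mem) \ s.blue).card + 1 := by
      refine (Finset.card_le_card ?_).trans (Finset.card_insert_le v _)
      intro w hw
      simp only [Finset.mem_sdiff, Finset.mem_inter, Finset.mem_insert, Finset.mem_erase] at hw ⊢
      tauto
    change r + 1 + ((insert v s.red ∩ Mem) \ s.blue.erase v).card ≤ q + 2
    omega

theorem compute (h : G.Reach M R Mem q) {v : G.V} (hi : ¬ G.IsInput v) (hp : G.parents v ⊆ R)
    (hM : (insert v R).card ≤ M) : G.Reach M (insert v R) Mem q := by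
  by_cases hvR : v ∈ R
  · rwa [Finset.insert_eq_of_mem hvR]
  obtain ⟨s, r, hs, rfl, hb, hc⟩ := h
  refine ⟨_, r, hs.snoc (.compute s v hi hp) hM, rfl, ?_, ?_⟩
  · exact hb.trans (Finset.union_subset_union_left (Finset.subset_insert _ _))
  -- A node of `Mem` outside the cache is blue, so recomputing it creates no new debt.
  · refine le_trans (Nat.add_le_add_left (Finset.card_le_card ?_) r) hc
    intro w hw
    simp only [Finset.mem_sdiff, Finset.mem_inter, Finset.mem_insert] at hw ⊢
    have := @hb w
    simp only [Finset.mem_union] at this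
    tauto

/-- No move is made: the write is promised and its cost set aside. -/
theorem save (h : G.Reach M R Mem q) {v : G.V} (hv : v ∈ R) :
    G.Reach M R (insert v Mem) (q + 1) := by
  obtain ⟨s, r, hs, rfl, hb, hc⟩ := h
  refine ⟨s, r, hs, rfl, ?_, ?_⟩
  · exact Finset.insert_subset (by simp [hv]) hb
  · have : ((s.red ∩ insert v Mem) \ s.blue).card ≤ ((s.red ∩ Mem) \ s.blue).card + 1 := by
      refine (Finset.card_le_card ?_).trans (Finset.card_insert_le v _)
      intro w hw
      simp only [Finset.mem_sdiff, Finset.mem_inter, Finset.mem_insert] at hw ⊢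
      tauto
    omega

theorem card_le (h : G.Reach M R Mem q) : R.card ≤ M := by
  obtain ⟨s, r, hs, rfl, -⟩ := h
  cases hs with
  | nil => simp [Dag.start]
  | snoc _ _ h => exact h

/-- A node owed to memory leaves the cache by an output move, paid from the reserve; any other node
is deleted for free. -/
theorem erase (h : G.Reach M R Mem q) (v : G.V) : G.Reach M (R.erase v) Mem q := by
  by_cases hvR : v ∈ R
  swap
  · rwa [Finset.erase_eq_of_notMem hvR]
  have hcard := (Finset.card_le_card (Finset.erase_subset v R)).trans h.card_le
  obtain ⟨s, r, hs, rfl, hb, hc⟩ := h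
  by_cases hv : v ∈ Mem ∧ v ∉ s.blue
  · refine ⟨_, r + 1, hs.snoc (.output s v hvR) hcard, rfl, ?_, ?_⟩
    · intro w hw
      have := hb hw
      simp only [Finset.mem_union, Finset.mem_insert, Finset.mem_erase] at this ⊢
      tauto
    · have hmem : v ∈ (s.red ∩ Mem) \ s.blue := by simp [hvR, hv.1, hv.2]
      have h1 := Finset.card_erase_add_one hmem
      have h2 : ((s.red.erase v ∩ Mem) \ insert v s.blue).card ≤
          (((s.red ∩ Mem) \ s.blue).erase v).card := by
        refine Finset.card_le_card fun w hw => ?_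
        simp only [Finset.mem_sdiff, Finset.mem_inter, Finset.mem_insert, Finset.mem_erase] at hw ⊢
        tauto
      change r + 1 + ((s.red.erase v ∩ Mem) \ insert v s.blue).card ≤ q
      omega
  · refine ⟨_, r, hs.snoc (.deleteRed s v) hcard, rfl, ?_, ?_⟩
    · intro w hw
      have := hb hw
      simp only [Finset.mem_union, Finset.mem_erase] at this ⊢
      by_cases hwv : w = v
      · subst hwv
        tauto
      · tauto
    · refine le_trans (Nat.add_le_add_left (Finset.card_le_card ?_) r) hc
      gcongr
      exact Finset.erase_subset _ _

theorem drop (h : G.Reach M R Mem q) {R' : Finset G.V} (hR : R' ⊆ R) : G.Reach M R' Mem q := by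
  have key : ∀ X : Finset G.V, G.Reach M (R \ X) Mem q := by
    intro X
    induction X using Finset.induction_on with
    | empty => simpa using h
    | insert v X _ ih =>
      rw [Finset.sdiff_insert]
      exact ih.erase v
  simpa [Finset.inter_eq_right.2 hR] using key (R \ R')

theorem loadSet (h : G.Reach M R Mem q) {X : Finset G.V} (hX : X ⊆ Mem)
    (hM : (R ∪ X).card ≤ M) : G.Reach M (R ∪ X) Mem (q + 2 * X.card) := by
  induction X using Finset.induction_on with
  | empty => simpa using h
  | insert v X hv ih =>
    rw [Finset.union_insert] at hM ⊢
    rw [Finset.card_insert_of_notMem hv]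
    exact (ih ((Finset.subset_insert _ _).trans hX)
      ((Finset.card_le_card (Finset.subset_insert _ _)).trans hM)).load
      (hX (Finset.mem_insert_self _ _)) hM

theorem saveSet (h : G.Reach M R Mem q) {X : Finset G.V} (hX : X ⊆ R) :
    G.Reach M R (Mem ∪ X) (q + X.card) := by
  induction X using Finset.induction_on with
  | empty => simpa using h
  | insert v X hv ih =>
    rw [Finset.union_insert, Finset.card_insert_of_notMem hv]
    exact (ih ((Finset.subset_insert _ _).trans hX)).save (hX (Finset.mem_insert_self _ _))

/-- Emptying the cache settles all debts, after which every node of `Mem` is blue. -/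
theorem ioComplexity_le (h : G.Reach M R Mem q) (hout : ∀ v, G.IsOutput v → v ∈ Mem) :
    G.ioComplexity M ≤ q := by
  obtain ⟨s, r, hs, hr, hb, hc⟩ := h.drop (Finset.empty_subset R)
  refine (iInf₂_le r ⟨s, hs, fun v hv => by simpa using hb (hout v hv)⟩).trans ?_
  exact_mod_cast (by omega : r ≤ q)

end Reach

/-! ### Computations inside the cache -/

/-- From any cache containing `R`, the node `v` can be computed without input and output, if there
is room for `w` further nodes. -/
def Obtains (G : Dag) (M : ℕ) (R : Finset G.V) (v : G.V) (w : ℕ) : Prop :=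
  ∀ ⦃R' : Finset G.V⦄, R ⊆ R' → R'.card + w ≤ M → ∀ ⦃Mem : Finset G.V⦄ ⦃q : ℕ⦄,
    G.Reach M R' Mem q → G.Reach M (insert v R') Mem q

namespace Obtains

variable {R : Finset G.V} {v : G.V} {w : ℕ}

theorem of_mem (hv : v ∈ R) : G.Obtains M R v w := fun R' hR _ _ _ h => by
  rwa [Finset.insert_eq_of_mem (hR hv)]

theorem mono (h : G.Obtains M R v w) {S : Finset G.V} {w' : ℕ} (hR : R ⊆ S) (hw : w ≤ w') :
    G.Obtains M S v w' := fun _ hR' hM => h (hR.trans hR') (by omega)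

/-- The node `u₁` stays in the cache while `u₂` is obtained, whence `b + 1`; the final step holds
both parents and `v`, whence `3`. -/
theorem of_parents {u₁ u₂ : G.V} {a b : ℕ} (hi : ¬ G.IsInput v) (hp : G.parents v ⊆ {u₁, u₂})
    (h₁ : G.Obtains M R u₁ a) (h₂ : G.Obtains M R u₂ b) (ha : a ≤ w) (hb : b + 1 ≤ w)
    (hw : 3 ≤ w) : G.Obtains M R v w := by
  intro R' hR hM Mem q h
  have c₁ := Finset.card_insert_le u₁ R'
  have c₂ := Finset.card_insert_le u₂ (insert u₁ R')
  have c₃ := Finset.card_insert_le v (insert u₂ (insert u₁ R'))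
  have r₁ := h₁ hR (by omega) h
  have r₂ := h₂ (hR.trans (Finset.subset_insert _ _)) (by omega) r₁
  have r₃ := r₂.compute hi (hp.trans (by intro x; simp; tauto)) (by omega)
  exact r₃.drop (by intro x; simp; tauto)

theorem of_parent {u : G.V} {a : ℕ} (hi : ¬ G.IsInput v) (hp : G.parents v ⊆ {u})
    (h : G.Obtains M R u a) (ha : a ≤ w) (hw : 2 ≤ w) : G.Obtains M R v w := by
  intro R' hR hM Mem q h'
  have c₁ := Finset.card_insert_le u R'
  have c₂ := Finset.card_insert_le v (insert u R')
  have r₂ := (h hR (by omega) h').compute hi (hp.trans (by simp)) (by omega)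
  exact r₂.drop (by intro x; simp; tauto)

end Obtains

theorem Reach.obtainSet {R Mem : Finset G.V} {q w : ℕ} (h : G.Reach M R Mem q) {X : Finset G.V}
    (hX : ∀ v ∈ X, G.Obtains M R v w) (hM : R.card + X.card + w ≤ M) :
    G.Reach M (R ∪ X) Mem q := by
  induction X using Finset.induction_on with
  | empty => simpa using h
  | insert v X hv ih =>
    rw [Finset.card_insert_of_notMem hv] at hM
    rw [Finset.union_insert]
    have := Finset.card_union_le R X
    exact hX v (by simp) Finset.subset_union_left (by omega)
      (ih (fun u hu => hX u (by simp [hu])) (by omega))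

/-! ### Schedules that write sets of nodes -/

/-- Starting from an empty cache and a memory that contains `Mem`, the nodes of `X` can be written
to memory at cost `κ`. -/
def Makes (G : Dag) (M : ℕ) (Mem X : Finset G.V) (κ : ℕ) : Prop :=
  ∀ ⦃Mem' : Finset G.V⦄, Mem ⊆ Mem' → ∀ ⦃q : ℕ⦄, G.Reach M ∅ Mem' q →
    G.Reach M ∅ (Mem' ∪ X) (q + κ)

namespace Makes

variable {Mem X Y : Finset G.V} {κ κ' : ℕ}

theorem mono (h : G.Makes M Mem X κ) {Mem' X' : Finset G.V} (hM : Mem ⊆ Mem') (hX : X' ⊆ X)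
    (hκ : κ ≤ κ') : G.Makes M Mem' X' κ' := fun _ hM' _ h' =>
  (h (hM.trans hM') h').mono (Finset.union_subset_union_right hX) (by omega)

theorem trans (h : G.Makes M Mem X κ) (h' : G.Makes M (Mem ∪ X) Y κ') :
    G.Makes M Mem (X ∪ Y) (κ + κ') := fun Mem' hM q hr => by
  rw [← Finset.union_assoc, ← add_assoc]
  exact h' (Finset.union_subset_union_left hM) (h hM hr)

theorem biUnion {τ : Type} (B : Finset τ) (Z : τ → Finset G.V)
    (h : ∀ t ∈ B, G.Makes M Mem (Z t) κ) : G.Makes M Mem (B.biUnion Z) (B.card * κ) := by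
  classical
  induction B using Finset.induction_on with
  | empty => exact fun Mem' _ q hr => by simpa using hr
  | insert t B ht ih =>
    have h1 := (ih fun u hu => h u (by simp [hu])).trans
      ((h t (by simp)).mono Finset.subset_union_left subset_rfl le_rfl)
    refine h1.mono subset_rfl ?_ ?_
    · rw [Finset.biUnion_insert, Finset.union_comm]
    · rw [Finset.card_insert_of_notMem ht, add_mul, one_mul]

/-- Loading some nodes, computing a node from them and writing it. -/
theorem single {L : Finset G.V} {v : G.V} {ℓ w : ℕ} (hL : L ⊆ Mem) (hℓ : L.card ≤ ℓ)
    (h : G.Obtains M L v w) (hM : ℓ + w ≤ M) : G.Makes M Mem {v} (2 * ℓ + 1) := by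
  intro Mem' hMem q hr
  have h1 := hr.loadSet (X := L) (hL.trans hMem) (by simp; omega)
  rw [Finset.empty_union] at h1
  have h2 := (h subset_rfl (by omega) h1).saveSet (X := {v}) (by simp)
  exact (h2.drop (Finset.empty_subset _)).mono subset_rfl (by simp; omega)

end Makes

/-- Computing the nodes one after the other, each by loading its parents. -/
theorem Reach.univ_of_card_parents_le (hM : 3 ≤ M) (hG : ∀ v, (G.parents v).card ≤ 2) :
    G.Reach M ∅ Finset.univ (5 * Fintype.card G.V) := by
  have key : ∀ (k : ℕ) (Mem : Finset G.V) (q : ℕ), (Finset.univ \ Mem).card = k →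
      (∀ v, G.IsInput v → v ∈ Mem) → G.Reach M ∅ Mem q →
      G.Reach M ∅ Finset.univ (q + 5 * k) := by
    intro k
    induction k with
    | zero =>
      intro Mem q hk _ hr
      rw [Finset.card_eq_zero, Finset.sdiff_eq_empty_iff_subset] at hk
      exact hr.mono hk (by omega)
    | succ k ih =>
      intro Mem q hk hin hr
      have hne : (Finset.univ \ Mem : Finset G.V).Nonempty := by
        rw [← Finset.card_pos]; omega
      -- A minimal node missing from memory has its parents there; two loads and one write cost `2 ·
      -- 2 + 1 = 5`.
      obtain ⟨v, hv, hmin⟩ := G.acyclic.has_min {v | v ∉ Mem}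
        (hne.imp fun v hv => by simpa using hv)
      have hp : G.parents v ⊆ Mem := fun u hu => by
        by_contra h
        exact hmin u h hu
      have hvi : ¬ G.IsInput v := fun h => hv (hin v h)
      have hc := Finset.card_insert_le v (G.parents v)
      have h1 := hr.loadSet hp (by simpa using (hG v).trans (by omega))
      rw [Finset.empty_union] at h1
      have h2 := ((h1.compute hvi subset_rfl (hc.trans (by have := hG v; omega))).save
        (Finset.mem_insert_self _ _)).drop (Finset.empty_subset _)
      refine (ih (insert v Mem) _ ?_ (fun u hu => by simp [hin u hu]) h2).mono subset_rfl ?_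
      · have : Finset.univ \ insert v Mem = (Finset.univ \ Mem).erase v := by
          rw [Finset.sdiff_insert]
        rw [this, Finset.card_erase_of_mem (by simpa using hv)]
        omega
      · have := hG v
        omega
  have h0 := key _ _ 0 rfl (by simp) (Reach.start G M)
  exact h0.mono subset_rfl (by
    have := Finset.card_le_univ
      (Finset.univ \ Finset.univ.filter fun v => G.IsInput v : Finset G.V)
    omega)

end Dag

/-! ### Running sums and blocked computations -/

/-- The running sums of the terms `p`, where `s k` is the node for the sum of `p 0, …, p (k + 1)`.
-/
def comb {V : Type} {N : ℕ} (p : Fin (N + 1) → V) (s : Fin N → V) : Fin (N + 1) → V :=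
  Fin.cases (p 0) s

@[simp] theorem comb_zero {V : Type} {N : ℕ} (p : Fin (N + 1) → V) (s : Fin N → V) :
    comb p s 0 = p 0 := rfl

@[simp] theorem comb_succ {V : Type} {N : ℕ} (p : Fin (N + 1) → V) (s : Fin N → V) (k : Fin N) :
    comb p s k.succ = s k := rfl

/-- The indices in the `t`-th block of length `s`. -/
def block {a : ℕ} (s t : ℕ) : Finset (Fin a) := Finset.univ.filter fun i => i.val / s = t

theorem card_block_le {a s : ℕ} (hs : 0 < s) (t : ℕ) : (block s t : Finset (Fin a)).card ≤ s := by
  calc _ ≤ (Finset.range s).card := by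
        refine Finset.card_le_card_of_injOn (fun i => i.val % s) (fun i _ => ?_) ?_
        · simpa using Nat.mod_lt _ hs
        · intro i hi j hj h
          simp only [block, Finset.coe_filter, Finset.mem_univ, true_and,
            Set.mem_ofPred_eq] at hi hj
          have h1 := Nat.div_add_mod i.val s
          have h2 := Nat.div_add_mod j.val s
          simp only at h
          rw [hi, h] at h1
          rw [hj] at h2
          exact Fin.ext (h1.symm.trans h2)
    _ = s := Finset.card_range s

theorem mem_block {a s : ℕ} (i : Fin a) : i ∈ (block s (i.val / s) : Finset (Fin a)) := by
  simp [block]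

theorem div_mem_range {a s : ℕ} (i : Fin a) : i.val / s ∈ Finset.range (a / s + 1) := by
  rw [Finset.mem_range, Nat.lt_succ_iff]
  exact Nat.div_le_div_right i.isLt.le

namespace Dag

variable {G : Dag} {M : ℕ}

/-- The nodes `s` compute the running sums of the nodes `p`. -/
def IsComb (G : Dag) {N : ℕ} (p : Fin (N + 1) → G.V) (s : Fin N → G.V) : Prop :=
  ∀ k, ¬ G.IsInput (s k) ∧ G.parents (s k) ⊆ {comb p s k.castSucc, p k.succ}

/-- Only the preceding running sum is held while the next term is obtained, so the extra room does
not grow with the number of terms. -/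
theorem IsComb.obtains {N : ℕ} {p : Fin (N + 1) → G.V} {s : Fin N → G.V} (h : G.IsComb p s)
    {R : Finset G.V} {w : ℕ} (hw : 2 ≤ w) (hp : ∀ k, G.Obtains M R (p k) w) (k : Fin (N + 1)) :
    G.Obtains M R (comb p s k) (w + 1) := by
  induction k using Fin.induction with
  | zero => exact (hp 0).mono subset_rfl (by omega)
  | succ k ih =>
    exact .of_parents (h k).1 (h k).2 ih (hp k.succ) le_rfl le_rfl (by omega)

/-- A block of running sums is computed in the cache, with the nodes `R₀` loaded throughout, and
the nodes `L k` loaded for the `k`-th terms. -/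
theorem Makes.combs {τ : Type} {N : ℕ} (Θ : Finset τ) {p : τ → Fin (N + 1) → G.V}
    {s : τ → Fin N → G.V} (hc : ∀ θ, G.IsComb (p θ) (s θ)) {Mem R₀ : Finset G.V}
    {L : Fin (N + 1) → Finset G.V} {r ℓ t w : ℕ} (hR : R₀ ⊆ Mem) (hL : ∀ k, L k ⊆ Mem)
    (hr : R₀.card ≤ r) (hℓ : ∀ k, (L k).card ≤ ℓ) (ht : Θ.card ≤ t) (hw : 2 ≤ w)
    (hp : ∀ k, ∀ θ ∈ Θ, G.Obtains M (R₀ ∪ L k) (p θ k) w) (hM : r + ℓ + 2 * t + w + 1 ≤ M) :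
    G.Makes M Mem (Θ.image fun θ => comb (p θ) (s θ) (Fin.last N))
      (2 * r + (N + 1) * (2 * ℓ) + t) := by
  intro Mem' hMem q hq
  set acc : Fin (N + 1) → Finset G.V := fun k => Θ.image fun θ => comb (p θ) (s θ) k with hacc
  have hcard : ∀ k, (acc k).card ≤ t := fun k => Finset.card_image_le.trans ht
  -- Old and new running sums coexist during an update, which explains `2 * t` in the room required.
  -- Each `k` costs one loading of `L k`.
  have key : ∀ k : Fin (N + 1),
      G.Reach M (R₀ ∪ acc k) Mem' (q + 2 * r + (k + 1) * (2 * ℓ)) := by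
    intro k
    induction k using Fin.induction with
    | zero =>
      have h1 := hq.loadSet (hR.trans hMem) (by simp; omega)
      rw [Finset.empty_union] at h1
      have hu := Finset.card_union_le R₀ (L 0)
      have := hℓ 0
      have h2 := h1.loadSet ((hL 0).trans hMem) (by omega)
      have h3 := h2.obtainSet (X := acc 0) (w := w) (by
        intro v hv
        obtain ⟨θ, hθ, rfl⟩ := Finset.mem_image.1 hv
        exact hp 0 θ hθ) (by have := hcard 0; omega)
      refine (h3.drop ?_).mono subset_rfl ?_
      · intro x; simp; tauto
      · simp; omega
    | succ k ih =>
      have hu := Finset.card_union_le R₀ (acc k.castSucc)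
      have hu' := Finset.card_union_le (R₀ ∪ acc k.castSucc) (L k.succ)
      have c1 := hℓ k.succ
      have c2 := hcard k.castSucc
      have c3 := hcard k.succ
      have h2 := ih.loadSet ((hL k.succ).trans hMem) (by omega)
      have h3 := h2.obtainSet (X := acc k.succ) (w := w + 1) (by
        intro v hv
        obtain ⟨θ, hθ, rfl⟩ := Finset.mem_image.1 hv
        refine .of_parents (hc θ k).1 (hc θ k).2 (a := 0) (.of_mem ?_)
          ((hp k.succ θ hθ).mono ?_ le_rfl) (by omega) le_rfl (by omega)
        · have : comb (p θ) (s θ) k.castSucc ∈ acc k.castSucc :=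
            Finset.mem_image_of_mem _ hθ
          simp [this]
        · intro x; simp; tauto) (by omega)
      refine (h3.drop ?_).mono subset_rfl ?_
      · intro x; simp; tauto
      · simp only [Fin.val_castSucc, Fin.val_succ]
        nlinarith
  have h := ((key (Fin.last N)).saveSet (X := acc (Fin.last N)) (by simp)).drop
    (Finset.empty_subset _)
  refine h.mono subset_rfl ?_
  have := hcard (Fin.last N)
  simp only [Fin.val_last]
  omega

/-- The cost of a matrix multiplication with tiles of size `s`. -/
def tiledCost (a b c s : ℕ) : ℕ :=
  (a / s + 1) * ((c / s + 1) * (b * (4 * s) + s * s))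

/-- Tiled matrix multiplication. -/
theorem Makes.matMul {a N c s : ℕ} (hs : 0 < s) (hM : 2 * s + 2 * (s * s) + 4 ≤ M)
    {P : Fin a → Fin (N + 1) → G.V} {Q : Fin (N + 1) → Fin c → G.V}
    {p : Fin a → Fin c → Fin (N + 1) → G.V} {σ : Fin a → Fin c → Fin N → G.V}
    (hc : ∀ i j, G.IsComb (p i j) (σ i j))
    (hp : ∀ i j k, ¬ G.IsInput (p i j k) ∧ G.parents (p i j k) ⊆ {P i k, Q k j})
    {Mem : Finset G.V} (hP : ∀ i k, P i k ∈ Mem) (hQ : ∀ k j, Q k j ∈ Mem) :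
    G.Makes M Mem
      (Finset.univ.image fun x : Fin a × Fin c => comb (p x.1 x.2) (σ x.1 x.2) (Fin.last N))
      (tiledCost a (N + 1) c s) := by
  have htile : ∀ u v : ℕ, G.Makes M Mem
      (((block s u : Finset (Fin a)) ×ˢ (block s v : Finset (Fin c))).image
        fun x => comb (p x.1 x.2) (σ x.1 x.2) (Fin.last N))
      ((N + 1) * (4 * s) + s * s) := by
    intro u v
    -- The `s * s` running sums of a tile stay in the cache, and for each `k` only `s` entries of
    -- `P` and `s` of `Q` are loaded.
    refine (Makes.combs (M := M) ((block s u : Finset (Fin a)) ×ˢ (block s v : Finset (Fin c)))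
      (p := fun x => p x.1 x.2) (s := fun x => σ x.1 x.2) (fun x => hc x.1 x.2) (R₀ := ∅)
      (L := fun k => (block s u : Finset (Fin a)).image (fun i => P i k) ∪
        (block s v : Finset (Fin c)).image (fun j => Q k j)) (r := 0) (ℓ := s + s)
      (t := s * s) (w := 3) (Finset.empty_subset _) ?_ (by simp) ?_ ?_ (by omega) ?_
      (by omega)).mono subset_rfl subset_rfl (by ring_nf; omega)
    · intro k x hx
      simp only [Finset.mem_union, Finset.mem_image] at hx
      rcases hx with ⟨i, -, rfl⟩ | ⟨j, -, rfl⟩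
      exacts [hP _ _, hQ _ _]
    · intro k
      exact (Finset.card_union_le _ _).trans (add_le_add
        (Finset.card_image_le.trans (card_block_le hs u))
        (Finset.card_image_le.trans (card_block_le hs v)))
    · rw [Finset.card_product]
      exact Nat.mul_le_mul (card_block_le hs u) (card_block_le hs v)
    · rintro k ⟨i, j⟩ hx
      rw [Finset.mem_product] at hx
      refine .of_parents (hp i j k).1 (hp i j k).2 (a := 0) (b := 0) (.of_mem ?_) (.of_mem ?_)
        (by omega) (by omega) le_rfl
      · have := Finset.mem_image_of_mem (fun i => P i k) hx.1
        simp only [Finset.mem_union]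
        exact .inr (.inl this)
      · have := Finset.mem_image_of_mem (fun j => Q k j) hx.2
        simp only [Finset.mem_union]
        exact .inr (.inr this)
  refine (Makes.biUnion (Finset.range (a / s + 1)) _ fun u _ =>
    Makes.biUnion (Finset.range (c / s + 1)) _ fun v _ => htile u v).mono subset_rfl ?_ ?_
  · intro x hx
    obtain ⟨⟨i, j⟩, -, rfl⟩ := Finset.mem_image.1 hx
    simp only [Finset.mem_biUnion]
    exact ⟨_, div_mem_range i, _, div_mem_range j, Finset.mem_image.2
      ⟨(i, j), Finset.mem_product.2 ⟨mem_block i, mem_block j⟩, rfl⟩⟩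
  · simp [tiledCost]

/-- Computing all nodes of a family one after the other, each from few loaded nodes. -/
theorem Makes.each {τ : Type} [Fintype τ] (v : τ → G.V) {Mem : Finset G.V} {ℓ w : ℕ}
    (L : τ → Finset G.V) (hL : ∀ x, L x ⊆ Mem) (hℓ : ∀ x, (L x).card ≤ ℓ)
    (h : ∀ x, G.Obtains M (L x) (v x) w) (hM : ℓ + w ≤ M) :
    G.Makes M Mem (Finset.univ.image v) (Fintype.card τ * (2 * ℓ + 1)) := by
  refine (Makes.biUnion Finset.univ (fun x => {v x}) fun x _ =>
    Makes.single (hL x) (hℓ x) (h x) hM).mono subset_rfl ?_ le_rfl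
  intro y hy
  simpa [eq_comm] using hy

/-- Computing running sums for all rows `i`, a block of `s` rows at a time. -/
theorem Makes.blockCombs {a N s : ℕ} (hs : 0 < s) {τ : Type} (Θ : Finset τ)
    {p : Fin a → τ → Fin (N + 1) → G.V} {σ : Fin a → τ → Fin N → G.V}
    (hc : ∀ i θ, G.IsComb (p i θ) (σ i θ)) {Mem : Finset G.V} (R : Fin a → Finset G.V)
    (L : Fin (N + 1) → Finset G.V) {r ℓ t w : ℕ} (hR : ∀ i, R i ⊆ Mem) (hL : ∀ k, L k ⊆ Mem)
    (hr : ∀ i, (R i).card ≤ r) (hℓ : ∀ k, (L k).card ≤ ℓ) (ht : Θ.card ≤ t) (hw : 2 ≤ w)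
    (hp : ∀ i k, ∀ θ ∈ Θ, G.Obtains M (R i ∪ L k) (p i θ k) w)
    (hM : s * r + ℓ + 2 * (s * t) + w + 1 ≤ M) :
    G.Makes M Mem
      ((Finset.univ ×ˢ Θ).image fun x => comb (p x.1 x.2) (σ x.1 x.2) (Fin.last N))
      ((a / s + 1) * (2 * (s * r) + (N + 1) * (2 * ℓ) + s * t)) := by
  have hblock : ∀ u : ℕ, G.Makes M Mem
      (((block s u : Finset (Fin a)) ×ˢ Θ).image
        fun x => comb (p x.1 x.2) (σ x.1 x.2) (Fin.last N))
      (2 * (s * r) + (N + 1) * (2 * ℓ) + s * t) := by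
    intro u
    refine Makes.combs ((block s u : Finset (Fin a)) ×ˢ Θ) (p := fun x => p x.1 x.2)
      (s := fun x => σ x.1 x.2) (fun x => hc x.1 x.2)
      (R₀ := (block s u : Finset (Fin a)).biUnion R) (L := L) (w := w) ?_ hL ?_ hℓ ?_ hw ?_ hM
    · exact Finset.biUnion_subset.2 fun i _ => hR i
    · exact (Finset.card_biUnion_le_card_mul _ _ _ fun i _ => hr i).trans
        (Nat.mul_le_mul_right _ (card_block_le hs u))
    · rw [Finset.card_product]
      exact Nat.mul_le_mul (card_block_le hs u) ht
    · rintro k ⟨i, θ⟩ hx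
      rw [Finset.mem_product] at hx
      exact (hp i k θ hx.2).mono (Finset.union_subset_union_left
        (Finset.subset_biUnion_of_mem R hx.1)) le_rfl
  refine (Makes.biUnion (Finset.range (a / s + 1)) _ fun u _ => hblock u).mono subset_rfl ?_ ?_
  · intro x hx
    obtain ⟨⟨i, θ⟩, h, rfl⟩ := Finset.mem_image.1 hx
    simp only [Finset.mem_biUnion]
    exact ⟨_, div_mem_range i, Finset.mem_image.2
      ⟨(i, θ), Finset.mem_product.2 ⟨mem_block i, (Finset.mem_product.1 h).2⟩, rfl⟩⟩
  · simp

end Dag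

/-! ### Evaluation of the standard computational graph -/

namespace Circuit

variable {ι : Type} {G : Circuit ι} {x : ι → ℝ} {v u w : G.V}

theorem eval_of_input {i : ι} (h : G.gate v = .input i) : G.eval x v = x i := by
  rw [eval, WellFounded.fix_eq]
  split <;> rename_i heq <;> rw [h] at heq <;> cases heq
  rfl

theorem eval_of_add (h : G.gate v = .add u w) : G.eval x v = G.eval x u + G.eval x w := by
  rw [eval, WellFounded.fix_eq]
  split <;> rename_i heq <;> rw [h] at heq <;> cases heq
  rfl

theorem eval_of_mul (h : G.gate v = .mul u w) : G.eval x v = G.eval x u * G.eval x w := by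
  rw [eval, WellFounded.fix_eq]
  split <;> rename_i heq <;> rw [h] at heq <;> cases heq
  rfl

theorem eval_of_unary {φ : ℝ → ℝ} (h : G.gate v = .unary φ u) :
    G.eval x v = φ (G.eval x u) := by
  rw [eval, WellFounded.fix_eq]
  split <;> rename_i heq <;> rw [h] at heq <;> cases heq
  rfl

theorem eval_of_binary {φ : ℝ → ℝ → ℝ} (h : G.gate v = .binary φ u w) :
    G.eval x v = φ (G.eval x u) (G.eval x w) := by
  rw [eval, WellFounded.fix_eq]
  split <;> rename_i heq <;> rw [h] at heq <;> cases heq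
  rfl

theorem IsProd.eval_eq (h : G.IsProd v u w) : G.eval x v = G.eval x u * G.eval x w := by
  rcases h with h | h
  · exact eval_of_mul h
  · rw [eval_of_mul h, mul_comm]

theorem IsSum.eval_eq {s : Multiset G.V} (h : G.IsSum v s) :
    G.eval x v = (s.map (G.eval x)).sum := by
  induction h with
  | leaf v => simp
  | add hv _ _ ihu ihw => rw [eval_of_add hv, ihu, ihw, Multiset.map_add, Multiset.sum_add]

theorem IsSum.eval_eq_sum {N : ℕ} {t : Fin N → G.V} (h : G.IsSum v (Finset.univ.val.map t)) :
    G.eval x v = ∑ k, G.eval x (t k) := by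
  rw [h.eval_eq, Multiset.map_map]
  rfl

theorem StdMul.eval_eq {a b c : ℕ} {P : Matrix (Fin a) (Fin b) G.V}
    {Q : Matrix (Fin b) (Fin c) G.V} {R : Matrix (Fin a) (Fin c) G.V} (h : G.StdMul P Q R) :
    R.map (G.eval x) = P.map (G.eval x) * Q.map (G.eval x) := by
  ext i j
  obtain ⟨m, hm, hs⟩ := h i j
  rw [Matrix.map_apply, hs.eval_eq_sum, Matrix.mul_apply]
  exact Finset.sum_congr rfl fun k _ => (hm k).eval_eq

theorem StdLayout.isAttnBackward {n d : ℕ} {G : Circuit (AttnInput n d)} (S : G.StdLayout) :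
    G.IsAttnBackward := by
  refine ⟨⟨S.g, S.out, fun D a b => ?_⟩,
    S.a₁, S.a₂, S.x, S.Z, S.a₁_eq, S.a₂_eq, S.x_eq, .inl ⟨S.S, S.S_eq, S.Z_eq⟩⟩
  set e := G.eval D.value with he
  have h1 : S.a₁.map e = D.A₁ := by ext; exact eval_of_input (S.a₁_eq _ _)
  have h2 : S.a₂.map e = D.A₂ := by ext; exact eval_of_input (S.a₂_eq _ _)
  have h3 : S.a₃.map e = D.A₃ := by ext; exact eval_of_input (S.a₃_eq _ _)
  have hdO : S.dO.map e = D.dO := by ext; exact eval_of_input (S.dO_eq _ _)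
  have hx : S.x.map e = D.X := by ext; exact eval_of_input (S.x_eq _ _)
  have hy : S.y.map e = D.Y := by ext; exact eval_of_input (S.y_eq _ _)
  have hZ : S.Z.map e = D.A₁ * D.X * D.A₂ᵀ := by
    rw [S.Z_eq.eval_eq, S.S_eq.eval_eq, Matrix.transpose_map, h1, h2, hx]
  have hE : ∀ i j, e (S.E i j) = D.A i j := fun i j => by
    rw [he, eval_of_unary (S.E_eq i j), AttnData.A, Matrix.map_apply, ← hZ]
    rfl
  have hl : ∀ i, e (S.l i) = D.l i := fun i => by
    rw [he, (S.l_eq i).eval_eq_sum, AttnData.l, Matrix.mulVec, dotProduct]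
    exact Finset.sum_congr rfl fun j _ => by rw [← he, hE, Pi.one_apply, mul_one]
  have hf : ∀ i j, e (S.f i j) = D.f i j := fun i j => by
    rw [he, eval_of_binary (S.f_eq i j), ← he, hE, hl, AttnData.f, Matrix.of_apply, Pi.smul_apply,
      smul_eq_mul, div_eq_inv_mul]
  have hq : S.q.map e = D.q := by
    rw [S.q_eq.eval_eq, Matrix.transpose_map, S.h_eq.eval_eq, ← he, hdO, h3, hy]
    rfl
  have hw : ∀ i j, e (S.w i j) = D.f i j * D.q i j := fun i j => by
    rw [he, (S.w_eq i j).eval_eq, ← he, hf, ← hq, Matrix.map_apply]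
  have hv : ∀ i, e (S.v i) = D.f i ⬝ᵥ D.q i := fun i => by
    rw [he, (S.v_eq i).eval_eq_sum, dotProduct]
    exact Finset.sum_congr rfl fun j _ => hw i j
  -- The identity `(diag(f) - f fᵀ) q = f ∘ q - (f · q) f` for each row.
  have hp : S.p.map e = D.p := by
    ext i j
    rw [Matrix.map_apply, he, eval_of_binary (S.p_eq i j), (S.r_eq i j).eval_eq, ← he, hw, hv, hf,
      AttnData.p, Matrix.of_apply, Matrix.sub_mulVec, Pi.sub_apply, Matrix.mulVec_diagonal,
      Matrix.vecMulVec_mulVec]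
    simp [mul_comm]
  have hg : S.g.map e = D.grad := by
    rw [S.g_eq.eval_eq, S.T_eq.eval_eq, Matrix.transpose_map, ← he, h1, h2, hp]
    rfl
  rw [← hg, Matrix.map_apply]

/-- Running sums form a summation tree. -/
theorem isSum_comb {N : ℕ} {p : Fin (N + 1) → G.V} {s : Fin N → G.V}
    (h : ∀ k, G.gate (s k) = .add (comb p s k.castSucc) (p k.succ)) :
    G.IsSum (comb p s (Fin.last N)) (Finset.univ.val.map p) := by
  induction N with
  | zero => simpa using IsSum.leaf (p 0)
  | succ N ih =>
    have hcomb : ∀ k : Fin (N + 1), comb (fun k => p k.castSucc) (fun k => s k.castSucc) k =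
        comb p s k.castSucc := by
      intro k
      refine Fin.cases ?_ (fun k => ?_) k
      · simp
      · rw [comb_succ, ← Fin.succ_castSucc, comb_succ]
    have h1 : G.IsSum (comb p s (Fin.last N).castSucc)
        (Finset.univ.val.map fun k : Fin (N + 1) => p k.castSucc) := by
      rw [← hcomb]
      refine ih fun k => ?_
      rw [h, hcomb, Fin.succ_castSucc]
    have h2 := IsSum.add (h (Fin.last N)) h1 (IsSum.leaf _)
    rw [← Fin.succ_last, comb_succ]
    convert h2 using 1
    rw [Fin.univ_castSuccEmb]
    simp [Function.comp_def, add_comm]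

end Circuit

/-! ### The computational graph -/

/-- The nodes of the computational graph for sequence length `n + 1` and head dimension `d + 1`.
The flag tells `S` from `h`, `Z` from `q`, and `l` from `v`. -/
inductive AttnNode (n d : ℕ) where
  | a₁ (i : Fin (n + 1)) (k : Fin (d + 1))
  | a₂ (i : Fin (n + 1)) (k : Fin (d + 1))
  | a₃ (i : Fin (n + 1)) (k : Fin (d + 1))
  | dO (i : Fin (n + 1)) (k : Fin (d + 1))
  | x (k l : Fin (d + 1))
  | y (k l : Fin (d + 1))
  | projMul (c : Bool) (i : Fin (n + 1)) (l k : Fin (d + 1))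
  | projSum (c : Bool) (i : Fin (n + 1)) (l : Fin (d + 1)) (k : Fin d)
  | scoreMul (c : Bool) (i j : Fin (n + 1)) (k : Fin (d + 1))
  | scoreSum (c : Bool) (i j : Fin (n + 1)) (k : Fin d)
  | exp (i j : Fin (n + 1))
  | rowSum (c : Bool) (i : Fin (n + 1)) (j : Fin n)
  | f (i j : Fin (n + 1))
  | w (i j : Fin (n + 1))
  | r (i j : Fin (n + 1))
  | p (i j : Fin (n + 1))
  | tMul (k : Fin (d + 1)) (j i : Fin (n + 1))
  | tSum (k : Fin (d + 1)) (j : Fin (n + 1)) (i : Fin n)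
  | gMul (a b : Fin (d + 1)) (j : Fin (n + 1))
  | gSum (a b : Fin (d + 1)) (j : Fin n)
  deriving DecidableEq

namespace AttnNode

variable {n d : ℕ}

/-- The entries of `S` and `h`. -/
def proj (c : Bool) (i : Fin (n + 1)) (l : Fin (d + 1)) : AttnNode n d :=
  comb (projMul c i l) (projSum c i l) (Fin.last d)

/-- The entries of `Z` and `q`. -/
def score (c : Bool) (i j : Fin (n + 1)) : AttnNode n d :=
  comb (scoreMul c i j) (scoreSum c i j) (Fin.last d)

/-- The terms of `l` and `v`. -/
def rowTerm (c : Bool) (i j : Fin (n + 1)) : AttnNode n d := bif c then w i j else exp i j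

/-- The entries of `l` and `v`. -/
def rowTotal (c : Bool) (i : Fin (n + 1)) : AttnNode n d :=
  comb (rowTerm c i) (rowSum c i) (Fin.last n)

/-- The entries of `T`. -/
def t (k : Fin (d + 1)) (j : Fin (n + 1)) : AttnNode n d :=
  comb (tMul k j) (tSum k j) (Fin.last n)

/-- The entries of `g`. -/
def g (a b : Fin (d + 1)) : AttnNode n d := comb (gMul a b) (gSum a b) (Fin.last n)

/-- The left factors of `S` and `h`. -/
def projLeft (c : Bool) (i : Fin (n + 1)) (k : Fin (d + 1)) : AttnNode n d :=
  bif c then a₃ i k else a₁ i k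

/-- The right factors of `S` and `h`. -/
def projRight (c : Bool) (k l : Fin (d + 1)) : AttnNode n d := bif c then y k l else x k l

/-- The left factors of `Z` and `q`. -/
def scoreLeft (c : Bool) (i : Fin (n + 1)) (k : Fin (d + 1)) : AttnNode n d :=
  bif c then dO i k else proj false i k

/-- The right factors of `Z` and `q`, transposed. -/
def scoreRight (c : Bool) (j : Fin (n + 1)) (k : Fin (d + 1)) : AttnNode n d :=
  bif c then proj true j k else a₂ j k

/-- The gates of the computational graph. -/
noncomputable def gate : AttnNode n d → Gate (AttnInput (n + 1) (d + 1)) (AttnNode n d)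
  | a₁ i k => .input (.A₁ i k)
  | a₂ i k => .input (.A₂ i k)
  | a₃ i k => .input (.A₃ i k)
  | dO i k => .input (.dO i k)
  | x k l => .input (.X k l)
  | y k l => .input (.Y k l)
  | projMul c i l k => .mul (projLeft c i k) (projRight c k l)
  | projSum c i l k => .add (comb (projMul c i l) (projSum c i l) k.castSucc) (projMul c i l k.succ)
  | scoreMul c i j k => .mul (scoreLeft c i k) (scoreRight c j k)
  | scoreSum c i j k =>
      .add (comb (scoreMul c i j) (scoreSum c i j) k.castSucc) (scoreMul c i j k.succ)
  | exp i j => .unary Real.exp (score false i j)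
  | rowSum c i j => .add (comb (rowTerm c i) (rowSum c i) j.castSucc) (rowTerm c i j.succ)
  | f i j => .binary (· / ·) (exp i j) (rowTotal false i)
  | w i j => .mul (f i j) (score true i j)
  | r i j => .mul (rowTotal true i) (f i j)
  | p i j => .binary (· - ·) (w i j) (r i j)
  | tMul k j i => .mul (a₁ i k) (p i j)
  | tSum k j i => .add (comb (tMul k j) (tSum k j) i.castSucc) (tMul k j i.succ)
  | gMul a b j => .mul (t a j) (a₂ j b)
  | gSum a b j => .add (comb (gMul a b) (gSum a b) j.castSucc) (gMul a b j.succ)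

/-- The level of a node, which exceeds that of its parents. -/
def level : AttnNode n d → ℕ
  | a₁ _ _ | a₂ _ _ | a₃ _ _ | dO _ _ | x _ _ | y _ _ => 0
  | projMul _ _ _ _ => 1
  | projSum _ _ _ k => 2 + k
  | scoreMul _ _ _ _ => n + d + 5
  | scoreSum _ _ _ k => (n + d + 5) + 1 + k
  | exp _ _ => 2 * (n + d + 5)
  | rowSum false _ j => 2 * (n + d + 5) + 1 + j
  | f _ _ => 3 * (n + d + 5)
  | w _ _ => 3 * (n + d + 5) + 1
  | rowSum true _ j => 3 * (n + d + 5) + 2 + j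
  | r _ _ => 4 * (n + d + 5)
  | p _ _ => 4 * (n + d + 5) + 1
  | tMul _ _ _ => 4 * (n + d + 5) + 2
  | tSum _ _ i => 4 * (n + d + 5) + 3 + i
  | gMul _ _ _ => 5 * (n + d + 5)
  | gSum _ _ j => 5 * (n + d + 5) + 1 + j

/-- Running sums climb one level at a time and never leave their band of width `n + d + 5`, so bands
alone order the main stages. -/
theorem level_comb {N B : ℕ} {p : Fin (N + 1) → AttnNode n d} {s : Fin N → AttnNode n d}
    (hp : (p 0).level = B) (hs : ∀ k : Fin N, (s k).level = B + 1 + k) (k : Fin (N + 1)) :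
    (comb p s k).level = B + k := by
  refine Fin.cases ?_ (fun k => ?_) k
  · simpa using hp
  · rw [comb_succ, hs, Fin.val_succ]
    omega

theorem level_projComb (c : Bool) (i : Fin (n + 1)) (l k : Fin (d + 1)) :
    (comb (projMul c i l) (projSum c i l) k : AttnNode n d).level = 1 + k :=
  level_comb rfl (fun k => by simp [level]) k

theorem level_proj (c : Bool) (i : Fin (n + 1)) (l : Fin (d + 1)) :
    (proj c i l : AttnNode n d).level = 1 + d := level_projComb c i l _

theorem level_scoreComb (c : Bool) (i j : Fin (n + 1)) (k : Fin (d + 1)) :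
    (comb (scoreMul c i j) (scoreSum c i j) k : AttnNode n d).level = (n + d + 5) + k :=
  level_comb rfl (fun k => by simp [level]) k

theorem level_score (c : Bool) (i j : Fin (n + 1)) :
    (score c i j : AttnNode n d).level = (n + d + 5) + d := level_scoreComb c i j _

theorem level_rowComb_false (i j : Fin (n + 1)) :
    (comb (rowTerm false i) (rowSum false i) j : AttnNode n d).level = 2 * (n + d + 5) + j :=
  level_comb (B := 2 * (n + d + 5)) rfl (fun k => by simp [level]) j

theorem level_rowComb_true (i j : Fin (n + 1)) :
    (comb (rowTerm true i) (rowSum true i) j : AttnNode n d).level = 3 * (n + d + 5) + 1 + j :=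
  level_comb (B := 3 * (n + d + 5) + 1) rfl (fun k => by simp [level]) j

theorem level_tComb (k : Fin (d + 1)) (j i : Fin (n + 1)) :
    (comb (tMul k j) (tSum k j) i : AttnNode n d).level = 4 * (n + d + 5) + 2 + i :=
  level_comb rfl (fun k => by simp [level]) i

theorem level_gComb (a b : Fin (d + 1)) (j : Fin (n + 1)) :
    (comb (gMul a b) (gSum a b) j : AttnNode n d).level = 5 * (n + d + 5) + j :=
  level_comb rfl (fun k => by simp [level]) j

theorem level_lt {u v : AttnNode n d} (h : u ∈ v.gate.parents) : u.level < v.level := by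
  cases v with
  | a₁ | a₂ | a₃ | dO | x | y => simp [gate, Gate.parents] at h
  | projMul c i l k =>
    cases c <;> simp only [gate, Gate.parents, projLeft, projRight, cond_true, cond_false,
      Finset.mem_insert, Finset.mem_singleton] at h <;> rcases h with rfl | rfl <;> simp [level]
  | projSum c i l k =>
    simp only [gate, Gate.parents, Finset.mem_insert, Finset.mem_singleton] at h
    rcases h with rfl | rfl
    · rw [level_projComb, Fin.val_castSucc]; simp only [level]; omega
    · simp only [level]; omega
  | scoreMul c i j k =>
    cases c <;> simp only [gate, Gate.parents, scoreLeft, scoreRight, cond_true, cond_false,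
      Finset.mem_insert, Finset.mem_singleton] at h <;> rcases h with rfl | rfl
    · rw [level_proj]; simp only [level]; omega
    · simp only [level]; omega
    · simp only [level]; omega
    · rw [level_proj]; simp only [level]; omega
  | scoreSum c i j k =>
    simp only [gate, Gate.parents, Finset.mem_insert, Finset.mem_singleton] at h
    rcases h with rfl | rfl
    · rw [level_scoreComb, Fin.val_castSucc]; simp only [level]; omega
    · simp only [level]; omega
  | exp i j =>
    simp only [gate, Gate.parents, Finset.mem_singleton] at h
    subst h
    rw [level_score]; simp only [level]; omega
  | rowSum c i j =>
    cases c <;> simp only [gate, Gate.parents, Finset.mem_insert, Finset.mem_singleton] at h <;>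
      rcases h with rfl | rfl
    · rw [level_rowComb_false, Fin.val_castSucc]; simp only [level]; omega
    · simp only [level, rowTerm, cond_false]; omega
    · rw [level_rowComb_true, Fin.val_castSucc]; simp only [level]; omega
    · simp only [level, rowTerm, cond_true]; omega
  | f i j =>
    simp only [gate, Gate.parents, Finset.mem_insert, Finset.mem_singleton] at h
    rcases h with rfl | rfl
    · simp only [level]; omega
    · rw [rowTotal, level_rowComb_false]; simp only [level, Fin.val_last]; omega
  | w i j =>
    simp only [gate, Gate.parents, Finset.mem_insert, Finset.mem_singleton] at h
    rcases h with rfl | rfl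
    · simp only [level]; omega
    · rw [level_score]; simp only [level]; omega
  | r i j =>
    simp only [gate, Gate.parents, Finset.mem_insert, Finset.mem_singleton] at h
    rcases h with rfl | rfl
    · rw [rowTotal, level_rowComb_true]; simp only [level, Fin.val_last]; omega
    · simp only [level]; omega
  | p i j =>
    simp only [gate, Gate.parents, Finset.mem_insert, Finset.mem_singleton] at h
    rcases h with rfl | rfl <;> simp only [level] <;> omega
  | tMul k j i =>
    simp only [gate, Gate.parents, Finset.mem_insert, Finset.mem_singleton] at h
    rcases h with rfl | rfl <;> simp only [level] <;> omega
  | tSum k j i =>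
    simp only [gate, Gate.parents, Finset.mem_insert, Finset.mem_singleton] at h
    rcases h with rfl | rfl
    · rw [level_tComb, Fin.val_castSucc]; simp only [level]; omega
    · simp only [level]; omega
  | gMul a b j =>
    simp only [gate, Gate.parents, Finset.mem_insert, Finset.mem_singleton] at h
    rcases h with rfl | rfl
    · rw [t, level_tComb]; simp only [level, Fin.val_last]; omega
    · simp only [level]; omega
  | gSum a b j =>
    simp only [gate, Gate.parents, Finset.mem_insert, Finset.mem_singleton] at h
    rcases h with rfl | rfl
    · rw [level_gComb, Fin.val_castSucc]; simp only [level]; omega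
    · simp only [level]; omega

theorem level_le (v : AttnNode n d) : v.level ≤ 5 * (n + d + 5) + n := by
  cases v with
  | rowSum c i j => cases c <;> simp only [level] <;> omega
  | _ => simp only [level]; omega

/-- Finite sets of nodes that together contain all nodes. -/
def cover (n d : ℕ) : List (Finset (AttnNode n d)) :=
  [Finset.univ.image fun x : Fin (n + 1) × Fin (d + 1) => a₁ x.1 x.2,
   Finset.univ.image fun x : Fin (n + 1) × Fin (d + 1) => a₂ x.1 x.2,
   Finset.univ.image fun x : Fin (n + 1) × Fin (d + 1) => a₃ x.1 x.2,
   Finset.univ.image fun x : Fin (n + 1) × Fin (d + 1) => dO x.1 x.2,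
   Finset.univ.image fun x : Fin (d + 1) × Fin (d + 1) => .x x.1 x.2,
   Finset.univ.image fun x : Fin (d + 1) × Fin (d + 1) => y x.1 x.2,
   Finset.univ.image fun x : Bool × Fin (n + 1) × Fin (d + 1) × Fin (d + 1) =>
     projMul x.1 x.2.1 x.2.2.1 x.2.2.2,
   Finset.univ.image fun x : Bool × Fin (n + 1) × Fin (d + 1) × Fin d =>
     projSum x.1 x.2.1 x.2.2.1 x.2.2.2,
   Finset.univ.image fun x : Bool × Fin (n + 1) × Fin (n + 1) × Fin (d + 1) =>
     scoreMul x.1 x.2.1 x.2.2.1 x.2.2.2,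
   Finset.univ.image fun x : Bool × Fin (n + 1) × Fin (n + 1) × Fin d =>
     scoreSum x.1 x.2.1 x.2.2.1 x.2.2.2,
   Finset.univ.image fun x : Fin (n + 1) × Fin (n + 1) => exp x.1 x.2,
   Finset.univ.image fun x : Bool × Fin (n + 1) × Fin n => rowSum x.1 x.2.1 x.2.2,
   Finset.univ.image fun x : Fin (n + 1) × Fin (n + 1) => f x.1 x.2,
   Finset.univ.image fun x : Fin (n + 1) × Fin (n + 1) => w x.1 x.2,
   Finset.univ.image fun x : Fin (n + 1) × Fin (n + 1) => r x.1 x.2,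
   Finset.univ.image fun x : Fin (n + 1) × Fin (n + 1) => p x.1 x.2,
   Finset.univ.image fun x : Fin (d + 1) × Fin (n + 1) × Fin (n + 1) => tMul x.1 x.2.1 x.2.2,
   Finset.univ.image fun x : Fin (d + 1) × Fin (n + 1) × Fin n => tSum x.1 x.2.1 x.2.2,
   Finset.univ.image fun x : Fin (d + 1) × Fin (d + 1) × Fin (n + 1) => gMul x.1 x.2.1 x.2.2,
   Finset.univ.image fun x : Fin (d + 1) × Fin (d + 1) × Fin n => gSum x.1 x.2.1 x.2.2]

theorem exists_mem_cover (v : AttnNode n d) : ∃ S ∈ cover n d, v ∈ S := by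
  have this {α : Type} [Fintype α] (m : ℕ) (e : α → AttnNode n d) (x : α)
      (hm : (cover n d)[m]? = some (Finset.univ.image e)) : ∃ S ∈ cover n d, e x ∈ S :=
    ⟨_, List.mem_of_getElem? hm, Finset.mem_image_of_mem e (Finset.mem_univ x)⟩
  cases v with
  | a₁ i k => exact this 0 _ (i, k) rfl
  | a₂ i k => exact this 1 _ (i, k) rfl
  | a₃ i k => exact this 2 _ (i, k) rfl
  | dO i k => exact this 3 _ (i, k) rfl
  | x k l => exact this 4 _ (k, l) rfl
  | y k l => exact this 5 _ (k, l) rfl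
  | projMul c i l k => exact this 6 _ (c, i, l, k) rfl
  | projSum c i l k => exact this 7 _ (c, i, l, k) rfl
  | scoreMul c i j k => exact this 8 _ (c, i, j, k) rfl
  | scoreSum c i j k => exact this 9 _ (c, i, j, k) rfl
  | exp i j => exact this 10 _ (i, j) rfl
  | rowSum c i j => exact this 11 _ (c, i, j) rfl
  | f i j => exact this 12 _ (i, j) rfl
  | w i j => exact this 13 _ (i, j) rfl
  | r i j => exact this 14 _ (i, j) rfl
  | p i j => exact this 15 _ (i, j) rfl
  | tMul k j i => exact this 16 _ (k, j, i) rfl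
  | tSum k j i => exact this 17 _ (k, j, i) rfl
  | gMul a b j => exact this 18 _ (a, b, j) rfl
  | gSum a b j => exact this 19 _ (a, b, j) rfl

theorem card_le_of_mem_cover {S : Finset (AttnNode n d)} (hS : S ∈ cover n d) :
    S.card ≤ 2 * ((n + 1) ^ 2 * (d + 1) + (n + 1) * (d + 1) ^ 2) := by
  simp only [cover, List.mem_cons, List.not_mem_nil, or_false] at hS
  rcases hS with rfl | rfl | rfl | rfl | rfl | rfl | rfl | rfl | rfl | rfl | rfl | rfl | rfl |
    rfl | rfl | rfl | rfl | rfl | rfl | rfl <;> refine Finset.card_image_le.trans ?_ <;>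
    simp only [Finset.card_univ, Fintype.card_prod, Fintype.card_fin, Fintype.card_bool] <;>
    nlinarith [Nat.zero_le (n * d), Nat.zero_le (n * n * d), Nat.zero_le (n * d * d)]

instance : Fintype (AttnNode n d) where
  elems := (cover n d).foldr (· ∪ ·) ∅
  complete v := by
    have key : ∀ L : List (Finset (AttnNode n d)), (∃ S ∈ L, v ∈ S) →
        v ∈ L.foldr (· ∪ ·) ∅ := by
      intro L
      induction L with
      | nil => simp
      | cons S L ih =>
        rintro ⟨T, hT, hv⟩
        rw [List.foldr_cons, Finset.mem_union]
        rcases List.mem_cons.1 hT with rfl | hT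
        exacts [.inl hv, .inr (ih ⟨T, hT, hv⟩)]
    exact key _ (exists_mem_cover v)

theorem card_le : Fintype.card (AttnNode n d) ≤
    40 * ((n + 1) ^ 2 * (d + 1) + (n + 1) * (d + 1) ^ 2) := by
  have := card_le_length_mul (cover n d) (fun S v => v ∈ S) _ exists_mem_cover
    (fun S hS => by simpa using card_le_of_mem_cover hS)
  rw [show (cover n d).length = 20 from rfl] at this
  omega

end AttnNode

/-- The computational graph of attention backward. -/
noncomputable def attnCircuit (n d : ℕ) : Circuit (AttnInput (n + 1) (d + 1)) where
  V := AttnNode n d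
  gate := AttnNode.gate
  acyclic := Subrelation.wf (fun h => AttnNode.level_lt h) (measure AttnNode.level).wf

namespace attnCircuit

open AttnNode

variable {n d : ℕ}

/-- The entries of `g` lie on the highest level, so nothing can have them as parents. -/
theorem not_mem_parents_g (a b : Fin (d + 1)) (v : AttnNode n d) : g a b ∉ v.gate.parents := by
  intro h
  have h1 := level_lt h
  have h2 := level_le v
  rw [g, level_gComb] at h1
  simp at h1
  omega

/-- Each running sum except the last, and each term, is used. -/
theorem comb_used {N : ℕ} {p : Fin (N + 1) → AttnNode n d} {s : Fin N → AttnNode n d}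
    (h : ∀ k, (s k).gate = .add (comb p s k.castSucc) (p k.succ)) (v : AttnNode n d)
    (hv : (∃ k, v = p k) ∨ ∃ k, v = s k) :
    v = comb p s (Fin.last N) ∨ ∃ u : AttnNode n d, v ∈ u.gate.parents := by
  have key : ∀ k, comb p s k = comb p s (Fin.last N) ∨
      ∃ u : AttnNode n d, comb p s k ∈ u.gate.parents := by
    intro k
    refine Fin.lastCases (.inl rfl) (fun k => .inr ⟨s k, ?_⟩) k
    simp [h, Gate.parents]
  rcases hv with ⟨k, rfl⟩ | ⟨k, rfl⟩
  · revert k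
    refine Fin.cases (key 0) fun k => .inr ⟨s k, ?_⟩
    simp [h, Gate.parents]
  · exact key k.succ

theorem used_or_eq_g (v : AttnNode n d) :
    (∃ u : AttnNode n d, v ∈ u.gate.parents) ∨ ∃ a b, g a b = v := by
  have viaRoot : ∀ {N : ℕ} {p : Fin (N + 1) → AttnNode n d} {s : Fin N → AttnNode n d},
      (∀ k, (s k).gate = .add (comb p s k.castSucc) (p k.succ)) →
      ((∃ k, v = p k) ∨ ∃ k, v = s k) →
      (∃ u : AttnNode n d, comb p s (Fin.last N) ∈ u.gate.parents) →
      (∃ u : AttnNode n d, v ∈ u.gate.parents) := by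
    intro N p s h hv hu
    rcases comb_used h v hv with rfl | h'
    exacts [hu, h']
  have hproj : ∀ c i l, ∃ u : AttnNode n d, proj c i l ∈ u.gate.parents := by
    intro c i l
    cases c
    · exact ⟨scoreMul false i 0 l, by simp [gate, Gate.parents, scoreLeft]⟩
    · exact ⟨scoreMul true 0 i l, by simp [gate, Gate.parents, scoreRight]⟩
  have hscore : ∀ c i j, ∃ u : AttnNode n d, score c i j ∈ u.gate.parents := by
    intro c i j
    cases c
    · exact ⟨exp i j, by simp [gate, Gate.parents]⟩
    · exact ⟨w i j, by simp [gate, Gate.parents]⟩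
  have hrow : ∀ c i, ∃ u : AttnNode n d, rowTotal c i ∈ u.gate.parents := by
    intro c i
    cases c
    · exact ⟨f i 0, by simp [gate, Gate.parents]⟩
    · exact ⟨r i 0, by simp [gate, Gate.parents]⟩
  cases v with
  | a₁ i k => exact .inl ⟨projMul false i 0 k, by simp [gate, Gate.parents, projLeft]⟩
  | a₂ i k => exact .inl ⟨scoreMul false 0 i k, by simp [gate, Gate.parents, scoreRight]⟩
  | a₃ i k => exact .inl ⟨projMul true i 0 k, by simp [gate, Gate.parents, projLeft]⟩
  | dO i k => exact .inl ⟨scoreMul true i 0 k, by simp [gate, Gate.parents, scoreLeft]⟩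
  | x k l => exact .inl ⟨projMul false 0 l k, by simp [gate, Gate.parents, projRight]⟩
  | y k l => exact .inl ⟨projMul true 0 l k, by simp [gate, Gate.parents, projRight]⟩
  | projMul c i l k => exact .inl (viaRoot (fun _ => rfl) (.inl ⟨k, rfl⟩) (hproj c i l))
  | projSum c i l k => exact .inl (viaRoot (fun _ => rfl) (.inr ⟨k, rfl⟩) (hproj c i l))
  | scoreMul c i j k => exact .inl (viaRoot (fun _ => rfl) (.inl ⟨k, rfl⟩) (hscore c i j))
  | scoreSum c i j k => exact .inl (viaRoot (fun _ => rfl) (.inr ⟨k, rfl⟩) (hscore c i j))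
  | exp i j => exact .inl ⟨f i j, by simp [gate, Gate.parents]⟩
  | rowSum c i j => exact .inl (viaRoot (fun _ => rfl) (.inr ⟨j, rfl⟩) (hrow c i))
  | f i j => exact .inl ⟨w i j, by simp [gate, Gate.parents]⟩
  | w i j => exact .inl ⟨p i j, by simp [gate, Gate.parents]⟩
  | r i j => exact .inl ⟨p i j, by simp [gate, Gate.parents]⟩
  | p i j => exact .inl ⟨tMul 0 j i, by simp [gate, Gate.parents]⟩
  | tMul k j i => exact .inl (viaRoot (s := tSum k j) (fun _ => rfl) (.inl ⟨i, rfl⟩)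
      ⟨gMul k 0 j, by simp [gate, Gate.parents, t]⟩)
  | tSum k j i => exact .inl (viaRoot (p := tMul k j) (fun _ => rfl) (.inr ⟨i, rfl⟩)
      ⟨gMul k 0 j, by simp [gate, Gate.parents, t]⟩)
  | gMul a b j =>
    rcases comb_used (p := gMul a b) (s := gSum a b) (fun _ => rfl) _ (.inl ⟨j, rfl⟩) with h | h
    · exact .inr ⟨a, b, h.symm⟩
    · exact .inl h
  | gSum a b j =>
    rcases comb_used (p := gMul a b) (s := gSum a b) (fun _ => rfl) _ (.inr ⟨j, rfl⟩) with h | h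
    · exact .inr ⟨a, b, h.symm⟩
    · exact .inl h

theorem isOutput_iff (v : AttnNode n d) :
    (attnCircuit n d).dag.IsOutput v ↔ ∃ a b, g a b = v := by
  constructor
  · intro h
    rcases used_or_eq_g v with ⟨u, hu⟩ | h'
    · exact absurd hu (h u)
    · exact h'
  · rintro ⟨a, b, rfl⟩ u
    exact not_mem_parents_g a b u

/-- The layout of the graph. -/
noncomputable def layout (n d : ℕ) : (attnCircuit n d).StdLayout where
  a₁ := AttnNode.a₁
  a₂ := AttnNode.a₂
  a₃ := AttnNode.a₃
  dO := AttnNode.dO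
  x := AttnNode.x
  y := AttnNode.y
  S := proj false
  Z := score false
  E := AttnNode.exp
  l := rowTotal false
  f := AttnNode.f
  h := proj true
  q := score true
  w := AttnNode.w
  v := rowTotal true
  r := AttnNode.r
  p := AttnNode.p
  T := t
  g := g
  a₁_eq _ _ := rfl
  a₂_eq _ _ := rfl
  a₃_eq _ _ := rfl
  dO_eq _ _ := rfl
  x_eq _ _ := rfl
  y_eq _ _ := rfl
  no_l u i := by cases u <;> simp [attnCircuit, gate]
  no_O u i k := by cases u <;> simp [attnCircuit, gate]
  S_eq i l := ⟨projMul false i l, fun _ => .inl rfl, Circuit.isSum_comb fun _ => rfl⟩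
  Z_eq i j := ⟨scoreMul false i j, fun _ => .inl rfl, Circuit.isSum_comb fun _ => rfl⟩
  E_eq _ _ := rfl
  l_eq i := Circuit.isSum_comb (G := attnCircuit n d) (p := rowTerm false i)
    (s := AttnNode.rowSum false i) fun _ => rfl
  f_eq _ _ := rfl
  h_eq i l := ⟨projMul true i l, fun _ => .inl rfl, Circuit.isSum_comb fun _ => rfl⟩
  q_eq i j := ⟨scoreMul true i j, fun _ => .inl rfl, Circuit.isSum_comb fun _ => rfl⟩
  w_eq _ _ := .inl rfl
  v_eq i := Circuit.isSum_comb (G := attnCircuit n d) (p := rowTerm true i)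
    (s := AttnNode.rowSum true i) fun _ => rfl
  r_eq _ _ := .inl rfl
  p_eq _ _ := rfl
  T_eq k j := ⟨tMul k j, fun _ => .inl rfl, Circuit.isSum_comb fun _ => rfl⟩
  g_eq a b := ⟨gMul a b, fun _ => .inl rfl, Circuit.isSum_comb fun _ => rfl⟩
  out := isOutput_iff

end attnCircuit

/-! ### Pebbling the computational graph -/

namespace Dag

variable {G : Dag} {M : ℕ}

theorem Makes.exists_reach {Mem X : Finset G.V} {κ q : ℕ} (h : G.Makes M Mem X κ)
    (hr : G.Reach M ∅ Mem q) :
    ∃ Mem', Mem ⊆ Mem' ∧ X ⊆ Mem' ∧ G.Reach M ∅ Mem' (q + κ) :=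
  ⟨_, Finset.subset_union_left, Finset.subset_union_right, h subset_rfl hr⟩

/-- Computing one running sum for each row, one after the other. -/
theorem Makes.rowCombs {a N : ℕ} {p : Fin a → Fin (N + 1) → G.V} {σ : Fin a → Fin N → G.V}
    (hc : ∀ i, G.IsComb (p i) (σ i)) {Mem : Finset G.V} (R : Fin a → Finset G.V)
    (L : Fin a → Fin (N + 1) → Finset G.V) {r ℓ w : ℕ} (hR : ∀ i, R i ⊆ Mem)
    (hL : ∀ i k, L i k ⊆ Mem) (hr : ∀ i, (R i).card ≤ r) (hℓ : ∀ i k, (L i k).card ≤ ℓ)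
    (hw : 2 ≤ w) (hp : ∀ i k, G.Obtains M (R i ∪ L i k) (p i k) w) (hM : r + ℓ + w + 3 ≤ M) :
    G.Makes M Mem (Finset.univ.image fun i => comb (p i) (σ i) (Fin.last N))
      (a * (2 * r + (N + 1) * (2 * ℓ) + 1)) := by
  have h : ∀ i, G.Makes M Mem {comb (p i) (σ i) (Fin.last N)}
      (2 * r + (N + 1) * (2 * ℓ) + 1) := fun i =>
    (Makes.combs (t := 1) ({()} : Finset Unit) (p := fun _ => p i) (s := fun _ => σ i)
      (fun _ => hc i) (hR i) (hL i) (hr i) (hℓ i) (by simp) hw (fun k _ _ => hp i k)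
      (by omega)).mono subset_rfl (by simp) le_rfl
  refine (Makes.biUnion Finset.univ _ fun i _ => h i).mono subset_rfl ?_ (by simp)
  intro y hy
  simpa [eq_comm] using hy

end Dag

/-- The nodes `ν` of `G` have the parents prescribed by the computational graph of attention
backward, and all outputs of `G` are outputs of that computational graph. -/
structure IsAttnDag {n d : ℕ} (G : Dag) (ν : AttnNode n d → G.V) : Prop where
  parents : ∀ v, G.parents (ν v) = v.gate.parents.image ν
  output : ∀ v, G.IsOutput v → ∃ a b, ν (AttnNode.g a b) = v

theorem comb_map {V W : Type} {N : ℕ} (ν : V → W) (p : Fin (N + 1) → V) (s : Fin N → V)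
    (k : Fin (N + 1)) : comb (fun k => ν (p k)) (fun k => ν (s k)) k = ν (comb p s k) :=
  Fin.cases rfl (fun _ => rfl) k

namespace IsAttnDag

open AttnNode Dag

variable {n d M : ℕ} {G : Dag} {ν : AttnNode n d → G.V}

theorem isInput (hν : IsAttnDag G ν) {v : AttnNode n d} (h : v.gate.parents = ∅) :
    G.IsInput (ν v) := by
  rw [Dag.IsInput, hν.parents, h, Finset.image_empty]

theorem not_isInput (hν : IsAttnDag G ν) {u v : AttnNode n d} (h : u ∈ v.gate.parents) :
    ¬ G.IsInput (ν v) := by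
  intro hv
  rw [Dag.IsInput, hν.parents, Finset.image_eq_empty] at hv
  rw [hv] at h
  exact Finset.notMem_empty _ h

theorem parents_pair (hν : IsAttnDag G ν) {v u w : AttnNode n d} (h : v.gate.parents = {u, w}) :
    ¬ G.IsInput (ν v) ∧ G.parents (ν v) ⊆ {ν u, ν w} := by
  refine ⟨hν.not_isInput (u := u) (by simp [h]), ?_⟩
  rw [hν.parents, h, Finset.image_insert, Finset.image_singleton]

theorem isComb (hν : IsAttnDag G ν) {N : ℕ}
    {p : Fin (N + 1) → AttnNode n d} {s : Fin N → AttnNode n d}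
    (h : ∀ k, (s k).gate = .add (comb p s k.castSucc) (p k.succ)) :
    G.IsComb (fun k => ν (p k)) (fun k => ν (s k)) := fun k => by
  rw [comb_map]
  exact hν.parents_pair (by rw [h]; rfl)

theorem obtains_pair (hν : IsAttnDag G ν) {R : Finset G.V} {v u₁ u₂ : AttnNode n d} {a b w : ℕ}
    (hp : v.gate.parents = {u₁, u₂}) (h₁ : G.Obtains M R (ν u₁) a)
    (h₂ : G.Obtains M R (ν u₂) b) (ha : a ≤ w) (hb : b + 1 ≤ w) (hw : 3 ≤ w) :
    G.Obtains M R (ν v) w :=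
  .of_parents (hν.parents_pair hp).1 (hν.parents_pair hp).2 h₁ h₂ ha hb hw

/-- Once two rows of length `d + 1` are in the cache, an entry of `Z` or `q` takes constant extra
room. This is why the fused schedule need not store the `n × n` matrices. -/
theorem obtains_score (hν : IsAttnDag G ν) {c : Bool} {i j : Fin (n + 1)} {R : Finset G.V}
    (hl : ∀ k, ν (scoreLeft c i k) ∈ R) (hr : ∀ k, ν (scoreRight c j k) ∈ R) :
    G.Obtains M R (ν (score c i j)) 4 := by
  have h := (hν.isComb (p := scoreMul c i j) (s := scoreSum c i j) fun _ => rfl).obtains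
    (M := M) (w := 3) (by omega) (fun k => hν.obtains_pair (a := 0) (b := 0)
      (u₁ := scoreLeft c i k) (u₂ := scoreRight c j k) rfl (.of_mem (hl k)) (.of_mem (hr k))
      (by omega) (by omega) le_rfl) (Fin.last d)
  rwa [comb_map] at h

section Obtains

variable {i j : Fin (n + 1)} {R : Finset G.V}

theorem obtains_exp (hν : IsAttnDag G ν) (hZ : G.Obtains M R (ν (score false i j)) 4) :
    G.Obtains M R (ν (exp i j)) 4 := by
  refine .of_parent (hν.not_isInput (u := score false i j) (by simp [gate, Gate.parents])) ?_
    hZ le_rfl (by omega)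
  rw [hν.parents]
  simp [gate, Gate.parents]

theorem obtains_f (hν : IsAttnDag G ν) (hZ : G.Obtains M R (ν (score false i j)) 4)
    (hl : ν (rowTotal false i) ∈ R) : G.Obtains M R (ν (f i j)) 4 :=
  hν.obtains_pair (u₁ := exp i j) (u₂ := rowTotal false i) (b := 0) rfl (hν.obtains_exp hZ)
    (.of_mem hl) le_rfl (by omega) (by omega)

theorem obtains_w (hν : IsAttnDag G ν) (hZ : G.Obtains M R (ν (score false i j)) 4)
    (hq : G.Obtains M R (ν (score true i j)) 4) (hl : ν (rowTotal false i) ∈ R) :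
    G.Obtains M R (ν (w i j)) 5 :=
  hν.obtains_pair (u₁ := f i j) (u₂ := score true i j) rfl (hν.obtains_f hZ hl) hq (by omega)
    le_rfl (by omega)

/-- The room is `6` because `w` is held while `r` is obtained with room `5`. -/
theorem obtains_p (hν : IsAttnDag G ν) (hZ : G.Obtains M R (ν (score false i j)) 4)
    (hq : G.Obtains M R (ν (score true i j)) 4) (hl : ν (rowTotal false i) ∈ R)
    (hv : ν (rowTotal true i) ∈ R) : G.Obtains M R (ν (p i j)) 6 :=
  hν.obtains_pair (u₁ := w i j) (u₂ := r i j) (a := 5) (b := 5) rfl (hν.obtains_w hZ hq hl)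
    (hν.obtains_pair (u₁ := rowTotal true i) (u₂ := f i j) (a := 0) rfl (.of_mem hv)
      (hν.obtains_f hZ hl) (by omega) le_rfl (by omega))
    (by omega) le_rfl (by omega)

end Obtains

/-! ### The passes and their costs -/

/-- The entries of the six matrices are in the set. -/
structure HasInputs (ν : AttnNode n d → G.V) (Mem : Finset G.V) : Prop where
  a₁ : ∀ i k, ν (AttnNode.a₁ i k) ∈ Mem
  a₂ : ∀ i k, ν (AttnNode.a₂ i k) ∈ Mem
  a₃ : ∀ i k, ν (AttnNode.a₃ i k) ∈ Mem
  dO : ∀ i k, ν (AttnNode.dO i k) ∈ Mem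
  x : ∀ k l, ν (AttnNode.x k l) ∈ Mem
  y : ∀ k l, ν (AttnNode.y k l) ∈ Mem

theorem hasInputs_start (hν : IsAttnDag G ν) :
    HasInputs ν (Finset.univ.filter fun v => G.IsInput v) := by
  constructor <;> intros <;>
    exact Finset.mem_filter.2 ⟨Finset.mem_univ _, hν.isInput rfl⟩

theorem HasInputs.mono {Mem Mem' : Finset G.V} (h : HasInputs ν Mem)
    (hM : Mem ⊆ Mem') : HasInputs ν Mem' :=
  ⟨fun i k => hM (h.a₁ i k), fun i k => hM (h.a₂ i k), fun i k => hM (h.a₃ i k),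
    fun i k => hM (h.dO i k), fun i k => hM (h.x i k), fun i k => hM (h.y i k)⟩

section Passes

variable {Mem : Finset G.V} {s : ℕ}

theorem makes_proj (hν : IsAttnDag G ν) (hs : 0 < s) (hM : 2 * s + 2 * (s * s) + 4 ≤ M)
    (h : HasInputs ν Mem) (c : Bool) : G.Makes M Mem
      (Finset.univ.image fun x : Fin (n + 1) × Fin (d + 1) => ν (proj c x.1 x.2))
      (tiledCost (n + 1) (d + 1) (d + 1) s) := by
  have h := Makes.matMul hs hM (P := fun i k => ν (projLeft c i k))
    (Q := fun k l => ν (projRight c k l)) (p := fun i l k => ν (projMul c i l k))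
    (σ := fun i l k => ν (projSum c i l k)) (fun i l => hν.isComb fun _ => rfl)
    (fun i l k => hν.parents_pair rfl) (Mem := Mem)
    (fun i k => by
      cases c
      exacts [h.a₁ i k, h.a₃ i k])
    (fun k l => by
      cases c
      exacts [h.x k l, h.y k l])
  simp only [comb_map] at h
  exact h

theorem makes_score (hν : IsAttnDag G ν) (hs : 0 < s) (hM : 2 * s + 2 * (s * s) + 4 ≤ M)
    {c : Bool} (hl : ∀ i k, ν (scoreLeft c i k) ∈ Mem) (hr : ∀ j k, ν (scoreRight c j k) ∈ Mem) :
    G.Makes M Mem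
      (Finset.univ.image fun x : Fin (n + 1) × Fin (n + 1) => ν (score c x.1 x.2))
      (tiledCost (n + 1) (d + 1) (n + 1) s) := by
  have h := Makes.matMul hs hM (P := fun i k => ν (scoreLeft c i k))
    (Q := fun k j => ν (scoreRight c j k)) (p := fun i j k => ν (scoreMul c i j k))
    (σ := fun i j k => ν (scoreSum c i j k)) (fun i l => hν.isComb fun _ => rfl)
    (fun i l k => hν.parents_pair rfl) (Mem := Mem) hl fun k j => hr j k
  simp only [comb_map] at h
  exact h

theorem makes_t (hν : IsAttnDag G ν) (hs : 0 < s) (hM : 2 * s + 2 * (s * s) + 4 ≤ M)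
    (h : HasInputs ν Mem) (hp : ∀ i j, ν (p i j) ∈ Mem) : G.Makes M Mem
      (Finset.univ.image fun x : Fin (d + 1) × Fin (n + 1) => ν (t x.1 x.2))
      (tiledCost (d + 1) (n + 1) (n + 1) s) := by
  have h := Makes.matMul hs hM (P := fun k i => ν (a₁ i k))
    (Q := fun i j => ν (p i j)) (p := fun k j i => ν (tMul k j i))
    (σ := fun k j i => ν (tSum k j i)) (fun i l => hν.isComb fun _ => rfl)
    (fun i l k => hν.parents_pair rfl) (Mem := Mem) (fun k i => h.a₁ i k) hp
  simp only [comb_map] at h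
  exact h

theorem makes_g (hν : IsAttnDag G ν) (hs : 0 < s) (hM : 2 * s + 2 * (s * s) + 4 ≤ M)
    (h : HasInputs ν Mem) (ht : ∀ k j, ν (t k j) ∈ Mem) : G.Makes M Mem
      (Finset.univ.image fun x : Fin (d + 1) × Fin (d + 1) => ν (g x.1 x.2))
      (tiledCost (d + 1) (n + 1) (d + 1) s) := by
  have h := Makes.matMul hs hM (P := fun k j => ν (t k j))
    (Q := fun j b => ν (a₂ j b)) (p := fun a b j => ν (gMul a b j))
    (σ := fun a b j => ν (gSum a b j)) (fun i l => hν.isComb fun _ => rfl)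
    (fun i l k => hν.parents_pair rfl) (Mem := Mem) ht h.a₂
  simp only [comb_map] at h
  exact h

/-- The passes for `l`, `v` and `p` from stored scores recompute exponentials, and `f`, `w`, `r`
where needed, from a bounded number of loaded nodes; these intermediates are never written. -/
theorem makes_l_of_score (hν : IsAttnDag G ν) (hM : 8 ≤ M)
    (hZ : ∀ i j, ν (score false i j) ∈ Mem) :
    G.Makes M Mem (Finset.univ.image fun i => ν (rowTotal false i))
      ((n + 1) * (2 * 0 + (n + 1) * (2 * 1) + 1)) := by
  have h := Makes.rowCombs (M := M) (w := 4) (p := fun i j => ν (rowTerm false i j))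
    (σ := fun i j => ν (rowSum false i j)) (fun i => hν.isComb fun _ => rfl) (Mem := Mem)
    (fun _ => ∅) (fun i j => {ν (score false i j)}) (by simp) (by simpa using hZ) (r := 0)
    (by simp) (ℓ := 1) (by simp) (by omega)
    (fun i j => hν.obtains_exp (.of_mem (by simp))) (by omega)
  simp only [comb_map] at h
  exact h

theorem makes_v_of_score (hν : IsAttnDag G ν) (hM : 11 ≤ M)
    (hZ : ∀ c i j, ν (score c i j) ∈ Mem) (hl : ∀ i, ν (rowTotal false i) ∈ Mem) :
    G.Makes M Mem (Finset.univ.image fun i => ν (rowTotal true i))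
      ((n + 1) * (2 * 1 + (n + 1) * (2 * 2) + 1)) := by
  have h := Makes.rowCombs (M := M) (w := 5) (p := fun i j => ν (rowTerm true i j))
    (σ := fun i j => ν (rowSum true i j)) (fun i => hν.isComb fun _ => rfl) (Mem := Mem)
    (fun i => {ν (rowTotal false i)})
    (fun i j => {ν (score false i j), ν (score true i j)}) (by simpa using hl)
    (by
      intro i j v hv
      simp only [Finset.mem_insert, Finset.mem_singleton] at hv
      rcases hv with rfl | rfl <;> apply hZ)
    (r := 1) (by simp) (ℓ := 2) (fun _ _ => Finset.card_le_two) (by omega)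
    (fun i j => hν.obtains_w (.of_mem (by simp)) (.of_mem (by simp)) (by simp)) (by omega)
  simp only [comb_map] at h
  exact h

theorem makes_p_of_score (hν : IsAttnDag G ν) (hM : 10 ≤ M)
    (hZ : ∀ c i j, ν (score c i j) ∈ Mem) (hl : ∀ c i, ν (rowTotal c i) ∈ Mem) :
    G.Makes M Mem
      (Finset.univ.image fun x : Fin (n + 1) × Fin (n + 1) => ν (p x.1 x.2))
      (Fintype.card (Fin (n + 1) × Fin (n + 1)) * (2 * 4 + 1)) :=
  Makes.each (w := 6) _ (fun x => {ν (score false x.1 x.2), ν (score true x.1 x.2),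
    ν (rowTotal false x.1), ν (rowTotal true x.1)})
    (by
      intro x v hv
      simp only [Finset.mem_insert, Finset.mem_singleton] at hv
      rcases hv with rfl | rfl | rfl | rfl
      exacts [hZ _ _ _, hZ _ _ _, hl _ _, hl _ _])
    (fun _ => Finset.card_le_four)
    (fun x => hν.obtains_p (.of_mem (by simp)) (.of_mem (by simp)) (by simp) (by simp))
    (by omega)

/-- The nodes in a row. -/
def row (F : Fin (d + 1) → G.V) : Finset G.V := Finset.univ.image F

theorem card_row_le (F : Fin (d + 1) → G.V) : (row F).card ≤ d + 1 :=
  Finset.card_image_le.trans (by simp)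

theorem mem_row (F : Fin (d + 1) → G.V) (k : Fin (d + 1)) : F k ∈ row F :=
  Finset.mem_image_of_mem _ (Finset.mem_univ k)

theorem row_subset {F : Fin (d + 1) → G.V} (hF : ∀ k, F k ∈ Mem) : row F ⊆ Mem := by
  simpa [row, Finset.image_subset_iff] using hF

/-- The rows of `S` for a block of `B` indices stay in the cache while all rows of `A₂` pass
through. -/
theorem makes_l (hν : IsAttnDag G ν) {B : ℕ} (hB : 0 < B)
    (hM : B * (d + 1) + (d + 1) + 2 * (B * 1) + 4 + 1 ≤ M)
    (hl : ∀ i k, ν (scoreLeft false i k) ∈ Mem) (hr : ∀ j k, ν (scoreRight false j k) ∈ Mem) :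
    G.Makes M Mem (Finset.univ.image fun i => ν (rowTotal false i))
      (((n + 1) / B + 1) *
        (2 * (B * (d + 1)) + (n + 1) * (2 * (d + 1)) + B * 1)) := by
  have h := Makes.blockCombs (w := 4) hB ({()} : Finset Unit)
    (p := fun i _ j => ν (rowTerm false i j)) (σ := fun i _ j => ν (rowSum false i j))
    (fun i _ => hν.isComb fun _ => rfl)
    (fun i => row fun k => ν (scoreLeft false i k))
    (fun j => row fun k => ν (scoreRight false j k)) (fun i => row_subset (hl i))
    (fun j => row_subset (hr j)) (fun i => card_row_le _)
    (fun j => card_row_le _) (t := 1) (by simp) (by omega) (fun i j _ _ =>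
      hν.obtains_exp (hν.obtains_score (fun k => Finset.mem_union_left _ (mem_row _ k))
        fun k => Finset.mem_union_right _ (mem_row _ k))) hM
  simp only [comb_map] at h
  refine h.mono subset_rfl ?_ le_rfl
  intro y hy
  obtain ⟨i, -, rfl⟩ := Finset.mem_image.1 hy
  exact Finset.mem_image.2 ⟨(i, ()), by simp, rfl⟩

theorem makes_v (hν : IsAttnDag G ν) {B : ℕ} (hB : 0 < B)
    (hM : B * ((d + 1) + (d + 1) + 1) + ((d + 1) + (d + 1)) + 2 * (B * 1) + 5 + 1 ≤ M)
    (hl : ∀ c i k, ν (scoreLeft c i k) ∈ Mem) (hr : ∀ c j k, ν (scoreRight c j k) ∈ Mem)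
    (hL : ∀ i, ν (rowTotal false i) ∈ Mem) :
    G.Makes M Mem (Finset.univ.image fun i => ν (rowTotal true i))
      (((n + 1) / B + 1) * (2 * (B * ((d + 1) + (d + 1) + 1)) +
        (n + 1) * (2 * ((d + 1) + (d + 1))) + B * 1)) := by
  have h := Makes.blockCombs (w := 5) hB ({()} : Finset Unit)
    (p := fun i _ j => ν (rowTerm true i j)) (σ := fun i _ j => ν (rowSum true i j))
    (fun i _ => hν.isComb fun _ => rfl)
    (fun i => ((row fun k => ν (scoreLeft false i k)) ∪ (row fun k => ν (scoreLeft true i k))) ∪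
      {ν (rowTotal false i)})
    (fun j => (row fun k => ν (scoreRight false j k)) ∪ (row fun k => ν (scoreRight true j k)))
    (fun i => Finset.union_subset (Finset.union_subset (row_subset (hl _ i))
      (row_subset (hl _ i))) (by simpa using hL i))
    (fun j => Finset.union_subset (row_subset (hr _ j)) (row_subset (hr _ j)))
    (fun i => (Finset.card_union_le _ _).trans (add_le_add ((Finset.card_union_le _ _).trans
      (add_le_add (card_row_le _) (card_row_le _))) (Finset.card_singleton _).le))
    (fun j => (Finset.card_union_le _ _).trans
      (add_le_add (card_row_le _) (card_row_le _)))
    (t := 1) (by simp) (by omega) (by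
      intro i j _ _
      have h₁ := mem_row fun k => ν (scoreLeft false i k)
      have h₂ := mem_row fun k => ν (scoreRight false j k)
      have h₃ := mem_row fun k => ν (scoreLeft true i k)
      have h₄ := mem_row fun k => ν (scoreRight true j k)
      refine hν.obtains_w (hν.obtains_score (fun k => ?_) fun k => ?_)
        (hν.obtains_score (fun k => ?_) fun k => ?_) ?_ <;> simp [h₁, h₂, h₃, h₄]) hM
  simp only [comb_map] at h
  refine h.mono subset_rfl ?_ le_rfl
  intro y hy
  obtain ⟨i, -, rfl⟩ := Finset.mem_image.1 hy
  exact Finset.mem_image.2 ⟨(i, ()), by simp, rfl⟩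

/-- Since `T` sums over `i`, the roles are exchanged: `B` column indices `j` stay with their rows of
`A₂` and `h` and their `B * (d + 1)` running sums, while the data of row `i` passes through. Room
`7` is that for `p` plus the held entry of `A₁`. -/
theorem makes_t_blocks (hν : IsAttnDag G ν) {B : ℕ} (hB : 0 < B)
    (hM : B * ((d + 1) + (d + 1)) + ((d + 1) + (d + 1) + (d + 1) + 2) + 2 * (B * (d + 1)) + 7 + 1
      ≤ M)
    (h : HasInputs ν Mem) (hl : ∀ c i k, ν (scoreLeft c i k) ∈ Mem)
    (hr : ∀ c j k, ν (scoreRight c j k) ∈ Mem) (hL : ∀ c i, ν (rowTotal c i) ∈ Mem) :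
    G.Makes M Mem
      (Finset.univ.image fun x : Fin (d + 1) × Fin (n + 1) => ν (t x.1 x.2))
      (((n + 1) / B + 1) * (2 * (B * ((d + 1) + (d + 1))) +
        (n + 1) * (2 * ((d + 1) + (d + 1) + (d + 1) + 2)) + B * (d + 1))) := by
  have h := Makes.blockCombs (w := 7) hB (Finset.univ : Finset (Fin (d + 1)))
    (p := fun j k i => ν (tMul k j i)) (σ := fun j k i => ν (tSum k j i))
    (fun j k => hν.isComb fun _ => rfl)
    (fun j => (row fun k => ν (scoreRight false j k)) ∪ (row fun k => ν (scoreRight true j k)))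
    (fun i => ((row fun k => ν (scoreLeft false i k)) ∪ (row fun k => ν (scoreLeft true i k)) ∪
      (row fun k => ν (a₁ i k))) ∪ {ν (rowTotal false i), ν (rowTotal true i)})
    (fun j => Finset.union_subset (row_subset (hr _ j)) (row_subset (hr _ j)))
    (fun i => Finset.union_subset (Finset.union_subset (Finset.union_subset
      (row_subset (hl _ i)) (row_subset (hl _ i))) (row_subset (h.a₁ i)))
      (by
        intro v hv
        simp only [Finset.mem_insert, Finset.mem_singleton] at hv
        rcases hv with rfl | rfl <;> apply hL))
    (fun j => (Finset.card_union_le _ _).trans (add_le_add (card_row_le _) (card_row_le _)))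
    (fun i => (Finset.card_union_le _ _).trans (add_le_add ((Finset.card_union_le _ _).trans
      (add_le_add ((Finset.card_union_le _ _).trans
      (add_le_add (card_row_le _) (card_row_le _))) (card_row_le _))) Finset.card_le_two))
    (t := d + 1) (by simp) (by omega) (by
      intro j i k _
      have h₁ := mem_row fun k => ν (scoreLeft false i k)
      have h₂ := mem_row fun k => ν (scoreRight false j k)
      have h₃ := mem_row fun k => ν (scoreLeft true i k)
      have h₄ := mem_row fun k => ν (scoreRight true j k)
      have h₅ := mem_row fun k => ν (a₁ i k)
      refine hν.obtains_pair (u₁ := a₁ i k) (u₂ := p i j) (a := 0) rfl (.of_mem ?_)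
        (hν.obtains_p (hν.obtains_score (fun k => ?_) fun k => ?_)
          (hν.obtains_score (fun k => ?_) fun k => ?_) ?_ ?_) (by omega) le_rfl (by omega) <;>
        simp [h₁, h₂, h₃, h₄, h₅]) hM
  simp only [comb_map] at h
  refine h.mono subset_rfl ?_ le_rfl
  intro y hy
  obtain ⟨⟨k, j⟩, -, rfl⟩ := Finset.mem_image.1 hy
  exact Finset.mem_image.2 ⟨(j, k), by simp, rfl⟩

end Passes

theorem mem_of_image_subset {V α : Type} [DecidableEq V] [Fintype α] {F : α → V}
    {Mem : Finset V} (h : Finset.univ.image F ⊆ Mem) (x : α) : F x ∈ Mem :=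
  h (Finset.mem_image_of_mem _ (Finset.mem_univ x))

/-- The matrices `S` and `h` come first. -/
theorem exists_reach_proj (hν : IsAttnDag G ν) {s : ℕ} (hs : 0 < s)
    (hM : 2 * s + 2 * (s * s) + 4 ≤ M) :
    ∃ Mem : Finset G.V, HasInputs ν Mem ∧ (∀ c i k, ν (scoreLeft c i k) ∈ Mem) ∧
      (∀ c j k, ν (scoreRight c j k) ∈ Mem) ∧
      G.Reach M ∅ Mem (2 * tiledCost (n + 1) (d + 1) (d + 1) s) := by
  have i0 := hν.hasInputs_start
  obtain ⟨m1, s1, x1, r1⟩ := (hν.makes_proj hs hM i0 false).exists_reach (Reach.start _ M)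
  obtain ⟨m2, s2, x2, r2⟩ := (hν.makes_proj hs hM (i0.mono s1) true).exists_reach r1
  have i2 := (i0.mono s1).mono s2
  refine ⟨m2, i2, fun c i k => ?_, fun c j k => ?_, r2.mono subset_rfl (by omega)⟩
  · cases c
    exacts [s2 (mem_of_image_subset x1 (i, k)), i2.dO i k]
  · cases c
    exacts [i2.a₂ j k, mem_of_image_subset x2 (j, k)]

/-- The product `g = T A₂` comes last. -/
theorem ioComplexity_le_of_t (hν : IsAttnDag G ν) {s q : ℕ} (hs : 0 < s)
    (hM : 2 * s + 2 * (s * s) + 4 ≤ M) {Mem : Finset G.V} (h : HasInputs ν Mem)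
    (ht : ∀ k j, ν (t k j) ∈ Mem) (hr : G.Reach M ∅ Mem q) :
    G.ioComplexity M ≤ (q + tiledCost (d + 1) (n + 1) (d + 1) s : ℕ) := by
  obtain ⟨m, -, x, r⟩ := (hν.makes_g hs hM h ht).exists_reach hr
  refine r.ioComplexity_le fun v hv => ?_
  obtain ⟨a, b, rfl⟩ := hν.output v hv
  exact mem_of_image_subset x (a, b)

/-- The I/O complexity when all matrices are written to memory. -/
theorem ioComplexity_le_tiled (hν : IsAttnDag G ν) {s : ℕ} (hs : 0 < s)
    (hM : 2 * s + 2 * (s * s) + 4 ≤ M) (hM' : 11 ≤ M) : G.ioComplexity M ≤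
      (2 * tiledCost (n + 1) (d + 1) (d + 1) s + 2 * tiledCost (n + 1) (d + 1) (n + 1) s +
        20 * (n + 1) ^ 2 + tiledCost (d + 1) (n + 1) (n + 1) s +
        tiledCost (d + 1) (n + 1) (d + 1) s : ℕ) := by
  obtain ⟨m0, i0, l0, r0, h0⟩ := hν.exists_reach_proj hs hM
  obtain ⟨m1, s1, x1, h1⟩ := (hν.makes_score hs hM (l0 false) (r0 false)).exists_reach h0
  obtain ⟨m2, s2, x2, h2⟩ := (hν.makes_score hs hM (fun i k => s1 (l0 true i k))
    (fun j k => s1 (r0 true j k))).exists_reach h1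
  have z2 : ∀ c i j, ν (score c i j) ∈ m2 := fun c i j => by
    cases c
    exacts [s2 (mem_of_image_subset x1 (i, j)), mem_of_image_subset x2 (i, j)]
  obtain ⟨m3, s3, x3, h3⟩ := (hν.makes_l_of_score (by omega) (z2 false)).exists_reach h2
  obtain ⟨m4, s4, x4, h4⟩ := (hν.makes_v_of_score (by omega) (fun c i j => s3 (z2 c i j))
    (mem_of_image_subset x3)).exists_reach h3
  obtain ⟨m5, s5, x5, h5⟩ := (hν.makes_p_of_score (by omega) (fun c i j => s4 (s3 (z2 c i j)))
    (fun c i => by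
      cases c
      exacts [s4 (mem_of_image_subset x3 i), mem_of_image_subset x4 i])).exists_reach h4
  have i5 := ((((i0.mono s1).mono s2).mono s3).mono s4).mono s5
  obtain ⟨m6, s6, x6, h6⟩ := (hν.makes_t hs hM i5
    (fun i j => mem_of_image_subset x5 (i, j))).exists_reach h5
  refine (hν.ioComplexity_le_of_t hs hM (i5.mono s6)
    (fun k j => mem_of_image_subset x6 (k, j)) h6).trans ?_
  rw [Nat.cast_le]
  simp only [Fintype.card_prod, Fintype.card_fin]
  -- The passes for `l`, `v`, `p` cost `15 N² + 4 N ≤ 20 N²` with `N = n + 1`.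
  nlinarith

/-- The I/O complexity when the matrices with `(n + 1)²` entries are recomputed. -/
theorem ioComplexity_le_fused (hν : IsAttnDag G ν) {s B : ℕ} (hs : 0 < s)
    (hM : 2 * s + 2 * (s * s) + 4 ≤ M) (hB : 0 < B)
    (hM' : 7 * (B * (d + 1)) + 5 * (d + 1) + 8 ≤ M) (hBn : B ≤ n + 1) :
    G.ioComplexity M ≤
      (2 * tiledCost (n + 1) (d + 1) (d + 1) s +
        ((n + 1) / B + 1) * (40 * ((n + 1) * (d + 1))) +
        tiledCost (d + 1) (n + 1) (d + 1) s : ℕ) := by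
  have hBD : B ≤ B * (d + 1) := Nat.le_mul_of_pos_right B (by omega)
  obtain ⟨m0, i0, l0, r0, h0⟩ := hν.exists_reach_proj hs hM
  obtain ⟨m1, s1, x1, h1⟩ := (hν.makes_l hB (by omega) (l0 false) (r0 false)).exists_reach h0
  obtain ⟨m2, s2, x2, h2⟩ := (hν.makes_v hB (by nlinarith) (fun c i k => s1 (l0 c i k))
    (fun c j k => s1 (r0 c j k)) (mem_of_image_subset x1)).exists_reach h1
  obtain ⟨m3, s3, x3, h3⟩ := (hν.makes_t_blocks hB (by nlinarith) ((i0.mono s1).mono s2)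
    (fun c i k => s2 (s1 (l0 c i k))) (fun c j k => s2 (s1 (r0 c j k))) (fun c i => by
      cases c
      exacts [s2 (mem_of_image_subset x1 i), mem_of_image_subset x2 i])).exists_reach h2
  refine (hν.ioComplexity_le_of_t hs hM (((i0.mono s1).mono s2).mono s3)
    (fun k j => mem_of_image_subset x3 (k, j)) h3).trans ?_
  rw [Nat.cast_le]
  have hBn' : B * (d + 1) ≤ (n + 1) * (d + 1) := Nat.mul_le_mul_right _ hBn
  have hn : n + 1 ≤ (n + 1) * (d + 1) := Nat.le_mul_of_pos_right _ (by omega)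
  -- The three passes together, per block. By `B ≤ n + 1` loading a block is no dearer than one
  -- sweep over all rows.
  have key : (2 * (B * (d + 1)) + (n + 1) * (2 * (d + 1)) + B * 1) +
      (2 * (B * ((d + 1) + (d + 1) + 1)) + (n + 1) * (2 * ((d + 1) + (d + 1))) + B * 1) +
      (2 * (B * ((d + 1) + (d + 1))) + (n + 1) * (2 * ((d + 1) + (d + 1) + (d + 1) + 2)) +
        B * (d + 1)) ≤ 40 * ((n + 1) * (d + 1)) := by
    nlinarith
  have := Nat.mul_le_mul_left ((n + 1) / B + 1) key
  rw [mul_add, mul_add] at this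
  omega

end IsAttnDag

theorem attnCircuit.isAttnDag (n d : ℕ) :
    IsAttnDag (attnCircuit n d).dag (fun v : AttnNode n d => v) where
  parents v := (Finset.image_id (s := v.gate.parents)).symm
  output v hv := (attnCircuit.isOutput_iff v).1 hv

/-- The I/O complexity when all nodes are written to memory. -/
theorem attnCircuit.ioComplexity_le_naive {n d M : ℕ} (hM : 3 ≤ M) :
    (attnCircuit n d).dag.ioComplexity M ≤
      (200 * ((n + 1) ^ 2 * (d + 1) + (n + 1) * (d + 1) ^ 2) : ℕ) := by
  have h := Dag.Reach.univ_of_card_parents_le (G := (attnCircuit n d).dag) hM fun v => by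
    change (AttnNode.gate v).parents.card ≤ 2
    cases h : AttnNode.gate v <;>
      simp only [Gate.parents, Finset.card_empty, Finset.card_singleton] <;>
      first | omega | exact Finset.card_le_two
  refine (h.ioComplexity_le fun v _ => Finset.mem_univ v).trans ?_
  rw [Nat.cast_le]
  have : Fintype.card (attnCircuit n d).dag.V ≤
    40 * ((n + 1) ^ 2 * (d + 1) + (n + 1) * (d + 1) ^ 2) := AttnNode.card_le
  omega

/-! ### Tile sizes and comparison with the bound -/

/-- A product of matrices whose dimensions are at least the tile size `s` costs `O(a b c / s)`. -/
theorem Dag.mul_tiledCost_le {a b c s : ℕ} (hs : 0 < s) (ha : s ≤ a) (hb : s ≤ b) (hc : s ≤ c) :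
    s * Dag.tiledCost a b c s ≤ 20 * (a * b * c) := by
  have h1 : s * (a / s + 1) ≤ 2 * a := by linarith [Nat.mul_div_le a s, mul_add s (a / s) 1]
  have h2 : s * (c / s + 1) ≤ 2 * c := by linarith [Nat.mul_div_le c s, mul_add s (c / s) 1]
  have h3 : b * (4 * s) + s * s ≤ 5 * b * s := by nlinarith
  refine Nat.le_of_mul_le_mul_left ?_ hs
  calc s * (s * Dag.tiledCost a b c s)
      = (s * (a / s + 1)) * ((s * (c / s + 1)) * (b * (4 * s) + s * s)) := by
        rw [Dag.tiledCost]; ring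
    _ ≤ (2 * a) * ((2 * c) * (5 * b * s)) := by gcongr
    _ = s * (20 * (a * b * c)) := by ring

/-- Either quotient may be the minimum, so a schedule must be compared with both; the first
numerator is `d` times the second. -/
theorem le_mul_attnIOBound {n d M k : ℕ} {C : ℝ} (hM : 0 < M)
    (h₁ : (M : ℝ) * k ≤ C * (d * (n ^ 2 * d + n * d ^ 2)))
    (h₂ : √(M : ℝ) * k ≤ C * (n ^ 2 * d + n * d ^ 2)) :
    (k : ℝ) ≤ C * attnIOBound n d M := by
  have hM' : (0 : ℝ) < M := by exact_mod_cast hM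
  rw [attnIOBound]
  rcases min_choice (((n : ℝ) ^ 2 * (d : ℝ) ^ 2 + (n : ℝ) * (d : ℝ) ^ 3) / (M : ℝ))
    (((n : ℝ) ^ 2 * (d : ℝ) + (n : ℝ) * (d : ℝ) ^ 2) / √(M : ℝ)) with h | h <;> rw [h]
  · rw [← mul_div_assoc, le_div_iff₀ hM']
    linarith
  · rw [← mul_div_assoc, le_div_iff₀ (Real.sqrt_pos.2 hM')]
    linarith

/-- The cost with tiles of side about `√M`, for caches smaller than a `d × d` matrix. -/
theorem IsAttnDag.exists_ioComplexity_le_of_sqrt_le {G : Dag} {n d M : ℕ} {ν : AttnNode n d → G.V}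
    (hν : IsAttnDag G ν) (hM : 1024 ≤ M) (hn : M ≤ (n + 1) ^ 2) (hd : Nat.sqrt M ≤ d + 1) :
    ∃ k : ℕ, G.ioComplexity M ≤ k ∧ (k : ℝ) ≤ 1600 * attnIOBound (n + 1) (d + 1) M := by
  obtain ⟨r, hr⟩ : ∃ r, r = Nat.sqrt M := ⟨_, rfl⟩
  have hrM : r * r ≤ M := hr ▸ Nat.sqrt_le M
  have hMr : M < (r + 1) * (r + 1) := hr ▸ Nat.lt_succ_sqrt M
  have hr32 : 32 ≤ r := by rw [hr, Nat.le_sqrt]; omega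
  have hrn : r ≤ n + 1 := by nlinarith
  rw [← hr] at hd
  -- The quarter makes `2s + 2s² + 4` fit into `M`, and `r ≥ 32` ensures that `s` stays comparable
  -- with `√M`.
  obtain ⟨s, hs⟩ : ∃ s, s = r / 4 := ⟨_, rfl⟩
  have hs0 : 0 < s := by omega
  have hsr : 4 * s ≤ r := by omega
  have hrs : r + 1 ≤ 8 * s := by omega
  refine ⟨_, hν.ioComplexity_le_tiled hs0 (by nlinarith) (by omega), ?_⟩
  obtain ⟨N, hN⟩ : ∃ N, N = n + 1 := ⟨_, rfl⟩
  obtain ⟨D, hD⟩ : ∃ D, D = d + 1 := ⟨_, rfl⟩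
  rw [← hN] at hrn
  rw [← hD] at hd
  rw [← hN, ← hD]
  have t1 := Dag.mul_tiledCost_le (a := N) (b := D) (c := D) hs0 (by omega) (by omega) (by omega)
  have t2 := Dag.mul_tiledCost_le (a := N) (b := D) (c := N) hs0 (by omega) (by omega) (by omega)
  have t3 := Dag.mul_tiledCost_le (a := D) (b := N) (c := N) hs0 (by omega) (by omega) (by omega)
  have t4 := Dag.mul_tiledCost_le (a := D) (b := N) (c := D) hs0 (by omega) (by omega) (by omega)
  have t5 : s * N ^ 2 ≤ D * N ^ 2 := Nat.mul_le_mul_right _ (by omega)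
  obtain ⟨k, hk⟩ : ∃ k, k = 2 * Dag.tiledCost N D D s + 2 * Dag.tiledCost N D N s + 20 * N ^ 2 +
    Dag.tiledCost D N N s + Dag.tiledCost D N D s := ⟨_, rfl⟩
  rw [← hk]
  have hsk : s * k ≤ 100 * (N ^ 2 * D + N * D ^ 2) := by
    rw [hk]; nlinarith
  have hrk : (r + 1) * k ≤ 800 * (N ^ 2 * D + N * D ^ 2) :=
    calc (r + 1) * k ≤ 8 * s * k := Nat.mul_le_mul_right _ hrs
      _ = 8 * (s * k) := by ring
      _ ≤ 8 * (100 * (N ^ 2 * D + N * D ^ 2)) := Nat.mul_le_mul_left _ hsk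
      _ = _ := by ring
  refine le_mul_attnIOBound (by omega) ?_ ?_
  -- The bound with `√M` implies the one with `M`, since `r + 1 ≤ 2D`.
  · have : M * k ≤ 1600 * (D * (N ^ 2 * D + N * D ^ 2)) :=
      calc M * k ≤ (r + 1) * (r + 1) * k := Nat.mul_le_mul_right _ hMr.le
        _ = (r + 1) * ((r + 1) * k) := by ring
        _ ≤ (2 * D) * (800 * (N ^ 2 * D + N * D ^ 2)) := Nat.mul_le_mul (by omega) hrk
        _ = _ := by ring
    exact_mod_cast this
  · have hsq : √(M : ℝ) ≤ (r + 1 : ℕ) := by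
      rw [Real.sqrt_le_left (by positivity)]
      rw [pow_two]
      exact_mod_cast hMr.le
    have h1 : ((r + 1 : ℕ) : ℝ) * k ≤ 800 * ((N : ℝ) ^ 2 * D + N * D ^ 2) := by
      exact_mod_cast hrk
    have h2 := mul_le_mul_of_nonneg_right hsq (Nat.cast_nonneg (α := ℝ) k)
    have h3 : (0 : ℝ) ≤ (N : ℝ) ^ 2 * D + N * D ^ 2 := by positivity
    linarith

/-- The cost of the fused computation, for caches larger than a `d × d` matrix. -/
theorem IsAttnDag.exists_ioComplexity_le_of_lt_sqrt {G : Dag} {n d M : ℕ} {ν : AttnNode n d → G.V}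
    (hν : IsAttnDag G ν) (hM : 1024 ≤ M) (hnd : M ≤ (n + 1) * (d + 1)) (hd : d + 1 < Nat.sqrt M) :
    ∃ k : ℕ, G.ioComplexity M ≤ k ∧ (k : ℝ) ≤ 2800 * attnIOBound (n + 1) (d + 1) M := by
  obtain ⟨r, hr⟩ : ∃ r, r = Nat.sqrt M := ⟨_, rfl⟩
  have hrM : r * r ≤ M := hr ▸ Nat.sqrt_le M
  have hr32 : 32 ≤ r := by rw [hr, Nat.le_sqrt]; omega
  rw [← hr] at hd
  -- This is `(d + 1) / 4` rounded up: at most `d + 1`, and small enough for the tile to fit.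
  obtain ⟨s, hs⟩ : ∃ s, s = (d + 4) / 4 := ⟨_, rfl⟩
  have hs0 : 0 < s := by omega
  have hds : d + 1 ≤ 4 * s := by omega
  have hsr : 3 * s ≤ r := by omega
  -- The fused passes need `7 B (d + 1)` plus lower terms; `16` leaves room for these, and `(d + 1)²
  -- < M` makes `B` positive.
  obtain ⟨B, hB⟩ : ∃ B, B = M / (16 * (d + 1)) := ⟨_, rfl⟩
  have hB0 : 0 < B := hB ▸ Nat.div_pos (by nlinarith) (by omega)
  have hBM : 16 * (d + 1) * B ≤ M := hB ▸ Nat.mul_div_le _ _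
  have hMB : M ≤ 32 * (d + 1) * B := by
    have := Nat.lt_mul_div_succ M (b := 16 * (d + 1)) (by omega)
    rw [← hB] at this
    nlinarith
  have hBn : B ≤ n + 1 := by
    by_contra! h
    nlinarith
  refine ⟨_, hν.ioComplexity_le_fused (B := B) hs0 (by nlinarith) hB0 (by nlinarith) hBn, ?_⟩
  obtain ⟨N, hN⟩ : ∃ N, N = n + 1 := ⟨_, rfl⟩
  obtain ⟨D, hD⟩ : ∃ D, D = d + 1 := ⟨_, rfl⟩
  have hDN : D ≤ N := by
    by_contra! h
    rw [hN, hD] at h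
    nlinarith
  have hsD : s ≤ D := by omega
  rw [← hN, ← hD] at hnd
  rw [← hD] at hd hds hMB
  rw [← hN] at hBn
  rw [← hN, ← hD]
  have hD0 : 0 < D := by omega
  have t1 := Dag.mul_tiledCost_le (a := N) (b := D) (c := D) hs0 (by omega) hsD hsD
  have t2 := Dag.mul_tiledCost_le (a := D) (b := N) (c := D) hs0 hsD (by omega) hsD
  have u : ∀ T, s * T ≤ 20 * (N * D * D) → T ≤ 80 * (N * D) := fun T hT => by
    refine Nat.le_of_mul_le_mul_left ?_ hD0
    have := Nat.mul_le_mul_right T hds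
    nlinarith
  have u1 := u _ t1
  have u2 := u _ (t2.trans (by rw [mul_comm D N]))
  obtain ⟨k, hk⟩ : ∃ k, k = 2 * Dag.tiledCost N D D s + (N / B + 1) * (40 * (N * D)) +
    Dag.tiledCost D N D s := ⟨_, rfl⟩
  rw [← hk]
  have hNB : B * (N / B + 1) ≤ 2 * N := by linarith [Nat.mul_div_le N B, mul_add B (N / B) 1]
  have hf : M * ((N / B + 1) * (40 * (N * D))) ≤ 2560 * (N * D * (N * D)) :=
    calc M * ((N / B + 1) * (40 * (N * D)))
        ≤ 32 * D * B * ((N / B + 1) * (40 * (N * D))) := Nat.mul_le_mul_right _ hMB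
      _ = 32 * D * (B * (N / B + 1)) * (40 * (N * D)) := by ring
      _ ≤ 32 * D * (2 * N) * (40 * (N * D)) := by gcongr
      _ = _ := by ring
  have hMk : M * k ≤ 2800 * (N * D * (N * D)) := by
    -- The products `S`, `h`, `g` cost `O(N D)`; `M ≤ N D` makes this no more than `(N D)² / M`.
    have h1 : M * (2 * Dag.tiledCost N D D s + Dag.tiledCost D N D s) ≤
        N * D * (240 * (N * D)) := Nat.mul_le_mul hnd (by omega)
    calc M * k = M * (2 * Dag.tiledCost N D D s + Dag.tiledCost D N D s) +
          M * ((N / B + 1) * (40 * (N * D))) := by rw [hk]; ring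
      _ ≤ N * D * (240 * (N * D)) + 2560 * (N * D * (N * D)) := Nat.add_le_add h1 hf
      _ = _ := by ring
  have hMkR : (M : ℝ) * k ≤ 2800 * ((N : ℝ) * D * (N * D)) := by exact_mod_cast hMk
  have hx : (0 : ℝ) ≤ (N : ℝ) * D ^ 2 := by positivity
  have hM0 : (0 : ℝ) < √(M : ℝ) := Real.sqrt_pos.2 (by exact_mod_cast (by omega : 0 < M))
  have hDD : D ^ 2 ≤ M := (pow_two D).trans_le ((Nat.mul_le_mul hd.le hd.le).trans hrM)
  have hDM : (D : ℝ) ≤ √(M : ℝ) := Real.le_sqrt_of_sq_le (by exact_mod_cast hDD)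
  refine le_mul_attnIOBound (by omega) ?_ ?_
  · have := mul_nonneg (Nat.cast_nonneg (α := ℝ) D) hx
    linarith
  -- After multiplication by `√M` this follows from the estimate of `M * k` and `D ≤ √M`.
  · refine le_of_mul_le_mul_left ?_ hM0
    rw [← mul_assoc, Real.mul_self_sqrt (Nat.cast_nonneg M)]
    have h1 : (0 : ℝ) ≤ (N : ℝ) ^ 2 * D := by positivity
    calc (M : ℝ) * k ≤ 2800 * (D * (N ^ 2 * D)) := by linarith
      _ ≤ 2800 * (√(M : ℝ) * (N ^ 2 * D + N * D ^ 2)) := by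
        gcongr
        linarith
      _ = _ := by ring

theorem attnCircuit.exists_ioComplexity_le {n d M : ℕ} (hM : 3 ≤ M)
    (hnd : M ≤ (n + 1) * (d + 1)) (hn : M ≤ (n + 1) ^ 2) :
    ∃ k : ℕ, (attnCircuit n d).dag.ioComplexity M ≤ k ∧
      (k : ℝ) ≤ 204800 * attnIOBound (n + 1) (d + 1) M := by
  have hB : 0 ≤ attnIOBound (n + 1) (d + 1) M := by rw [attnIOBound]; positivity
  rcases lt_or_ge M 1024 with h | h
  -- For bounded `M` both quotients are comparable with the size of the graph or larger; `200 ·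
  -- 1024` is the final constant.
  · refine ⟨_, attnCircuit.ioComplexity_le_naive hM, le_mul_attnIOBound (by omega) ?_ ?_⟩ <;>
      push_cast
    · have hM' : (M : ℝ) ≤ 1024 := by exact_mod_cast h.le
      have hK : (0 : ℝ) ≤ ((n : ℝ) + 1) ^ 2 * (d + 1) + (n + 1) * (d + 1) ^ 2 := by positivity
      have hdK := mul_nonneg (Nat.cast_nonneg (α := ℝ) d) hK
      have := mul_le_mul_of_nonneg_right hM' hK
      linarith
    · have hM' : √(M : ℝ) ≤ 1024 := by
        rw [Real.sqrt_le_left (by norm_num)]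
        exact_mod_cast (by omega : M ≤ 1024 ^ 2)
      have hK : (0 : ℝ) ≤ ((n : ℝ) + 1) ^ 2 * (d + 1) + (n + 1) * (d + 1) ^ 2 := by positivity
      have := mul_le_mul_of_nonneg_right hM' hK
      linarith
  · rcases le_or_gt (Nat.sqrt M) (d + 1) with hd | hd
    · obtain ⟨k, hk, hk'⟩ := (attnCircuit.isAttnDag n d).exists_ioComplexity_le_of_sqrt_le h hn hd
      exact ⟨k, hk, by linarith⟩
    · obtain ⟨k, hk, hk'⟩ := (attnCircuit.isAttnDag n d).exists_ioComplexity_le_of_lt_sqrt h hnd hd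
      exact ⟨k, hk, by linarith⟩

theorem theorem1p1 :
    ∃ c C : ℝ, 0 < c ∧ 0 < C ∧
      (∀ n d M : ℕ, 0 < n → 0 < d → 0 < M →
        ∀ G : Circuit (AttnInput n d), G.IsAttnBackward →
          ENNReal.ofReal (c * attnIOBound n d M) ≤ ((G.dag.ioComplexity M : ℕ∞) : ℝ≥0∞)) ∧
      (∀ n d M : ℕ, 3 ≤ M → M ≤ n * d → M ≤ n ^ 2 →
        ∃ G : Circuit (AttnInput n d), G.IsAttnBackward ∧ Nonempty G.StdLayout ∧
          ((G.dag.ioComplexity M : ℕ∞) : ℝ≥0∞) ≤ ENNReal.ofReal (C * attnIOBound n d M)) := by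
  refine ⟨1 / 64, 204800, by norm_num, by norm_num,
    fun n d M hn hd hM G h => h.le_ioComplexity hn hd hM, fun n d M hM hnd hn => ?_⟩
  obtain ⟨n, rfl⟩ := Nat.exists_eq_succ_of_ne_zero (n := n) (by rintro rfl; omega)
  obtain ⟨d, rfl⟩ := Nat.exists_eq_succ_of_ne_zero (n := d) (by rintro rfl; omega)
  refine ⟨attnCircuit n d, (attnCircuit.layout n d).isAttnBackward, ⟨attnCircuit.layout n d⟩, ?_⟩
  obtain ⟨k, hk, hk'⟩ := attnCircuit.exists_ioComplexity_le hM hnd hn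
  calc (((attnCircuit n d).dag.ioComplexity M : ℕ∞) : ℝ≥0∞) ≤ ((k : ℕ∞) : ℝ≥0∞) := by
        exact_mod_cast hk
    _ = ENNReal.ofReal (k : ℝ) := by simp
    _ ≤ _ := ENNReal.ofReal_le_ofReal hk'
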